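/- Let $\sigma\ge 0$, $\mu\in\mathbb R$, $\alpha_1,\alpha_2,\beta_1,\beta_2,c_1,c_2>0$ and $q>0$. For $\chi\in\{\tfrac12,1,\tfrac32,2,\tfrac52\}$ put $k=\chi-\tfrac12$, $\Theta_k(x)=\delta_{k,0}+2\sum_{n\ge1}n^{2k}e^{-n^2x}$ $(x>0)$ and $$\pi_\chi(x)=\mathbf 1_{x>0}\,c_1\beta_1e^{-\alpha_1x}\Theta_k(x\beta_1)+\mathbf 1_{x<0}\,c_2\beta_2e^{\alpha_2x}\Theta_k(-x\beta_2),$$ and let $$\Psi(z)=\tfrac12\sigma^2z^2-i\mu z-\int_{\mathbb R}\bigl(e^{izx}-1-izx\,h\bigr)\pi_\chi(x)\,dx,\qquad z\in\mathbb R,$$ with $h=0$ if $\chi<2$ and $h=1$ if $\chi\ge2$, be the characteristic exponent of the Lévy process with triplet $(\mu,\sigma,\pi_\chi(x)dx)$. Then there is exactly one meromorphic function $\phi$ on $\mathbb C$ (up to the values at its poles and removable singularities) with $\phi(iy)=-\Psi(y)$ for $y\in\mathbb R$, i.e. $\phi(z)=-\Psi(-iz)$. "The large positive solutions of $f(\zeta)=q$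 satisfy $\zeta\sim a_n+O(e_n)$" means: there are $R>0$ and $N\in\mathbb N$ such that the real solutions in $(R,\infty)$ can be listed, each exactly once, as $\zeta_N<\zeta_{N+1}<\cdots$ with $\zeta_n=a_n+O(e_n)$ as $n\to\infty$. **(A)** The large positive solutions $\zeta$ of $\phi(-\zeta)=q$ (so $-\zeta$ is a large negative root of $\phi=q$) satisfy the following. * $\chi=\frac12$. If $\sigma\ne0$: $$\zeta\sim\beta_2n^2+\alpha_2+\frac4{\sigma^2}\frac{c_2}{\beta_2}n^{-4}+\frac8{\sigma^4}\frac{c_2}{\beta_2^2}(\mu-\alpha_2\sigma^2)n^{-6}+O(n^{-8}).$$ If $\sigma=0$, $\mu\neq0$: $$\zeta\sim\beta_2n^2+\alpha_2-\frac{2c_2}{\mu}n^{-2}+\frac2{\mu^2}\frac{c_2}{\beta_2}(\mu\alpha_2+\gamma+q)n^{-4}+O(n^{-5}).$$ * $\chi=1$. If $\sigma\ne0$: $$\zeta\sim\beta_2n^2+\alpha_2+\frac4{\sigma^2}\frac{c_2}{\beta_2}n^{-3}+\frac8{\sigma^4}\frac{c_2}{\beta_2^2}(\mu-\alpha_2\sigma^2)n^{-5}+\frac{16}{\sigma^4}\frac{c_2(c_1+c_2)}{\beta_2^3}n^{-7}\ln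 n+O(n^{-7}).$$ If $\sigma=0$, $\mu\ne0$: $$\zeta\sim\beta_2n^2+\alpha_2-\frac{2c_2}\mu n^{-1}+\frac2{\mu^2}\frac{c_2}{\beta_2}\bigl(2(c_1+c_2)\ln n+c_0\bigr)n^{-3}+O(n^{-4}\ln n),\quad c_0=\mu\alpha_2-\gamma+q+c_1\ln\tfrac{\beta_2}{\beta_1}.$$ * $\chi=\frac32$. If $\sigma\ne0$: $$\zeta\sim\beta_2n^2+\alpha_2+\frac4{\sigma^2}\frac{c_2}{\beta_2}n^{-2}+\frac8{\sigma^4}\frac{c_2}{\beta_2^2}(\mu-\alpha_2\sigma^2)n^{-4}+\frac{8\pi}{\sigma^4}\frac{c_1c_2}{\beta_2^2\sqrt{\beta_1\beta_2}}n^{-5}+O(n^{-6}).$$ If $\sigma=0$, $\mu\ne0$: $$\zeta\sim\beta_2n^2+\alpha_2-\frac{2c_2}\mu+\frac{2\pi}{\mu^2}\frac{c_1c_2}{\sqrt{\beta_1\beta_2}}n^{-1}+O(n^{-2}).$$ * $\chi=2$. If $\sigma\ne0$: $$\zeta\sim\beta_2n^2+\alpha_2+\frac4{\sigma^2}\frac{c_2}{\beta_2}n^{-1}+O(n^{-3}\ln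 n).$$ * $\chi=\frac52$. If $\sigma\ne0$: $$\zeta\sim\beta_2n^2+\alpha_2+\frac4{\sigma^2}\frac{c_2}{\beta_2}-\frac{8\pi}{\sigma^4}\frac{c_1c_2}{(\beta_1\beta_2)^{3/2}}n^{-1}+O(n^{-2}).$$ If $\sigma=0$: $$\zeta\sim\beta_2(n+w_0)^2+\alpha_2+\frac{2\rho}{\pi^2}\frac{c_2\beta_2^2\beta_1^3}{c_1^2\beta_2^3+c_2^2\beta_1^3}+O(n^{-1}),\qquad w_0=\frac1\pi\arctan\frac{c_2\beta_1^{3/2}}{c_1\beta_2^{3/2}}.$$ **(B)** The large positive solutions $\zeta$ of $\phi(\zeta)=q$ satisfy the same expansions with the indices $1$ and $2$ interchanged everywhere and with $\mu$, $\rho$ replaced by $-\mu$, $-\rho$ (the constant $\gamma$ is unchanged). Here $\gamma$ and $\rho$ are the following real constants. With $s_1=(\alpha_1-iz)/\beta_1$, $s_2=(\alpha_2+iz)/\beta_2$ and $\psi$ the digamma function, consider $$\tfrac12\sigma^2z^2-i\mu z-\sum_{j=1}^2c_j\pi s_j^{-1/2}\coth(\pi\sqrt{s_j})+\gamma\quad(\chi=\tfrac12),$$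 $$\tfrac12\sigma^2z^2-i\mu z+\sum_{j=1}^2c_j\bigl[\psi(i\sqrt{s_j})+\psi(-i\sqrt{s_j})\bigr]-\gamma\quad(\chi=1),$$ $$\tfrac12\sigma^2z^2-i\rho z-\sum_{j=1}^2c_j\pi s_j^{3/2}\coth(\pi\sqrt{s_j})+\gamma\quad(\chi=\tfrac52).$$ In each case $\gamma$ is determined by the condition that the expression vanishes at $z=0$, and for $\chi=\frac52$ the constant $\rho$ is determined by the condition that its derivative at $z=0$ equals $-i\mu$. -/

import Mathlib

open Asymptotics

/-- Parameters `(σ, μ, α₁, α₂, β₁, β₂, c₁, c₂)` of the theta-type Lévy processes: the Gaussian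
coefficient `σ ≥ 0`, the drift parameter `μ ∈ ℝ` of the characteristic triplet, and the positive
parameters of the Lévy density. -/
structure ThetaParams where
  σ : ℝ
  μ : ℝ
  α₁ : ℝ
  α₂ : ℝ
  β₁ : ℝ
  β₂ : ℝ
  c₁ : ℝ
  c₂ : ℝ
  σ_nonneg : 0 ≤ σ
  α₁_pos : 0 < α₁
  α₂_pos : 0 < α₂
  β₁_pos : 0 < β₁
  β₂_pos : 0 < β₂
  c₁_pos : 0 < c₁
  c₂_pos : 0 < c₂

/-- `Θ_k(x) = δ_{k,0} + 2 ∑_{n ≥ 1} n^{2k} e^{-n² x}`, for real `k` and `x > 0`. -/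
noncomputable def thetaFun (k x : ℝ) : ℝ :=
  (if k = 0 then 1 else 0) +
    2 * ∑' n : ℕ, ((n : ℝ) + 1) ^ (2 * k) * Real.exp (-((n : ℝ) + 1) ^ 2 * x)

/-- The Lévy density `π_χ`, with `k = χ - 1/2`. -/
noncomputable def levyDensity (P : ThetaParams) (χ x : ℝ) : ℝ :=
  if 0 < x then
    P.c₁ * P.β₁ * Real.exp (-P.α₁ * x) * thetaFun (χ - 1 / 2) (x * P.β₁)
  else if x < 0 then
    P.c₂ * P.β₂ * Real.exp (P.α₂ * x) * thetaFun (χ - 1 / 2) (-x * P.β₂)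
  else 0

/-- The cutoff function in the Lévy–Khintchine formula: `h ≡ 0` when `χ < 2` (jumps of bounded
variation) and `h ≡ 1` when `χ ≥ 2`. -/
noncomputable def levyCutoff (χ : ℝ) : ℝ := if χ < 2 then 0 else 1

/-- The characteristic exponent of the Lévy process with triplet `(μ, σ, π_χ(x) dx)`, given by the
Lévy–Khintchine formula
`Ψ(z) = σ² z² / 2 - i μ z - ∫ (e^{izx} - 1 - i z x h) π_χ(x) dx` for real `z`. -/
noncomputable def charExponent (P : ThetaParams) (χ z : ℝ) : ℂ :=
  1 / 2 * (P.σ : ℂ) ^ 2 * (z : ℂ) ^ 2 - Complex.I * P.μ * z -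
    ∫ x : ℝ, (Complex.exp (Complex.I * z * x) - 1 - Complex.I * z * x * levyCutoff χ) *
      (levyDensity P χ x : ℂ)

/-- `φ` is the Laplace exponent `φ(z) = -Ψ(-iz)`: the meromorphic function on `ℂ` (in normal form,
so that its values are determined everywhere) that equals `-Ψ(-iz)` on the imaginary axis, where
`-iz` is real. -/
def IsLaplaceExponent (P : ThetaParams) (χ : ℝ) (φ : ℂ → ℂ) : Prop :=
  MeromorphicNFOn φ Set.univ ∧ ∀ y : ℝ, φ (Complex.I * y) = -charExponent P χ y

/-- `coth z = cosh z / sinh z`. -/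
noncomputable def complexCoth (z : ℂ) : ℂ := Complex.cosh z / Complex.sinh z

/-- Closed form of the characteristic exponent for `χ = 1/2`; here it serves to fix the
constant `γ`. -/
noncomputable def closedHalf (P : ThetaParams) (ρ γ : ℝ) (z : ℂ) : ℂ :=
  1 / 2 * (P.σ : ℂ) ^ 2 * z ^ 2 - Complex.I * ρ * z
    - P.c₁ * Real.pi * ((P.α₁ - Complex.I * z) * (P.β₁ : ℂ)⁻¹) ^ (-(1 / 2) : ℂ) *
        complexCoth (Real.pi * ((P.α₁ - Complex.I * z) * (P.β₁ : ℂ)⁻¹) ^ (1 / 2 : ℂ))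
    - P.c₂ * Real.pi * ((P.α₂ + Complex.I * z) * (P.β₂ : ℂ)⁻¹) ^ (-(1 / 2) : ℂ) *
        complexCoth (Real.pi * ((P.α₂ + Complex.I * z) * (P.β₂ : ℂ)⁻¹) ^ (1 / 2 : ℂ))
    + γ

/-- Closed form of the characteristic exponent for `χ = 1`; here it serves to fix the
constant `γ`. -/
noncomputable def closedOne (P : ThetaParams) (ρ γ : ℝ) (z : ℂ) : ℂ :=
  1 / 2 * (P.σ : ℂ) ^ 2 * z ^ 2 - Complex.I * ρ * z
    + P.c₁ * Complex.digamma
        (Complex.I * ((P.α₁ - Complex.I * z) * (P.β₁ : ℂ)⁻¹) ^ (1 / 2 : ℂ))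
    + P.c₁ * Complex.digamma
        (-Complex.I * ((P.α₁ - Complex.I * z) * (P.β₁ : ℂ)⁻¹) ^ (1 / 2 : ℂ))
    + P.c₂ * Complex.digamma
        (Complex.I * ((P.α₂ + Complex.I * z) * (P.β₂ : ℂ)⁻¹) ^ (1 / 2 : ℂ))
    + P.c₂ * Complex.digamma
        (-Complex.I * ((P.α₂ + Complex.I * z) * (P.β₂ : ℂ)⁻¹) ^ (1 / 2 : ℂ))
    - γ

/-- Closed form of the characteristic exponent for `χ = 5/2`; here it serves to fix the
constant `ρ`. -/
noncomputable def closedFiveHalves (P : ThetaParams) (ρ γ : ℝ) (z : ℂ) : ℂ :=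
  1 / 2 * (P.σ : ℂ) ^ 2 * z ^ 2 - Complex.I * ρ * z
    - P.c₁ * Real.pi * ((P.α₁ - Complex.I * z) * (P.β₁ : ℂ)⁻¹) ^ (3 / 2 : ℂ) *
        complexCoth (Real.pi * ((P.α₁ - Complex.I * z) * (P.β₁ : ℂ)⁻¹) ^ (1 / 2 : ℂ))
    - P.c₂ * Real.pi * ((P.α₂ + Complex.I * z) * (P.β₂ : ℂ)⁻¹) ^ (3 / 2 : ℂ) *
        complexCoth (Real.pi * ((P.α₂ + Complex.I * z) * (P.β₂ : ℂ)⁻¹) ^ (1 / 2 : ℂ))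
    + γ

/-- The large positive solutions of `f(ζ) = q` can be numbered as `ζ_N < ζ_{N+1} < …` in such a way
that `ζ_n = a_n + O(e_n)` as `n → ∞`. Every positive solution beyond some bound `R` (`f` being
analytic there, that is, not at a pole) occurs exactly once in the list. -/
def LargeRootsExpansion (f : ℂ → ℂ) (q : ℝ) (a e : ℕ → ℝ) : Prop :=
  ∃ ζ : ℕ → ℝ,
    (∃ (N : ℕ) (R : ℝ), 0 < R ∧ StrictMonoOn ζ (Set.Ici N) ∧
      ζ '' Set.Ici N = {x : ℝ | R < x ∧ AnalyticAt ℂ f (x : ℂ) ∧ f (x : ℂ) = (q : ℂ)}) ∧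
    (fun n => ζ n - a n) =O[Filter.atTop] e

/-!
Expanding the theta functions, the Lévy density is a superposition of exponentials, and the
Lévy–Khintchine integral can be evaluated termwise. Up to a quadratic polynomial, the Laplace
exponent is therefore a partial fraction series with simple poles at `α₁ + β₁n²` and
`-(α₂ + β₂n²)` (`neg_charExponent_eq_laplaceSeries`). This gives existence, and a meromorphic
function is determined by its values on the imaginary axis.

For `ζ > 0` between two consecutive poles, no term of `(φ(-ζ) - q) / ζ` decreases in `ζ`, and the
term `-q / ζ` increases. Since `φ(-ζ)` runs from `-∞` to `+∞` there, each gap contains exactly one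
root (`existsUnique_root`), so that the large roots can be numbered by poles.

Their position is computed in the variable `w`, `ζ = α₂ + β₂w²`. There, the series over the poles
`-(α₂ + β₂n²)` is a cotangent up to a function that stays regular through the poles, and the other
series is a hyperbolic cotangent or a logarithmic sum, whose asymptotics are elementary. With
`m = 2χ - 1`, the equation `φ(-ζ) = q` becomes `c₂πw^(m-1) cot(πw) = B(w)`, where the expansion of
`B` at infinity is explicit. The sign of `B` decides which of the two neighbouring poles numbers the
root; with that number `n`, `w = n + arctan(c₂πw^(m-1) / B(w)) / π` (`largeRootsExpansion_of_cot`).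

When `B` dominates, the arctangent is small and one substitution gives the expansion
(`largeRootsExpansion_of_isBigO`); all cases but one are instances of this, with different orders of
the leading and subleading parts of `B`. In the case `χ = 5/2`, `σ = 0`, both sides are of order
`w³`; the arctangent is then linearized at the limit of the quotient
(`isBigO_arctan_div_sub`), which produces the shift of the index.

The constant `γ` is identified by evaluating the closed forms at `0`, and `ρ` by differentiating the
closed form there. The positive roots of `φ = q` are obtained from the negative ones by passing to
the dual process `-X` (`IsLaplaceExponent.swap`).
-/

section

open Filter Topology MeasureTheory

/-! ### Stieltjes series -/

/-- The Stieltjes-type series `∑ tₙ / (pₙ - z)` with masses `tₙ` at the points `pₙ`. -/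
noncomputable def stieltjes (t p : ℕ → ℝ) (z : ℂ) : ℂ := ∑' n, (t n : ℂ) / (p n - z)

theorem norm_stieltjes_term_le {t p : ℝ} {z : ℂ} (hp : 0 < p) (hz : 2 * ‖z‖ ≤ p) :
    ‖(t : ℂ) / (p - z)‖ ≤ 2 * (|t| / p) := by
  have h1 : p / 2 ≤ ‖(p : ℂ) - z‖ := by
    have := norm_sub_norm_le (p : ℂ) z
    rw [Complex.norm_real, Real.norm_of_nonneg hp.le] at this
    linarith
  rw [norm_div, Complex.norm_real, Real.norm_eq_abs, show 2 * (|t| / p) = |t| / (p / 2) by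
    field_simp]
  gcongr

theorem summable_stieltjes {t p : ℕ → ℝ} (hp : Tendsto p atTop atTop)
    (ht : Summable fun n => |t n| / p n) (z : ℂ) :
    Summable fun n => (t n : ℂ) / (p n - z) := by
  refine Summable.of_norm_bounded_eventually_nat (ht.mul_left 2) ?_
  filter_upwards [hp.eventually_gt_atTop 0, hp.eventually_ge_atTop (2 * ‖z‖)] with n h0 h1
  exact norm_stieltjes_term_le h0 h1

theorem summable_stieltjes_real {t p : ℕ → ℝ} (hp : Tendsto p atTop atTop)
    (ht : Summable fun n => |t n| / p n) (x : ℝ) :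
    Summable fun n => t n / (p n - x) := by
  have := summable_stieltjes hp ht x
  exact_mod_cast this

theorem analyticAt_stieltjes {t p : ℕ → ℝ} (hp : Tendsto p atTop atTop)
    (ht : Summable fun n => |t n| / p n) {z : ℂ} (hz : ∀ n, t n = 0 ∨ (p n : ℂ) ≠ z) :
    AnalyticAt ℂ (stieltjes t p) z := by
  -- Only finitely many poles are close to `z`; beyond them the series converges normally.
  obtain ⟨N, hN⟩ := eventually_atTop.1
    ((hp.eventually_gt_atTop 0).and (hp.eventually_ge_atTop (2 * (‖z‖ + 1))))
  have hsplit : stieltjes t p = fun w => (∑ n ∈ Finset.range N, (t n : ℂ) / (p n - w)) +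
      ∑' n, (t (n + N) : ℂ) / (p (n + N) - w) := by
    ext w
    exact ((summable_stieltjes hp ht w).sum_add_tsum_nat_add N).symm
  have htail : DifferentiableOn ℂ (fun w => ∑' n, (t (n + N) : ℂ) / (p (n + N) - w))
      (Metric.ball 0 (‖z‖ + 1)) := by
    refine Complex.differentiableOn_tsum_of_summable_norm
      (((summable_nat_add_iff N).2 ht).mul_left 2) (fun n => ?_) Metric.isOpen_ball
      (fun n w hw => ?_)
    · refine DifferentiableOn.div (by fun_prop) (by fun_prop) fun w hw h0 => ?_
      obtain ⟨h1, h2⟩ := hN (n + N) (by omega)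
      have : (p (n + N) : ℂ) = w := sub_eq_zero.1 h0
      rw [mem_ball_zero_iff, ← this, Complex.norm_real, Real.norm_of_nonneg h1.le] at hw
      have := norm_nonneg z
      linarith
    · obtain ⟨h1, h2⟩ := hN (n + N) (by omega)
      rw [mem_ball_zero_iff] at hw
      exact norm_stieltjes_term_le h1 (by linarith)
  rw [hsplit]
  refine AnalyticAt.add ?_ (htail.analyticAt (Metric.isOpen_ball.mem_nhds (by simp)))
  refine Finset.analyticAt_fun_sum _ fun n _ => ?_
  rcases hz n with h | h
  · simpa [h] using analyticAt_const
  · exact analyticAt_const.div (analyticAt_const.sub analyticAt_id) (sub_ne_zero.2 h)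

/-- Isolating the pole at `p n`: the remaining series has mass zero there. -/
theorem stieltjes_eq_add {t p : ℕ → ℝ} (hp : Tendsto p atTop atTop)
    (ht : Summable fun n => |t n| / p n) (n : ℕ) (z : ℂ) :
    stieltjes t p z = t n / (p n - z) + stieltjes (Function.update t n 0) p z := by
  rw [stieltjes, (summable_stieltjes hp ht z).tsum_eq_add_tsum_ite n, stieltjes]
  congr 2
  ext k
  by_cases hk : k = n
  · subst hk; simp
  · simp [hk]

theorem summable_update {t p : ℕ → ℝ} (ht : Summable fun n => |t n| / p n) (n : ℕ) :
    Summable fun k => |Function.update t n 0 k| / p k := by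
  refine (ht.update n 0).congr fun k => ?_
  by_cases hk : k = n
  · subst hk; simp
  · simp [hk]

theorem analyticAt_stieltjes_update {t p : ℕ → ℝ} (hp : Tendsto p atTop atTop)
    (hinj : Function.Injective p) (ht : Summable fun n => |t n| / p n) (n : ℕ) :
    AnalyticAt ℂ (stieltjes (Function.update t n 0) p) (p n) := by
  refine analyticAt_stieltjes hp (summable_update ht n) fun k => ?_
  by_cases hk : k = n
  · subst hk; simp
  · exact Or.inr fun h => hk (hinj (by exact_mod_cast h))

theorem meromorphicAt_stieltjes {t p : ℕ → ℝ} (hp : Tendsto p atTop atTop)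
    (hinj : Function.Injective p) (ht : Summable fun n => |t n| / p n) (z : ℂ) :
    MeromorphicAt (stieltjes t p) z := by
  by_cases hz : ∀ n, t n = 0 ∨ (p n : ℂ) ≠ z
  · exact (analyticAt_stieltjes hp ht hz).meromorphicAt
  · push Not at hz
    obtain ⟨n, -, rfl⟩ := hz
    rw [show stieltjes t p = _ from funext (stieltjes_eq_add hp ht n)]
    refine MeromorphicAt.fun_add ?_ (analyticAt_stieltjes_update hp hinj ht n).meromorphicAt
    exact (MeromorphicAt.const _ _).fun_div
      ((MeromorphicAt.const _ _).fun_sub (MeromorphicAt.id _))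

theorem stieltjes_ofReal (t p : ℕ → ℝ) (x : ℝ) :
    stieltjes t p x = ((∑' n, t n / (p n - x) : ℝ) : ℂ) := by
  rw [stieltjes, Complex.ofReal_tsum]
  congr 1; ext n; push_cast; rfl

/-! ### The Lévy–Khintchine integral of an exponential density and theta weights -/

theorem norm_exp_I_mul_sub_one_sub_le (u : ℝ) :
    ‖Complex.exp (Complex.I * u) - 1 - Complex.I * u‖ ≤ 3 * |u| ^ 2 := by
  have hn : ‖Complex.I * (u : ℂ)‖ = |u| := by simp
  rcases le_total |u| 1 with h | h
  · refine (Complex.norm_exp_sub_one_sub_id_le (by rwa [hn])).trans ?_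
    rw [hn]; nlinarith [sq_nonneg |u|]
  · calc ‖Complex.exp (Complex.I * u) - 1 - Complex.I * u‖
        ≤ ‖Complex.exp (Complex.I * u) - 1‖ + ‖Complex.I * (u : ℂ)‖ := norm_sub_le _ _
      _ ≤ |u| + |u| := by
          rw [hn]
          gcongr
          exact Real.norm_exp_I_mul_ofReal_sub_one_le
      _ ≤ 3 * |u| ^ 2 := by nlinarith

/-- The factor `e^{izx} - 1 - izxh` of the Lévy–Khintchine integrand, `h ∈ {0, 1}`. It vanishes to
order `h + 1` at `x = 0`, which compensates the singularity of the Lévy density. -/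
noncomputable def levyKernel (h : ℕ) (z x : ℝ) : ℂ :=
  Complex.exp (Complex.I * z * x) - 1 - Complex.I * z * x * h

theorem levyKernel_neg (h : ℕ) (z x : ℝ) : levyKernel h z (-x) = levyKernel h (-z) x := by
  simp [levyKernel]

theorem continuous_levyKernel (h : ℕ) (z : ℝ) : Continuous (levyKernel h z) := by
  unfold levyKernel; fun_prop

theorem norm_levyKernel_le {h : ℕ} (hh : h < 2) (z x : ℝ) :
    ‖levyKernel h z x‖ ≤ 3 * |z * x| ^ (h + 1) := by
  have e : Complex.I * z * x = Complex.I * ((z * x : ℝ) : ℂ) := by push_cast; ring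
  unfold levyKernel
  rw [e]
  interval_cases h
  · have := Real.norm_exp_I_mul_ofReal_sub_one_le (x := z * x)
    simp only [Nat.cast_zero, mul_zero, sub_zero, zero_add, pow_one]
    rw [Real.norm_eq_abs] at this
    have := abs_nonneg (z * x)
    linarith
  · simpa using norm_exp_I_mul_sub_one_sub_le (z * x)

theorem integral_pow_mul_exp_neg {p : ℝ} (hp : 0 < p) (k : ℕ) :
    ∫ x in Set.Ioi (0 : ℝ), x ^ k * Real.exp (-(p * x)) = k.factorial / p ^ (k + 1) := by
  have := Real.integral_rpow_mul_exp_neg_mul_Ioi (a := k + 1) (by positivity) hp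
  rw [Real.Gamma_nat_eq_factorial] at this
  simp only [add_sub_cancel_right, Real.rpow_natCast] at this
  rw [this]
  norm_cast
  rw [one_div, inv_pow]
  field_simp

theorem integrableOn_pow_mul_exp_neg {p : ℝ} (hp : 0 < p) (k : ℕ) :
    IntegrableOn (fun x : ℝ => x ^ k * Real.exp (-(p * x))) (Set.Ioi 0) := by
  refine Integrable.of_integral_ne_zero ?_
  rw [integral_pow_mul_exp_neg hp]
  positivity

theorem norm_levyKernel_mul_exp_le {h : ℕ} (hh : h < 2) (z p : ℝ) {x : ℝ} (hx : 0 < x) :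
    ‖levyKernel h z x * (Real.exp (-(p * x)) : ℂ)‖ ≤
      3 * |z| ^ (h + 1) * (x ^ (h + 1) * Real.exp (-(p * x))) := by
  rw [norm_mul, Complex.norm_real, Real.norm_of_nonneg (Real.exp_pos _).le]
  have := norm_levyKernel_le hh z x
  rw [abs_mul, abs_of_pos hx, mul_pow] at this
  calc _ ≤ 3 * (|z| ^ (h + 1) * x ^ (h + 1)) * Real.exp (-(p * x)) := by gcongr
    _ = _ := by ring

theorem integrableOn_levyKernel_mul_exp {h : ℕ} (hh : h < 2) (z : ℝ) {p : ℝ} (hp : 0 < p) :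
    IntegrableOn (fun x : ℝ => levyKernel h z x * (Real.exp (-(p * x)) : ℂ)) (Set.Ioi 0) := by
  refine Integrable.mono' ((integrableOn_pow_mul_exp_neg hp (h + 1)).const_mul
    (3 * |z| ^ (h + 1))) ?_ ?_
  · refine Continuous.aestronglyMeasurable ?_
    exact (continuous_levyKernel h z).mul (by fun_prop)
  · refine (ae_restrict_iff' measurableSet_Ioi).2 (ae_of_all _ fun x hx => ?_)
    exact norm_levyKernel_mul_exp_le hh z p hx

theorem integral_norm_levyKernel_mul_exp_le {h : ℕ} (hh : h < 2) (z : ℝ) {p : ℝ} (hp : 0 < p) :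
    ∫ x in Set.Ioi (0 : ℝ), ‖levyKernel h z x * (Real.exp (-(p * x)) : ℂ)‖ ≤
      3 * |z| ^ (h + 1) * (h + 1).factorial / p ^ (h + 2) := by
  rw [mul_div_assoc, ← integral_pow_mul_exp_neg hp, ← integral_const_mul]
  refine setIntegral_mono_on (integrableOn_levyKernel_mul_exp hh z hp).norm
    ((integrableOn_pow_mul_exp_neg hp (h + 1)).const_mul _) measurableSet_Ioi fun x hx => ?_
  exact norm_levyKernel_mul_exp_le hh z p hx

/-- The Laplace transform of the Lévy–Khintchine kernel. -/
theorem integral_levyKernel_mul_exp {h : ℕ} (hh : h < 2) (z : ℝ) {p : ℝ} (hp : 0 < p) :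
    ∫ x in Set.Ioi (0 : ℝ), levyKernel h z x * (Real.exp (-(p * x)) : ℂ) =
      (Complex.I * z) ^ (h + 1) / ((p : ℂ) ^ (h + 1) * (p - Complex.I * z)) := by
  have hp' : (p : ℂ) ≠ 0 := by exact_mod_cast hp.ne'
  have hpz : (p : ℂ) - Complex.I * z ≠ 0 := fun h0 => hp.ne' (by simpa using congrArg Complex.re h0)
  have i1 := integrableOn_exp_mul_complex_Ioi (a := -(p - Complex.I * z)) (by simpa using hp) 0
  have i2 := integrableOn_exp_mul_complex_Ioi (a := -(p : ℂ)) (by simpa using hp) 0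
  have i3 : IntegrableOn (fun x : ℝ => ((x ^ 1 * Real.exp (-(p * x)) : ℝ) : ℂ)) (Set.Ioi 0) :=
    (integrableOn_pow_mul_exp_neg hp 1).ofReal
  have e : ∀ x : ℝ, levyKernel h z x * (Real.exp (-(p * x)) : ℂ) =
      Complex.exp (-(p - Complex.I * z) * x) - Complex.exp (-(p : ℂ) * x) -
        Complex.I * z * h * ((x ^ 1 * Real.exp (-(p * x)) : ℝ) : ℂ) := fun x => by
    have : Complex.exp (-(p - Complex.I * z) * x) =
        Complex.exp (Complex.I * z * x) * Complex.exp (-(p : ℂ) * x) := by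
      rw [← Complex.exp_add]; ring_nf
    rw [this, levyKernel]
    push_cast
    ring_nf
  simp_rw [e]
  have i12 : IntegrableOn (fun x : ℝ => Complex.exp (-(p - Complex.I * z) * x) -
      Complex.exp (-(p : ℂ) * x)) (Set.Ioi 0) := i1.sub i2
  rw [integral_sub i12 (i3.const_mul _), integral_sub i1 i2, integral_const_mul,
    integral_complex_ofReal, integral_pow_mul_exp_neg hp,
    integral_exp_mul_complex_Ioi (by simpa using hp),
    integral_exp_mul_complex_Ioi (by simpa using hp)]
  simp only [Complex.ofReal_zero, mul_zero, Complex.exp_zero]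
  interval_cases h
  · simp only [Nat.cast_zero]
    field_simp
    ring
  · push_cast
    simp only [Nat.factorial_one, Nat.cast_one]
    field_simp
    ring

/-- The weights of `Θ_k`, written as a series over `n ≥ 0`, with `m = 2k`: the weight is `2nᵐ`
for `n ≥ 1` and `δ_{m,0}` for `n = 0`. -/
noncomputable def thetaWeight (m n : ℕ) : ℝ := (if n = 0 then 1 else 2) * (n : ℝ) ^ m

theorem thetaWeight_nonneg (m n : ℕ) : 0 ≤ thetaWeight m n := by
  unfold thetaWeight; split_ifs <;> positivity

theorem thetaWeight_pos (m : ℕ) {n : ℕ} (hn : n ≠ 0) : 0 < thetaWeight m n := by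
  unfold thetaWeight
  rw [if_neg hn]
  have : (0 : ℝ) < n := by exact_mod_cast Nat.pos_of_ne_zero hn
  positivity

theorem thetaWeight_le (m n : ℕ) : thetaWeight m n ≤ 2 * (n : ℝ) ^ m := by
  unfold thetaWeight
  gcongr
  split_ifs <;> norm_num

/-- The exponential rates `α + βn²`, which are also the poles. -/
noncomputable def thetaPole (α β : ℝ) (n : ℕ) : ℝ := α + β * (n : ℝ) ^ 2

section thetaPole

variable {α β : ℝ}

theorem thetaPole_pos (hα : 0 < α) (hβ : 0 < β) (n : ℕ) : 0 < thetaPole α β n := by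
  unfold thetaPole; positivity

theorem thetaPole_strictMono (α : ℝ) (hβ : 0 < β) : StrictMono (thetaPole α β) := by
  intro a b hab
  unfold thetaPole
  gcongr

theorem tendsto_thetaPole (α : ℝ) (hβ : 0 < β) : Tendsto (thetaPole α β) atTop atTop := by
  refine tendsto_atTop_add_const_left _ _ (Tendsto.const_mul_atTop hβ ?_)
  exact (tendsto_pow_atTop two_ne_zero).comp tendsto_natCast_atTop_atTop

theorem summable_thetaWeight_div (hα : 0 < α) (hβ : 0 < β) {m j : ℕ} (hmj : m + 2 ≤ 2 * j) :
    Summable fun n => thetaWeight m n / thetaPole α β n ^ j := by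
  have hs : Summable fun n : ℕ => 2 / β ^ j * (1 / (n : ℝ) ^ 2) :=
    (Real.summable_one_div_nat_pow.2 one_lt_two).mul_left _
  refine Summable.of_norm_bounded_eventually_nat hs ?_
  filter_upwards [eventually_ge_atTop 1] with n hn
  have hn' : (1 : ℝ) ≤ n := by exact_mod_cast hn
  have hp := thetaPole_pos hα hβ n
  rw [Real.norm_of_nonneg (div_nonneg (thetaWeight_nonneg m n) (pow_pos hp j).le)]
  have h1 : β ^ j * (n : ℝ) ^ (m + 2) ≤ thetaPole α β n ^ j := by
    calc β ^ j * (n : ℝ) ^ (m + 2) ≤ β ^ j * (n : ℝ) ^ (2 * j) := by gcongr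
      _ = (β * (n : ℝ) ^ 2) ^ j := by rw [mul_pow, pow_mul]
      _ ≤ _ := pow_le_pow_left₀ (by positivity) (by unfold thetaPole; linarith) j
  calc thetaWeight m n / thetaPole α β n ^ j
      ≤ 2 * (n : ℝ) ^ m / (β ^ j * (n : ℝ) ^ (m + 2)) := by
        gcongr; exact thetaWeight_le m n
    _ = 2 / β ^ j * (1 / (n : ℝ) ^ 2) := by
        rw [pow_add]; field_simp

end thetaPole

theorem summable_thetaWeight_mul_exp (m : ℕ) {x : ℝ} (hx : 0 < x) :
    Summable fun n : ℕ => thetaWeight m n * Real.exp (-(n : ℝ) ^ 2 * x) := by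
  refine Summable.of_nonneg_of_le (fun n => mul_nonneg (thetaWeight_nonneg m n)
    (Real.exp_pos _).le) (fun n => ?_) ((Real.summable_pow_mul_exp_neg_nat_mul m hx).mul_left 2)
  have h1 : (n : ℝ) ≤ (n : ℝ) ^ 2 := by
    have : n ≤ n ^ 2 := Nat.le_self_pow two_ne_zero n
    exact_mod_cast this
  calc thetaWeight m n * Real.exp (-(n : ℝ) ^ 2 * x)
      ≤ (2 * (n : ℝ) ^ m) * Real.exp (-x * n) := by
        refine mul_le_mul (thetaWeight_le m n) (Real.exp_le_exp.2 ?_) (Real.exp_pos _).le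
          (by positivity)
        nlinarith
    _ = _ := by ring

theorem hasSum_thetaFun (m : ℕ) {x : ℝ} (hx : 0 < x) :
    HasSum (fun n : ℕ => thetaWeight m n * Real.exp (-(n : ℝ) ^ 2 * x))
      (thetaFun ((m : ℝ) / 2) x) := by
  have hs := summable_thetaWeight_mul_exp m hx
  rw [hs.hasSum_iff, hs.tsum_eq_zero_add, thetaFun, ← tsum_mul_left]
  congr 1
  · rcases Nat.eq_zero_or_pos m with rfl | h
    · simp [thetaWeight]
    · simp [thetaWeight, h.ne']
  · congr 1
    ext n
    rw [thetaWeight, if_neg (Nat.succ_ne_zero n), mul_div_cancel₀ _ (two_ne_zero' ℝ),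
      Real.rpow_natCast]
    push_cast
    ring

/-! ### The Laplace exponent as a partial fraction series -/

/-- The function on the line that is `g₁` on the positive half-line and the reflection of `g₂` on
the negative half-line. -/
noncomputable def glue {E : Type*} [Zero E] (g₁ g₂ : ℝ → E) (x : ℝ) : E :=
  if 0 < x then g₁ x else if x < 0 then g₂ (-x) else 0

section glue

variable {E : Type*} [NormedAddCommGroup E] {g₁ g₂ : ℝ → E}

theorem norm_glue (x : ℝ) : ‖glue g₁ g₂ x‖ = glue (fun x => ‖g₁ x‖) (fun x => ‖g₂ x‖) x := by
  unfold glue; split_ifs <;> simp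

theorem integrableOn_glue_Ioi (h₁ : IntegrableOn g₁ (Set.Ioi 0)) :
    IntegrableOn (glue g₁ g₂) (Set.Ioi 0) :=
  h₁.congr_fun (fun _ hx => (if_pos (Set.mem_Ioi.1 hx)).symm) measurableSet_Ioi

theorem integrableOn_glue_Iic (h₂ : IntegrableOn g₂ (Set.Ioi 0)) :
    IntegrableOn (glue g₁ g₂) (Set.Iic 0) := by
  rw [integrableOn_Iic_iff_integrableOn_Iio]
  have := IntegrableOn.comp_neg_Iio (c := 0) (f := g₂) (by simpa using h₂)
  refine this.congr_fun (fun x hx => ?_) measurableSet_Iio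
  have hx : x < 0 := hx
  simp [glue, hx, hx.le]

theorem integrable_glue (h₁ : IntegrableOn g₁ (Set.Ioi 0)) (h₂ : IntegrableOn g₂ (Set.Ioi 0)) :
    Integrable (glue g₁ g₂) := by
  rw [← integrableOn_univ, ← Set.Iic_union_Ioi (a := (0 : ℝ))]
  exact (integrableOn_glue_Iic h₂).union (integrableOn_glue_Ioi h₁)

theorem integral_glue [NormedSpace ℝ E] (h₁ : IntegrableOn g₁ (Set.Ioi 0))
    (h₂ : IntegrableOn g₂ (Set.Ioi 0)) :
    ∫ x, glue g₁ g₂ x = (∫ x in Set.Ioi 0, g₁ x) + ∫ x in Set.Ioi 0, g₂ x := by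
  rw [← intervalIntegral.integral_Iic_add_Ioi (integrableOn_glue_Iic h₂) (integrableOn_glue_Ioi h₁),
    add_comm]
  congr 1
  · exact setIntegral_congr_fun measurableSet_Ioi fun x hx => if_pos hx
  · rw [integral_Iic_eq_integral_Iio]
    have := integral_comp_neg_Iic (0 : ℝ) g₂
    rw [neg_zero, integral_Iic_eq_integral_Iio] at this
    rw [← this]
    refine setIntegral_congr_fun measurableSet_Iio fun x hx => ?_
    have hx : x < 0 := hx
    simp [glue, hx, hx.le]

end glue

/-- The contribution of one half-line to the Laplace exponent:
`cβ z^(h+1) ∑ₙ wₙ / (pₙ^(h+1) (pₙ - z))`, with weights `wₙ = thetaWeight m n` and poles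
`pₙ = α + βn²`. -/
noncomputable def halfExponent (α β c : ℝ) (m h : ℕ) (z : ℂ) : ℂ :=
  c * β * z ^ (h + 1) *
    stieltjes (fun n => thetaWeight m n / thetaPole α β n ^ (h + 1)) (thetaPole α β) z

/-- The meromorphic continuation of the Laplace exponent as a partial fraction series (up to the
values at the poles). -/
noncomputable def laplaceSeries (P : ThetaParams) (m h : ℕ) (z : ℂ) : ℂ :=
  1 / 2 * (P.σ : ℂ) ^ 2 * z ^ 2 + P.μ * z + halfExponent P.α₁ P.β₁ P.c₁ m h z +
    halfExponent P.α₂ P.β₂ P.c₂ m h (-z)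

section summability

variable {α β : ℝ} {m h : ℕ}

theorem summable_mass_div (hα : 0 < α) (hβ : 0 < β) (hmh : m ≤ 2 * h + 2) :
    Summable fun n => |thetaWeight m n / thetaPole α β n ^ (h + 1)| / thetaPole α β n := by
  refine (summable_thetaWeight_div hα hβ (m := m) (j := h + 2) (by omega)).congr fun n => ?_
  have := thetaPole_pos hα hβ n
  rw [abs_of_nonneg (div_nonneg (thetaWeight_nonneg m n) (by positivity)), div_div, ← pow_succ]

theorem analyticAt_halfExponent (c : ℝ) (hα : 0 < α) (hβ : 0 < β) (hmh : m ≤ 2 * h + 2) {z : ℂ}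
    (hz : ∀ n, thetaWeight m n = 0 ∨ (thetaPole α β n : ℂ) ≠ z) :
    AnalyticAt ℂ (halfExponent α β c m h) z := by
  refine AnalyticAt.mul (by fun_prop) (analyticAt_stieltjes (tendsto_thetaPole α hβ)
    (summable_mass_div hα hβ hmh) fun n => (hz n).imp_left fun h0 => ?_)
  simp [h0]

theorem meromorphicAt_halfExponent (c : ℝ) (hα : 0 < α) (hβ : 0 < β) (hmh : m ≤ 2 * h + 2)
    (z : ℂ) : MeromorphicAt (halfExponent α β c m h) z :=
  MeromorphicAt.fun_mul (AnalyticAt.meromorphicAt (by fun_prop))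
    (meromorphicAt_stieltjes (tendsto_thetaPole α hβ) (thetaPole_strictMono α hβ).injective
      (summable_mass_div hα hβ hmh) z)

end summability

theorem meromorphic_laplaceSeries (P : ThetaParams) {m h : ℕ} (hmh : m ≤ 2 * h + 2) :
    MeromorphicOn (laplaceSeries P m h) Set.univ := by
  intro z _
  refine MeromorphicAt.fun_add (MeromorphicAt.fun_add (AnalyticAt.meromorphicAt (by fun_prop))
    (meromorphicAt_halfExponent _ P.α₁_pos P.β₁_pos hmh z)) ?_
  exact (meromorphicAt_halfExponent P.c₂ P.α₂_pos P.β₂_pos hmh (-z)).comp_analyticAt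
    (g := fun z => -z) (by fun_prop)

theorem analyticAt_laplaceSeries (P : ThetaParams) {m h : ℕ} (hmh : m ≤ 2 * h + 2) {z : ℂ}
    (h₁ : ∀ n, thetaWeight m n = 0 ∨ (thetaPole P.α₁ P.β₁ n : ℂ) ≠ z)
    (h₂ : ∀ n, thetaWeight m n = 0 ∨ (thetaPole P.α₂ P.β₂ n : ℂ) ≠ -z) :
    AnalyticAt ℂ (laplaceSeries P m h) z := by
  refine AnalyticAt.add (AnalyticAt.add (by fun_prop)
    (analyticAt_halfExponent _ P.α₁_pos P.β₁_pos hmh h₁)) ?_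
  exact (analyticAt_halfExponent P.c₂ P.α₂_pos P.β₂_pos hmh h₂).fun_comp
    (f := fun z => -z) (by fun_prop)

/-- The Lévy density is the sum over `n` of two-sided exponential densities. -/
theorem hasSum_levyDensity (P : ThetaParams) (m : ℕ) (x : ℝ) :
    HasSum (fun n => glue
      (fun x => P.c₁ * P.β₁ * thetaWeight m n * Real.exp (-(thetaPole P.α₁ P.β₁ n * x)))
      (fun x => P.c₂ * P.β₂ * thetaWeight m n * Real.exp (-(thetaPole P.α₂ P.β₂ n * x))) x)
      (levyDensity P (((m : ℝ) + 1) / 2) x) := by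
  have hk : ((m : ℝ) + 1) / 2 - 1 / 2 = m / 2 := by ring
  have key : ∀ α β c y : ℝ, 0 < β → 0 < y →
      HasSum (fun n => c * β * thetaWeight m n * Real.exp (-(thetaPole α β n * y)))
        (c * β * Real.exp (-α * y) * thetaFun ((m : ℝ) / 2) (y * β)) := fun α β c y hβ hy => by
    refine ((hasSum_thetaFun m (mul_pos hy hβ)).mul_left
      (c * β * Real.exp (-α * y))).congr_fun fun n => ?_
    have : Real.exp (-(thetaPole α β n * y)) =
        Real.exp (-α * y) * Real.exp (-(n : ℝ) ^ 2 * (y * β)) := by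
      rw [← Real.exp_add, thetaPole]; ring_nf
    rw [this]; ring
  unfold levyDensity glue
  rw [hk]
  rcases lt_trichotomy x 0 with hx | rfl | hx
  · simp only [hx, not_lt.2 hx.le, if_true, if_false]
    simpa using key P.α₂ P.β₂ P.c₂ (-x) P.β₂_pos (neg_pos.2 hx)
  · simp
  · simp only [hx, if_true]
    exact key P.α₁ P.β₁ P.c₁ x P.β₁_pos hx

theorem hasSum_halfExponent {α β : ℝ} (c : ℝ) {m h : ℕ} (hα : 0 < α) (hβ : 0 < β)
    (hmh : m ≤ 2 * h + 2) (z : ℂ) :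
    HasSum (fun n => (c * β * thetaWeight m n : ℂ) *
      (z ^ (h + 1) / ((thetaPole α β n : ℂ) ^ (h + 1) * (thetaPole α β n - z))))
      (halfExponent α β c m h z) := by
  refine ((summable_stieltjes (tendsto_thetaPole α hβ) (summable_mass_div hα hβ hmh) z).hasSum
    |>.mul_left (c * β * z ^ (h + 1))).congr_fun fun n => ?_
  push_cast
  rw [div_div, mul_div_assoc', mul_div_assoc']
  ring

/-- The Lévy–Khintchine integral is evaluated termwise. -/
theorem neg_charExponent_eq_laplaceSeries (P : ThetaParams) {m h : ℕ} (hh : h < 2)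
    (hmh : m ≤ 2 * h + 2) (hcut : levyCutoff (((m : ℝ) + 1) / 2) = h) (y : ℝ) :
    -charExponent P (((m : ℝ) + 1) / 2) y = laplaceSeries P m h (Complex.I * y) := by
  set G₁ : ℕ → ℝ → ℂ := fun n x => (P.c₁ * P.β₁ * thetaWeight m n : ℂ) *
    (levyKernel h y x * (Real.exp (-(thetaPole P.α₁ P.β₁ n * x)) : ℂ)) with hG₁
  set G₂ : ℕ → ℝ → ℂ := fun n x => (P.c₂ * P.β₂ * thetaWeight m n : ℂ) *
    (levyKernel h (-y) x * (Real.exp (-(thetaPole P.α₂ P.β₂ n * x)) : ℂ)) with hG₂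
  have p₁ := thetaPole_pos P.α₁_pos P.β₁_pos
  have p₂ := thetaPole_pos P.α₂_pos P.β₂_pos
  have i₁ : ∀ n, IntegrableOn (G₁ n) (Set.Ioi 0) := fun n =>
    (integrableOn_levyKernel_mul_exp hh y (p₁ n)).const_mul _
  have i₂ : ∀ n, IntegrableOn (G₂ n) (Set.Ioi 0) := fun n =>
    (integrableOn_levyKernel_mul_exp hh (-y) (p₂ n)).const_mul _
  have bound : ∀ α β c : ℝ, 0 < α → 0 < β → 0 < c → ∀ z : ℝ, Summable fun n =>
      ∫ x in Set.Ioi (0 : ℝ), ‖(c * β * thetaWeight m n : ℂ) *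
        (levyKernel h z x * (Real.exp (-(thetaPole α β n * x)) : ℂ))‖ := fun α β c hα hβ hc z => by
    refine Summable.of_nonneg_of_le (fun n => by positivity) (fun n => ?_)
      ((summable_thetaWeight_div hα hβ (m := m) (j := h + 2) (by omega)).mul_left
        (c * β * (3 * |z| ^ (h + 1) * (h + 1).factorial)))
    simp_rw [norm_mul (_ * _ : ℂ) (_ * _)]
    have hw := thetaWeight_nonneg m n
    have e : ‖(c * β * thetaWeight m n : ℂ)‖ = c * β * thetaWeight m n := by
      rw [← Complex.ofReal_mul, ← Complex.ofReal_mul, Complex.norm_real,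
        Real.norm_of_nonneg (by positivity)]
    rw [integral_const_mul, e]
    calc _ ≤ c * β * thetaWeight m n * (3 * |z| ^ (h + 1) * (h + 1).factorial /
          thetaPole α β n ^ (h + 2)) := by
          gcongr
          exact integral_norm_levyKernel_mul_exp_le hh z (thetaPole_pos hα hβ n)
      _ = _ := by ring
  have hsum : Summable fun n => ∫ x, ‖glue (G₁ n) (G₂ n) x‖ := by
    simp_rw [norm_glue]
    refine ((bound _ _ _ P.α₁_pos P.β₁_pos P.c₁_pos y).add
      (bound _ _ _ P.α₂_pos P.β₂_pos P.c₂_pos (-y))).congr fun n => ?_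
    exact (integral_glue (i₁ n).norm (i₂ n).norm).symm
  have H := hasSum_integral_of_summable_integral_norm
    (fun n => integrable_glue (i₁ n) (i₂ n)) hsum
  have hdens : ∀ x : ℝ, ∑' n, glue (G₁ n) (G₂ n) x =
      levyKernel h y x * (levyDensity P (((m : ℝ) + 1) / 2) x : ℂ) := fun x => by
    refine ((Complex.hasSum_ofReal.2 (hasSum_levyDensity P m x)).mul_left
      (levyKernel h y x)).congr_fun (fun n => ?_) |>.tsum_eq
    unfold glue
    split_ifs
    · simp only [hG₁]; push_cast; ring
    · simp only [hG₂]
      rw [← levyKernel_neg, neg_neg]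
      push_cast; ring
    · simp
  simp_rw [hdens] at H
  have H₂ := (hasSum_halfExponent P.c₁ P.α₁_pos P.β₁_pos hmh (Complex.I * y)).add
    (hasSum_halfExponent P.c₂ P.α₂_pos P.β₂_pos hmh (-(Complex.I * y)))
  have heq := H.unique (H₂.congr_fun fun n => ?_)
  · rw [charExponent, laplaceSeries, hcut]
    have : ∀ x : ℝ, (Complex.exp (Complex.I * y * x) - 1 - Complex.I * y * x * ((h : ℝ) : ℂ)) =
        levyKernel h y x := fun x => by simp [levyKernel]
    simp_rw [this]
    rw [heq, mul_pow, Complex.I_sq]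
    ring
  · rw [integral_glue (i₁ n) (i₂ n), integral_const_mul, integral_const_mul,
      integral_levyKernel_mul_exp hh _ (p₁ n), integral_levyKernel_mul_exp hh _ (p₂ n)]
    push_cast
    simp only [mul_neg]

/-- Two meromorphic functions in normal form that agree on the imaginary axis are equal. -/
theorem MeromorphicNFOn.eq_of_eq_on_imaginary_axis {f g : ℂ → ℂ}
    (hf : MeromorphicNFOn f Set.univ) (hg : MeromorphicNFOn g Set.univ)
    (hfg : ∀ y : ℝ, f (Complex.I * y) = g (Complex.I * y)) : f = g := by
  have hd : MeromorphicOn (f - g) Set.univ := hf.meromorphicOn.sub hg.meromorphicOn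
  have h0 : meromorphicOrderAt (f - g) 0 = ⊤ := by
    by_contra h
    rw [← ne_eq, meromorphicOrderAt_ne_top_iff_eventually_ne_zero (hd 0 trivial)] at h
    have ht : Tendsto (fun y : ℝ => Complex.I * y) (𝓝[≠] 0) (𝓝[≠] 0) := by
      refine tendsto_nhdsWithin_iff.2 ⟨?_, ?_⟩
      · have : Continuous fun y : ℝ => Complex.I * (y : ℂ) := by fun_prop
        simpa using (this.tendsto 0).mono_left nhdsWithin_le_nhds
      · filter_upwards [self_mem_nhdsWithin] with y hy
        simpa using hy
    obtain ⟨y, hy⟩ := (ht.eventually h).exists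
    exact hy (by simp [hfg y])
  have hall : ∀ z, meromorphicOrderAt (f - g) z = ⊤ := fun z => by
    by_contra h
    exact hd.meromorphicOrderAt_ne_top_of_isPreconnected isPreconnected_univ
      (Set.mem_univ z) (Set.mem_univ 0) h h0
  ext z
  have h1 : f =ᶠ[𝓝[≠] z] g := by
    filter_upwards [meromorphicOrderAt_eq_top_iff.1 (hall z)] with w hw
    exact sub_eq_zero.1 hw
  exact (((hf (Set.mem_univ z)).eventuallyEq_nhdsNE_iff_eventuallyEq_nhds
    (hg (Set.mem_univ z))).1 h1).eq_of_nhds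

theorem thetaPole_ne_of_re_eq_zero {α β : ℝ} (hα : 0 < α) (hβ : 0 < β) {z : ℂ} (hz : z.re = 0)
    (n : ℕ) : (thetaPole α β n : ℂ) ≠ z := fun h => by
  have := thetaPole_pos hα hβ n
  rw [← Complex.ofReal_re (thetaPole α β n), h, hz] at this
  exact this.false

theorem toMeromorphicNFOn_eq_of_analyticAt {f : ℂ → ℂ} (hf : MeromorphicOn f Set.univ) {z : ℂ}
    (hz : AnalyticAt ℂ f z) : toMeromorphicNFOn f Set.univ =ᶠ[𝓝 z] f := by
  have := toMeromorphicNFOn_eq_toMeromorphicNFAt_on_nhds hf (Set.mem_univ z)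
  rwa [toMeromorphicNFAt_eq_self.2 hz.meromorphicNFAt] at this

theorem isLaplaceExponent_laplaceSeries (P : ThetaParams) {m h : ℕ} (hh : h < 2)
    (hmh : m ≤ 2 * h + 2) (hcut : levyCutoff (((m : ℝ) + 1) / 2) = h) :
    IsLaplaceExponent P (((m : ℝ) + 1) / 2) (toMeromorphicNFOn (laplaceSeries P m h) Set.univ) := by
  refine ⟨meromorphicNFOn_toMeromorphicNFOn _ _, fun y => ?_⟩
  rw [neg_charExponent_eq_laplaceSeries P hh hmh hcut]
  refine (toMeromorphicNFOn_eq_of_analyticAt (meromorphic_laplaceSeries P hmh)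
    (analyticAt_laplaceSeries P hmh (fun n => Or.inr ?_) (fun n => Or.inr ?_))).eq_of_nhds
  · exact thetaPole_ne_of_re_eq_zero P.α₁_pos P.β₁_pos (by simp) n
  · exact thetaPole_ne_of_re_eq_zero P.α₂_pos P.β₂_pos (by simp) n

theorem IsLaplaceExponent.unique {P : ThetaParams} {χ : ℝ} {φ ψ : ℂ → ℂ}
    (hφ : IsLaplaceExponent P χ φ) (hψ : IsLaplaceExponent P χ ψ) : φ = ψ :=
  MeromorphicNFOn.eq_of_eq_on_imaginary_axis hφ.1 hψ.1 fun y => by rw [hφ.2, hψ.2]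

/-! ### Closed forms of the partial fraction series -/

/-- The restriction of `halfExponent` to the real line. -/
noncomputable def realHalfExponent (α β c : ℝ) (m h : ℕ) (x : ℝ) : ℝ :=
  c * β * x ^ (h + 1) *
    ∑' n, thetaWeight m n / thetaPole α β n ^ (h + 1) / (thetaPole α β n - x)

theorem halfExponent_ofReal (α β c : ℝ) (m h : ℕ) (x : ℝ) :
    halfExponent α β c m h x = (realHalfExponent α β c m h x : ℂ) := by
  rw [halfExponent, stieltjes_ofReal, realHalfExponent]
  push_cast; rfl

theorem thetaWeight_add_two (m n : ℕ) : thetaWeight (m + 2) n = (n : ℝ) ^ 2 * thetaWeight m n := by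
  unfold thetaWeight; ring

/-- `∑ wₙ / (n² + s)` with the weights of `Θ₀`, that is, the sum of `1 / (n² + s)` over all
integers `n`. -/
noncomputable def invSqSum (s : ℝ) : ℝ := ∑' n : ℕ, thetaWeight 0 n / ((n : ℝ) ^ 2 + s)

/-- The regularized sum `∑ wₙ (1 / (n² + s) - 1 / (n² + s₀))`, `wₙ = thetaWeight m n`. -/
noncomputable def thetaDiff (m : ℕ) (s s₀ : ℝ) : ℝ :=
  ∑' n : ℕ, thetaWeight m n * (1 / ((n : ℝ) ^ 2 + s) - 1 / ((n : ℝ) ^ 2 + s₀))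

/-- The convergent sum `∑ wₙ / (n² + s₀)²`, `wₙ = thetaWeight m n`. -/
noncomputable def invSqSqSum (m : ℕ) (s₀ : ℝ) : ℝ :=
  ∑' n : ℕ, thetaWeight m n / ((n : ℝ) ^ 2 + s₀) ^ 2

theorem summable_invSqSum (s : ℝ) :
    Summable fun n : ℕ => thetaWeight 0 n / ((n : ℝ) ^ 2 + s) := by
  refine (summable_stieltjes_real (t := thetaWeight 0) (tendsto_thetaPole 1 one_pos)
    ((summable_thetaWeight_div one_pos one_pos (m := 0) (j := 1) le_rfl).congr fun n => ?_)
    (1 - s)).congr fun n => ?_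
  · rw [pow_one, abs_of_nonneg (thetaWeight_nonneg 0 n)]
  · rw [thetaPole]; ring_nf

theorem summable_invSqSqSum {m : ℕ} (hm : m ≤ 2) {s₀ : ℝ} (hs₀ : 0 < s₀) :
    Summable fun n : ℕ => thetaWeight m n / ((n : ℝ) ^ 2 + s₀) ^ 2 := by
  refine (summable_thetaWeight_div hs₀ one_pos (m := m) (j := 2) (by omega)).congr fun n => ?_
  rw [thetaPole, one_mul, add_comm s₀]

theorem summable_thetaDiff {m : ℕ} (hm : m ≤ 2) {s s₀ : ℝ} (hs₀ : 0 < s₀)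
    (hs : ∀ n : ℕ, (n : ℝ) ^ 2 + s ≠ 0) :
    Summable fun n : ℕ =>
      thetaWeight m n * (1 / ((n : ℝ) ^ 2 + s) - 1 / ((n : ℝ) ^ 2 + s₀)) := by
  refine ((summable_stieltjes_real (tendsto_thetaPole s₀ one_pos)
    (summable_mass_div hs₀ one_pos (m := m) (h := 0) (by omega)) (s₀ - s)).mul_left
    (s₀ - s)).congr fun n => ?_
  have h1 := hs n
  have h2 : (n : ℝ) ^ 2 + s₀ ≠ 0 := by positivity
  have h3 : thetaPole s₀ 1 n = (n : ℝ) ^ 2 + s₀ := by rw [thetaPole]; ring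
  rw [h3, show (n : ℝ) ^ 2 + s₀ - (s₀ - s) = (n : ℝ) ^ 2 + s by ring]
  field_simp
  ring

theorem thetaDiff_zero {s s₀ : ℝ} : thetaDiff 0 s s₀ = invSqSum s - invSqSum s₀ := by
  rw [thetaDiff, invSqSum, invSqSum, ← (summable_invSqSum s).tsum_sub (summable_invSqSum s₀)]
  congr 1; ext n; ring

theorem thetaDiff_two {s s₀ : ℝ} (hs₀ : 0 < s₀) (hs : ∀ n : ℕ, (n : ℝ) ^ 2 + s ≠ 0) :
    thetaDiff 2 s s₀ = s₀ * invSqSum s₀ - s * invSqSum s := by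
  rw [thetaDiff, invSqSum, invSqSum, ← tsum_mul_left, ← tsum_mul_left,
    ← ((summable_invSqSum s₀).mul_left s₀).tsum_sub ((summable_invSqSum s).mul_left s)]
  congr 1; ext n
  have h1 := hs n
  have h2 : (n : ℝ) ^ 2 + s₀ ≠ 0 := by positivity
  rw [thetaWeight_add_two]
  field_simp
  ring

section closedForms

variable {α β c : ℝ} {m : ℕ} {x : ℝ}

theorem realHalfExponent_zero (hα : 0 < α) (hβ : 0 < β)
    (hx : ∀ n, thetaPole α β n ≠ x) :
    realHalfExponent α β c m 0 x = c * thetaDiff m ((α - x) / β) (α / β) := by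
  rw [realHalfExponent, thetaDiff, ← tsum_mul_left, ← tsum_mul_left]
  congr 1; ext n
  have h1 : thetaPole α β n - x ≠ 0 := sub_ne_zero.2 (hx n)
  have h2 := (thetaPole_pos hα hβ n).ne'
  have e1 : (n : ℝ) ^ 2 + (α - x) / β = (thetaPole α β n - x) / β := by
    rw [thetaPole]; field_simp; ring
  have e2 : (n : ℝ) ^ 2 + α / β = thetaPole α β n / β := by
    rw [thetaPole]; field_simp; ring
  rw [e1, e2]
  field_simp
  ring

theorem realHalfExponent_one (hα : 0 < α) (hβ : 0 < β) (hm : m ≤ 2)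
    (hx : ∀ n, thetaPole α β n ≠ x) :
    realHalfExponent α β c (m + 2) 1 x =
      c * (-((α - x) / β) * thetaDiff m ((α - x) / β) (α / β) +
        x / β * (α / β) * invSqSqSum m (α / β)) := by
  have e1 : ∀ n : ℕ, (n : ℝ) ^ 2 + (α - x) / β = (thetaPole α β n - x) / β := fun n => by
    rw [thetaPole]; field_simp; ring
  have e2 : ∀ n : ℕ, (n : ℝ) ^ 2 + α / β = thetaPole α β n / β := fun n => by
    rw [thetaPole]; field_simp; ring
  have hs : ∀ n : ℕ, (n : ℝ) ^ 2 + (α - x) / β ≠ 0 := fun n => by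
    rw [e1]; exact div_ne_zero (sub_ne_zero.2 (hx n)) hβ.ne'
  have hs₀ : 0 < α / β := by positivity
  rw [realHalfExponent, thetaDiff, invSqSqSum, ← tsum_mul_left, ← tsum_mul_left, ← tsum_mul_left,
    ← ((summable_thetaDiff hm hs₀ hs).mul_left _).tsum_add
      ((summable_invSqSqSum hm hs₀).mul_left _), ← tsum_mul_left]
  congr 1; ext n
  have h1 : thetaPole α β n - x ≠ 0 := sub_ne_zero.2 (hx n)
  have h2 := (thetaPole_pos hα hβ n).ne'
  rw [e1, e2, thetaWeight_add_two,
    show (n : ℝ) ^ 2 = (thetaPole α β n - α) / β by rw [thetaPole]; field_simp; ring]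
  field_simp
  ring

end closedForms

/-- The partial fraction expansion of the cotangent, in the variable `s = -z²`. -/
theorem hasSum_inv_sq_sub_sq {z : ℂ} (hz : z ∈ Complex.integerComplement) :
    HasSum (fun n : ℕ => (thetaWeight 0 n : ℂ) / ((n : ℂ) ^ 2 + -z ^ 2))
      (-(Real.pi * Complex.cot (Real.pi * z)) / z) := by
  have hz0 : z ≠ 0 := Complex.integerComplement.ne_zero hz
  have h1 := (summable_cotTerm hz).hasSum
  have h2 : ∑' n, cotTerm z n = Real.pi * Complex.cot (Real.pi * z) - 1 / z :=
    (cot_series_rep' hz).symm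
  rw [h2] at h1
  rw [← hasSum_nat_add_iff' 1]
  have hval : -(Real.pi * Complex.cot (Real.pi * z)) / z -
      ∑ i ∈ Finset.range 1, (thetaWeight 0 i : ℂ) / ((i : ℂ) ^ 2 + -z ^ 2) =
      -1 / z * (Real.pi * Complex.cot (Real.pi * z) - 1 / z) := by
    simp only [Finset.sum_range_one, thetaWeight, Nat.cast_zero]
    push_cast
    simp only [pow_zero]
    field_simp
    ring
  rw [hval]
  refine (h1.mul_left (-1 / z)).congr_fun fun n => ?_
  have e1 := Complex.integerComplement_add_ne_zero hz ((n : ℤ) + 1)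
  have e2 := Complex.integerComplement_add_ne_zero hz (-((n : ℤ) + 1))
  push_cast at e1 e2
  rw [cotTerm_identity hz, thetaWeight, if_neg (Nat.succ_ne_zero n)]
  have e3 : ((n : ℂ) + 1) ^ 2 + -z ^ 2 ≠ 0 := by
    rw [show ((n : ℂ) + 1) ^ 2 + -z ^ 2 = -((z + (n + 1)) * (z + -(n + 1))) by ring]
    exact neg_ne_zero.2 (mul_ne_zero e1 e2)
  have e4 : z - ((n : ℂ) + 1) ≠ 0 := by rwa [sub_eq_add_neg]
  push_cast
  field_simp
  ring

theorem invSqSum_neg_sq {w : ℝ} (hw : ∀ n : ℤ, (n : ℝ) ≠ w) :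
    invSqSum (-w ^ 2) =
      -(Real.pi * (Real.cos (Real.pi * w) / Real.sin (Real.pi * w))) / w := by
  have hz : (w : ℂ) ∈ Complex.integerComplement := by
    rintro ⟨n, hn⟩
    exact hw n (by exact_mod_cast hn)
  have := (hasSum_inv_sq_sub_sq hz).tsum_eq
  rw [Complex.cot] at this
  rw [invSqSum]
  exact_mod_cast this

theorem invSqSum_sq {v : ℝ} (hv : 0 < v) :
    invSqSum (v ^ 2) =
      Real.pi * (Real.cosh (Real.pi * v) / Real.sinh (Real.pi * v)) / v := by
  have hz : (v : ℂ) * Complex.I ∈ Complex.integerComplement := by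
    rintro ⟨n, hn⟩
    have := congrArg Complex.im hn
    simp at this
    exact hv.ne this
  have := (hasSum_inv_sq_sub_sq hz).tsum_eq
  have e : -((v : ℂ) * Complex.I) ^ 2 = ((v ^ 2 : ℝ) : ℂ) := by
    rw [mul_pow, Complex.I_sq]; push_cast; ring
  have hs : Complex.sinh (Real.pi * v) ≠ 0 := by
    have : Real.sinh (Real.pi * v) ≠ 0 := (Real.sinh_pos_iff.2 (by positivity)).ne'
    exact_mod_cast this
  have hv' : (v : ℂ) ≠ 0 := by exact_mod_cast hv.ne'
  rw [Complex.cot, ← mul_assoc, Complex.cos_mul_I, Complex.sin_mul_I, e] at this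
  have e2 : -((Real.pi : ℂ) * (Complex.cosh (Real.pi * v) /
      (Complex.sinh (Real.pi * v) * Complex.I))) / (v * Complex.I) =
      Real.pi * (Complex.cosh (Real.pi * v) / Complex.sinh (Real.pi * v)) / v := by
    field_simp
    rw [Complex.I_sq]; ring
  rw [e2] at this
  rw [invSqSum]
  exact_mod_cast this

/-- On the positive half-line `invSqSum (v²)` is `π / v` up to an exponentially small error, which
is bounded here by a power of `v`. -/
theorem abs_mul_invSqSum_sq_sub_pi_le {v : ℝ} (hv : 0 < v) :
    |v * invSqSum (v ^ 2) - Real.pi| ≤ 6 / v ^ 4 := by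
  have hπ : 3 < Real.pi := Real.pi_gt_three
  have hs : 0 < Real.sinh (Real.pi * v) := Real.sinh_pos_iff.2 (by positivity)
  have e : v * invSqSum (v ^ 2) - Real.pi =
      Real.pi * (Real.exp (-(Real.pi * v)) / Real.sinh (Real.pi * v)) := by
    rw [invSqSum_sq hv, ← Real.cosh_sub_sinh]
    field_simp
  have h1 : Real.pi * v ≤ Real.sinh (Real.pi * v) := Real.self_le_sinh_iff.2 (by positivity)
  have h2 : (Real.pi * v) ^ 3 / 6 ≤ Real.exp (Real.pi * v) := by
    simpa [Nat.factorial] using Real.pow_div_factorial_le_exp (Real.pi * v) (by positivity) 3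
  rw [e, abs_of_pos (by positivity), Real.exp_neg]
  calc Real.pi * ((Real.exp (Real.pi * v))⁻¹ / Real.sinh (Real.pi * v))
      ≤ Real.pi * (((Real.pi * v) ^ 3 / 6)⁻¹ / (Real.pi * v)) := by gcongr
    _ = 6 / (Real.pi ^ 3 * v ^ 4) := by field_simp
    _ ≤ 6 / (1 * v ^ 4) := by
        gcongr
        exact one_le_pow₀ (by linarith)
    _ = 6 / v ^ 4 := by rw [one_mul]

/-! ### Asymptotics of the logarithmic sums -/

/-- The differences `2 log N - ∑_{n ≤ N} 2n / (n² + s)`. -/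
noncomputable def logDiff (s : ℝ) (N : ℕ) : ℝ :=
  2 * Real.log N - ∑ n ∈ Finset.range N, thetaWeight 1 (n + 1) / (((n + 1 : ℕ) : ℝ) ^ 2 + s)

theorem thetaWeight_one_succ (n : ℕ) : thetaWeight 1 (n + 1) = 2 * ((n : ℝ) + 1) := by
  simp [thetaWeight]

/-- Comparison of `∑ 2n / (n² + v²)` with `∫ 2x / (x² + v²) dx`. -/
theorem abs_sum_sub_log_le {v : ℝ} (hv : 0 < v) (N : ℕ) :
    |∑ n ∈ Finset.range N, thetaWeight 1 (n + 1) / (((n + 1 : ℕ) : ℝ) ^ 2 + v ^ 2) -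
      Real.log (((N : ℝ) ^ 2 + v ^ 2) / v ^ 2)| ≤ 4 * invSqSum (v ^ 2) := by
  -- The logarithm telescopes, and `1 - 1/t ≤ log t ≤ t - 1` bounds every increment.
  have hlog : Real.log (((N : ℝ) ^ 2 + v ^ 2) / v ^ 2) = ∑ n ∈ Finset.range N,
      (Real.log (((n + 1 : ℕ) : ℝ) ^ 2 + v ^ 2) - Real.log ((n : ℝ) ^ 2 + v ^ 2)) := by
    rw [Finset.sum_range_sub (fun n : ℕ => Real.log ((n : ℝ) ^ 2 + v ^ 2)),
      Real.log_div (by positivity) (by positivity)]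
    simp
  have hterm : ∀ n : ℕ, |thetaWeight 1 (n + 1) / (((n + 1 : ℕ) : ℝ) ^ 2 + v ^ 2) -
      (Real.log (((n + 1 : ℕ) : ℝ) ^ 2 + v ^ 2) - Real.log ((n : ℝ) ^ 2 + v ^ 2))| ≤
      4 * (thetaWeight 0 n / ((n : ℝ) ^ 2 + v ^ 2)) := fun n => by
    rw [thetaWeight_one_succ]
    push_cast
    set x := (n : ℝ) ^ 2 + v ^ 2 with hx
    set y := ((n : ℝ) + 1) ^ 2 + v ^ 2 with hy
    have hn : (0 : ℝ) ≤ n := n.cast_nonneg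
    have hx0 : 0 < x := by positivity
    have hy0 : 0 < y := by positivity
    have hyx : y = x + 2 * n + 1 := by rw [hy, hx]; ring
    have hw : 1 ≤ thetaWeight 0 n := by unfold thetaWeight; split_ifs <;> norm_num
    have hup := Real.log_le_sub_one_of_pos (show 0 < y / x by positivity)
    have hlo := Real.one_sub_inv_le_log_of_pos (show 0 < y / x by positivity)
    rw [Real.log_div hy0.ne' hx0.ne'] at hup hlo
    have b1 : 2 * ((n : ℝ) + 1) / y - (1 - (y / x)⁻¹) = 1 / y := by
      rw [inv_div]; field_simp; rw [hyx]; ring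
    have b2 : 1 / y ≤ 1 / x := one_div_le_one_div_of_le hx0 (by rw [hyx]; linarith)
    have b3 : y / x - 1 - 2 * ((n : ℝ) + 1) / y ≤ 4 / x := by
      have : y / x - 1 - 2 * ((n : ℝ) + 1) / y =
          ((2 * n + 1) * y - 2 * (n + 1) * x) / y / x := by
        field_simp; rw [hyx]; ring
      rw [this]
      refine div_le_div_of_nonneg_right ((div_le_iff₀ hy0).2 ?_) hx0.le
      rw [hyx, hx]
      nlinarith [sq_nonneg v]
    have b4 : 4 / x ≤ 4 * (thetaWeight 0 n / x) := by
      rw [mul_div_assoc']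
      gcongr
      linarith
    have b5 : 1 / x ≤ 4 / x := by gcongr; norm_num
    rw [abs_le]
    constructor <;> linarith
  rw [hlog, ← Finset.sum_sub_distrib]
  refine (Finset.abs_sum_le_sum_abs _ _).trans ((Finset.sum_le_sum fun n _ => hterm n).trans ?_)
  rw [← Finset.mul_sum]
  gcongr
  exact (summable_invSqSum (v ^ 2)).sum_le_tsum _
    fun n _ => div_nonneg (thetaWeight_nonneg 0 n) (by positivity)

/-- Comparison of `∑ 1 / (n + w)` with `∫ dx / (x + w)`. -/
theorem abs_sum_inv_sub_log_le {w : ℝ} (hw : 0 < w) (N : ℕ) :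
    |∑ n ∈ Finset.range N, 1 / (w + (n + 1)) - Real.log ((w + N) / w)| ≤ 1 / w := by
  suffices H : ∑ n ∈ Finset.range N, 1 / (w + (n + 1)) ≤ Real.log ((w + N) / w) ∧
      Real.log ((w + N) / w) ≤ ∑ n ∈ Finset.range N, 1 / (w + (n + 1)) +
        (1 / w - 1 / (w + N)) by
    have : 0 < 1 / (w + N) := by positivity
    rw [abs_le]
    constructor <;> linarith [H.1, H.2]
  induction N with
  | zero => simp [hw.ne']
  | succ N ih =>
    have h0 : 0 < w + N := by positivity
    have h1 : 0 < w + (N + 1) := by positivity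
    have e : Real.log ((w + (N + 1)) / w) =
        Real.log ((w + N) / w) + Real.log ((w + (N + 1)) / (w + N)) := by
      rw [← Real.log_mul (by positivity) (by positivity)]
      congr 1; field_simp
    have hup := Real.log_le_sub_one_of_pos (show 0 < (w + (N + 1)) / (w + N) by positivity)
    have hlo := Real.one_sub_inv_le_log_of_pos (show 0 < (w + (N + 1)) / (w + N) by positivity)
    have e1 : (w + (N + 1)) / (w + N) - 1 = 1 / (w + N) := by field_simp; ring
    have e2 : 1 - ((w + (N + 1)) / (w + N))⁻¹ = 1 / (w + (N + 1)) := by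
      rw [inv_div]; field_simp; ring
    rw [e1] at hup
    rw [e2] at hlo
    rw [Finset.sum_range_succ]
    push_cast
    rw [e]
    constructor <;> linarith [ih.1, ih.2]

theorem tendsto_sum_thetaDiff_one {s s₀ : ℝ} (hs₀ : 0 < s₀) (hs : ∀ n : ℕ, (n : ℝ) ^ 2 + s ≠ 0) :
    Tendsto (fun N => ∑ n ∈ Finset.range N,
      thetaWeight 1 (n + 1) * (1 / (((n + 1 : ℕ) : ℝ) ^ 2 + s) - 1 / (((n + 1 : ℕ) : ℝ) ^ 2 + s₀)))
      atTop (𝓝 (thetaDiff 1 s s₀)) := by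
  have h := (summable_thetaDiff one_le_two hs₀ hs).hasSum
  rw [← hasSum_nat_add_iff' 1] at h
  simpa [thetaWeight, thetaDiff] using h.tendsto_sum_nat

theorem tendsto_log_add_div_sub {w : ℝ} (hw : 0 < w) :
    Tendsto (fun N : ℕ => Real.log ((w + N) / w) - Real.log N) atTop (𝓝 (-Real.log w)) := by
  have h1 : Tendsto (fun N : ℕ => Real.log (w / N + 1)) atTop (𝓝 (Real.log (0 + 1))) := by
    refine Tendsto.log ?_ (by norm_num)
    exact (tendsto_const_div_atTop_nhds_zero_nat w).add_const 1
  rw [zero_add, Real.log_one] at h1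
  have h2 := h1.sub_const (Real.log w)
  rw [zero_sub] at h2
  refine h2.congr' ?_
  filter_upwards [eventually_gt_atTop 0] with N hN
  have hN' : (0 : ℝ) < N := by exact_mod_cast hN
  rw [← Real.log_div (by positivity) hw.ne', ← Real.log_div (by positivity) hN'.ne']
  congr 1
  field_simp

theorem tendsto_log_sq_add_div_sub {v : ℝ} (hv : 0 < v) :
    Tendsto (fun N : ℕ => Real.log (((N : ℝ) ^ 2 + v ^ 2) / v ^ 2) - 2 * Real.log N) atTop
      (𝓝 (-(2 * Real.log v))) := by
  have h1 : Tendsto (fun N : ℕ => Real.log (1 + (v / N) ^ 2)) atTop (𝓝 (Real.log (1 + 0 ^ 2))) := by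
    refine Tendsto.log ?_ (by norm_num)
    exact ((tendsto_const_div_atTop_nhds_zero_nat v).pow 2).const_add 1
  rw [zero_pow two_ne_zero, add_zero, Real.log_one] at h1
  have h2 := h1.sub_const (2 * Real.log v)
  rw [zero_sub] at h2
  refine h2.congr' ?_
  filter_upwards [eventually_gt_atTop 0] with N hN
  have hN' : (0 : ℝ) < N := by exact_mod_cast hN
  have e1 : 2 * Real.log v = Real.log (v ^ 2) := by rw [Real.log_pow]; norm_num
  have e2 : 2 * Real.log (N : ℝ) = Real.log ((N : ℝ) ^ 2) := by rw [Real.log_pow]; norm_num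
  rw [e1, e2, ← Real.log_div (by positivity) (by positivity),
    ← Real.log_div (by positivity) (by positivity)]
  congr 1
  field_simp

section thetaDiffOne

variable {s₀ C : ℝ}

/-- Asymptotics of the regularized sum of order one on the positive half-line. -/
theorem abs_thetaDiff_one_sq_le (hs₀ : 0 < s₀) (hC : Tendsto (logDiff s₀) atTop (𝓝 C))
    {v : ℝ} (hv : 0 < v) :
    |thetaDiff 1 (v ^ 2) s₀ - C + 2 * Real.log v| ≤ 4 * invSqSum (v ^ 2) := by
  have hlim := ((tendsto_sum_thetaDiff_one (s := v ^ 2) hs₀ fun n => by positivity).sub hC).sub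
    (tendsto_log_sq_add_div_sub hv)
  rw [sub_neg_eq_add] at hlim
  refine le_of_tendsto hlim.abs (Eventually.of_forall fun N => ?_)
  refine le_of_eq_of_le (congrArg _ ?_) (abs_sum_sub_log_le hv N)
  simp only [logDiff, mul_sub, Finset.sum_sub_distrib, mul_one_div]
  ring

/-- Asymptotics of the regularized sum of order one on the negative half-line, between the
poles. -/
theorem abs_thetaDiff_one_neg_sq_le (hs₀ : 0 < s₀) (hC : Tendsto (logDiff s₀) atTop (𝓝 C))
    {w : ℝ} (hw0 : 0 < w) (hw : ∀ n : ℤ, (n : ℝ) ≠ w) :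
    |thetaDiff 1 (-w ^ 2) s₀ +
      Real.pi * (Real.cos (Real.pi * w) / Real.sin (Real.pi * w)) - C + 2 * Real.log w| ≤
      3 / w := by
  have hne : ∀ n : ℕ, w + ((n : ℝ) + 1) ≠ 0 ∧ w - ((n : ℝ) + 1) ≠ 0 := fun n =>
    ⟨by positivity, sub_ne_zero.2 fun h => hw ((n : ℤ) + 1) (by push_cast; exact h.symm)⟩
  have hs : ∀ n : ℕ, (n : ℝ) ^ 2 + -w ^ 2 ≠ 0 := fun n h => by
    have h' : ((n : ℝ) - w) * (n + w) = 0 := by linear_combination h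
    rcases mul_eq_zero.1 h' with h | h
    · exact hw n (by push_cast; linarith)
    · have : (0 : ℝ) ≤ n := n.cast_nonneg
      linarith
  have hz : (w : ℂ) ∈ Complex.integerComplement := by
    rintro ⟨n, hn⟩
    exact hw n (by exact_mod_cast hn)
  have hcot : HasSum (fun n : ℕ => 1 / (w - ((n : ℝ) + 1)) + 1 / (w + ((n : ℝ) + 1)))
      (Real.pi * (Real.cos (Real.pi * w) / Real.sin (Real.pi * w)) - 1 / w) := by
    have h1 := (summable_cotTerm hz).hasSum
    have h2 : ∑' n, cotTerm (w : ℂ) n = Real.pi * Complex.cot (Real.pi * w) - 1 / w :=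
      (cot_series_rep' hz).symm
    rw [h2, Complex.cot] at h1
    unfold cotTerm at h1
    exact_mod_cast h1
  have hlim := (((tendsto_sum_thetaDiff_one hs₀ hs).add hcot.tendsto_sum_nat).sub hC).sub
    ((tendsto_log_add_div_sub hw0).const_mul 2)
  have hb : |thetaDiff 1 (-w ^ 2) s₀ + (Real.pi * (Real.cos (Real.pi * w) /
      Real.sin (Real.pi * w)) - 1 / w) - C - 2 * -Real.log w| ≤ 2 * (1 / w) := by
    refine le_of_tendsto hlim.abs (Eventually.of_forall fun N => ?_)
    refine le_of_eq_of_le ?_ (mul_le_mul_of_nonneg_left (abs_sum_inv_sub_log_le hw0 N) two_pos.le)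
    rw [← abs_two, ← abs_mul, abs_two]
    -- Of the two partial fractions of `2n / (n² - w²)` the cotangent cancels the singular one and
    -- doubles the other; what remains is `2 / (w + n)`, without poles for `w > 0`.
    have e : ∑ n ∈ Finset.range N, 2 * (1 / (w + ((n : ℝ) + 1))) =
        ∑ n ∈ Finset.range N, thetaWeight 1 (n + 1) *
          (1 / (((n + 1 : ℕ) : ℝ) ^ 2 + -w ^ 2) - 1 / (((n + 1 : ℕ) : ℝ) ^ 2 + s₀)) +
        ∑ n ∈ Finset.range N, (1 / (w - ((n : ℝ) + 1)) + 1 / (w + ((n : ℝ) + 1))) +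
        ∑ n ∈ Finset.range N, thetaWeight 1 (n + 1) / (((n + 1 : ℕ) : ℝ) ^ 2 + s₀) := by
      rw [← Finset.sum_add_distrib, ← Finset.sum_add_distrib]
      refine Finset.sum_congr rfl fun n _ => ?_
      obtain ⟨h1, h2⟩ := hne n
      have h3 : ((n + 1 : ℕ) : ℝ) ^ 2 + -w ^ 2 = -((w - (n + 1)) * (w + (n + 1))) := by
        push_cast; ring
      rw [h3, thetaWeight_one_succ]
      field_simp
      ring
    congr 1
    rw [mul_sub 2 (Finset.sum _ _), Finset.mul_sum, e, logDiff]
    ring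
  have h1w : 0 < 1 / w := by positivity
  have e3 : 3 / w = 3 * (1 / w) := by ring
  rw [abs_le] at hb ⊢
  rw [e3]
  constructor <;> linarith [hb.1, hb.2]

end thetaDiffOne

/-! ### The digamma function and the logarithmic sums -/

/-- Derivatives converge along a pointwise convergent, locally bounded sequence of holomorphic
functions (dominated convergence in the Cauchy formula). -/
theorem tendsto_deriv_of_tendsto_of_bounded {U : Set ℂ} (hU : IsOpen U) {F : ℕ → ℂ → ℂ}
    {f : ℂ → ℂ} (hF : ∀ n, DifferentiableOn ℂ (F n) U) (hf : DifferentiableOn ℂ f U) {z : ℂ}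
    {r M : ℝ} (hr : 0 < r) (hzr : Metric.closedBall z r ⊆ U)
    (hb : ∀ᶠ n in atTop, ∀ w ∈ Metric.sphere z r, ‖F n w‖ ≤ M)
    (hlim : ∀ w ∈ Metric.sphere z r, Tendsto (fun n => F n w) atTop (𝓝 (f w))) :
    Tendsto (fun n => deriv (F n) z) atTop (𝓝 (deriv f z)) := by
  simp_rw [← Complex.cderiv_eq_deriv hU (hF _) hr hzr, ← Complex.cderiv_eq_deriv hU hf hr hzr]
  unfold Complex.cderiv circleIntegral
  refine Tendsto.const_smul ?_ _
  have hmem : ∀ θ : ℝ, circleMap z r θ ∈ Metric.sphere z r := circleMap_mem_sphere z hr.le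
  have hcont : ∀ n, Continuous fun θ : ℝ => F n (circleMap z r θ) := fun n =>
    (hF n).continuousOn.comp_continuous (continuous_circleMap z r)
      fun θ => hzr (Metric.sphere_subset_closedBall (hmem θ))
  have hne : ∀ θ : ℝ, (circleMap z r θ - z) ^ 2 ≠ 0 := fun θ =>
    pow_ne_zero _ (sub_ne_zero.2 (circleMap_ne_center hr.ne'))
  refine intervalIntegral.tendsto_integral_filter_of_dominated_convergence
    (fun _ => r * ((r ^ 2)⁻¹ * M)) (Eventually.of_forall fun n => ?_) ?_
    intervalIntegrable_const (MeasureTheory.ae_of_all _ fun θ _ => ?_)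
  · refine Continuous.aestronglyMeasurable ?_
    simp only [deriv_circleMap]
    exact ((continuous_circleMap 0 r).mul continuous_const).smul
      ((Continuous.inv₀ (((continuous_circleMap z r).sub continuous_const).pow 2) hne).smul
        (hcont n))
  · filter_upwards [hb] with n hn
    refine MeasureTheory.ae_of_all _ fun θ _ => ?_
    simp only [deriv_circleMap, smul_eq_mul, norm_mul, norm_circleMap_zero, Complex.norm_I, mul_one,
      norm_inv, norm_pow, abs_of_pos hr, circleMap_sub_center]
    gcongr
    exact hn _ (hmem θ)
  · exact ((hlim _ (hmem θ)).const_smul _).const_smul _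

/-- Euler's product approximates `Γ` from below, by log-convexity. -/
theorem gammaSeq_le_Gamma {x : ℝ} (hx : 0 < x) {n : ℕ} (hn : n ≠ 0) :
    Real.GammaSeq x n ≤ Real.Gamma x := by
  have hfeq : ∀ {y : ℝ}, 0 < y →
      (Real.log ∘ Real.Gamma) (y + 1) = (Real.log ∘ Real.Gamma) y + Real.log y := fun hy => by
    simp only [Function.comp_apply]
    rw [Real.Gamma_add_one hy.ne', Real.log_mul hy.ne' (Real.Gamma_pos_of_pos hy).ne', add_comm]
  have h := Real.BohrMollerup.ge_logGammaSeq Real.convexOn_log_Gamma hfeq hx hn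
  simp only [Function.comp_apply, Real.Gamma_one, Real.log_one, zero_add] at h
  have hpos : ∀ m ∈ Finset.range (n + 1), 0 < x + m := fun m _ => by positivity
  have hprod : 0 < ∏ j ∈ Finset.range (n + 1), (x + j) := Finset.prod_pos hpos
  have hn' : (0 : ℝ) < n := by exact_mod_cast Nat.pos_of_ne_zero hn
  have e : Real.BohrMollerup.logGammaSeq x n = Real.log (Real.GammaSeq x n) := by
    rw [Real.GammaSeq, Real.BohrMollerup.logGammaSeq, Real.log_div (by positivity) hprod.ne',
      Real.log_mul (by positivity) (by positivity), Real.log_rpow hn',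
      Real.log_prod fun m hm => (hpos m hm).ne']
  rw [e] at h
  have : 0 < Real.GammaSeq x n := by unfold Real.GammaSeq; positivity
  exact (Real.log_le_log_iff this (Real.Gamma_pos_of_pos hx)).1 h

/-- The locally uniform bound that allows differentiation of Euler's limit formula for `Γ`. -/
theorem norm_GammaSeq_le {s : ℂ} (hs : 0 < s.re) {n : ℕ} (hn : n ≠ 0) :
    ‖Complex.GammaSeq s n‖ ≤ Real.Gamma s.re := by
  refine le_trans ?_ (gammaSeq_le_Gamma hs hn)
  rw [Complex.GammaSeq, Real.GammaSeq, norm_div, norm_mul,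
    Complex.norm_natCast_cpow_of_pos (Nat.pos_of_ne_zero hn), norm_prod, Complex.norm_natCast]
  have hpos : ∀ m ∈ Finset.range (n + 1), 0 < s.re + m := fun m _ => by positivity
  refine div_le_div_of_nonneg_left (by positivity) (Finset.prod_pos hpos)
    (Finset.prod_le_prod (fun m hm => (hpos m hm).le) fun m _ => ?_)
  simpa using Complex.re_le_norm (s + m)

theorem differentiableOn_GammaSeq {n : ℕ} (hn : n ≠ 0) :
    DifferentiableOn ℂ (fun s => Complex.GammaSeq s n) {s | 0 < s.re} := by
  unfold Complex.GammaSeq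
  refine DifferentiableOn.div ?_ (by fun_prop) fun s hs => ?_
  · refine DifferentiableOn.mul_const (fun s _ => ?_) _
    exact (differentiableAt_id.const_cpow
      (Or.inl (Nat.cast_ne_zero.2 hn))).differentiableWithinAt
  · refine Finset.prod_ne_zero_iff.2 fun j _ h => ?_
    have : 0 < s.re + j := add_pos_of_pos_of_nonneg hs j.cast_nonneg
    have h' := congrArg Complex.re h
    simp at h'
    linarith

theorem logDeriv_GammaSeq {s : ℂ} (hs : 0 < s.re) {n : ℕ} (hn : n ≠ 0) :
    logDeriv (fun s => Complex.GammaSeq s n) s =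
      Complex.log n - ∑ j ∈ Finset.range (n + 1), 1 / (s + j) := by
  have hne : ∀ j ∈ Finset.range (n + 1), s + (j : ℂ) ≠ 0 := fun j _ h => by
    have : 0 < s.re + j := add_pos_of_pos_of_nonneg hs j.cast_nonneg
    have h' := congrArg Complex.re h
    simp at h'
    linarith
  have hn' : (n : ℂ) ≠ 0 := Nat.cast_ne_zero.2 hn
  have hfac : (n.factorial : ℂ) ≠ 0 := Nat.cast_ne_zero.2 n.factorial_ne_zero
  have hd : HasDerivAt (fun s : ℂ => (n : ℂ) ^ s) ((n : ℂ) ^ s * Complex.log n * 1) s :=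
    (hasDerivAt_id s).const_cpow (Or.inl hn')
  have hpow : (n : ℂ) ^ s ≠ 0 := by simp [Complex.cpow_eq_zero_iff, hn']
  unfold Complex.GammaSeq
  rw [logDeriv_div (f := fun s : ℂ => (n : ℂ) ^ s * n.factorial)
    (g := fun s : ℂ => ∏ j ∈ Finset.range (n + 1), (s + j)) s (mul_ne_zero hpow hfac)
    (Finset.prod_ne_zero_iff.2 hne)
    (hd.differentiableAt.mul_const _) (by fun_prop), logDeriv_mul_const _ _ hfac,
    logDeriv_prod hne (fun _ _ => by fun_prop), logDeriv_apply, hd.deriv]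
  congr 1
  · field_simp
  · refine Finset.sum_congr rfl fun j _ => ?_
    rw [logDeriv_apply, deriv_add_const, deriv_id'']

/-- Euler's limit formula for the digamma function. -/
theorem tendsto_digamma {s : ℂ} (hs : 0 < s.re) :
    Tendsto (fun n : ℕ => Complex.log n - ∑ j ∈ Finset.range (n + 1), 1 / (s + j)) atTop
      (𝓝 (Complex.digamma s)) := by
  have hU : IsOpen {s : ℂ | 0 < s.re} := isOpen_lt continuous_const Complex.continuous_re
  set r := s.re / 2 with hr
  have hr0 : 0 < r := by positivity
  have hball : Metric.closedBall s r ⊆ {s : ℂ | 0 < s.re} := fun w hw => by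
    rw [mem_closedBall_iff_norm] at hw
    have h1 := Complex.abs_re_le_norm (w - s)
    rw [Complex.sub_re, abs_le] at h1
    have : 0 < w.re := by linarith [h1.1]
    exact this
  have hGd : DifferentiableOn ℂ Complex.Gamma {s : ℂ | 0 < s.re} := fun w hw =>
    (Complex.differentiableAt_Gamma w fun m h => by
      have hw : 0 < w.re := hw
      rw [h] at hw
      simp at hw
      have : (0 : ℝ) ≤ m := m.cast_nonneg
      linarith).differentiableWithinAt
  obtain ⟨M, hM⟩ : ∃ M, ∀ w ∈ Metric.sphere s r, ‖Real.Gamma w.re‖ ≤ M := by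
    refine (isCompact_sphere s r).exists_bound_of_continuousOn fun w hw => ?_
    have hw : 0 < w.re := hball (Metric.sphere_subset_closedBall hw)
    have hG : ContinuousAt Real.Gamma w.re := (Real.differentiableAt_Gamma fun m h => by
      have : (0 : ℝ) ≤ m := m.cast_nonneg
      linarith).continuousAt
    exact (hG.comp (f := Complex.re) Complex.continuous_re.continuousAt).continuousWithinAt
  have hderiv := tendsto_deriv_of_tendsto_of_bounded (F := fun n s => Complex.GammaSeq s (n + 1))
    hU (fun n => differentiableOn_GammaSeq n.succ_ne_zero) hGd hr0 hball
    (M := M) (Eventually.of_forall fun n w hw =>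
      (norm_GammaSeq_le (hball (Metric.sphere_subset_closedBall hw)) n.succ_ne_zero).trans
        ((le_abs_self _).trans (hM w hw)))
    (fun w _ => (Complex.GammaSeq_tendsto_Gamma w).comp (tendsto_add_atTop_nat 1))
  -- Convergence of `F_n` and `F_n'` gives convergence of `F_n' / F_n`.
  have hlog := hderiv.div ((Complex.GammaSeq_tendsto_Gamma s).comp (tendsto_add_atTop_nat 1))
    (Complex.Gamma_ne_zero_of_re_pos hs)
  refine (tendsto_add_atTop_iff_nat 1).1 (hlog.congr fun n => ?_)
  rw [← logDeriv_GammaSeq hs n.succ_ne_zero]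
  rfl

/-- The sum of the digamma values at `±ix` is the limit of `2 log N - ∑_{n ≤ N} 2n / (n² + x²)`. -/
theorem tendsto_logDiff_digamma {x : ℝ} (hx : 0 < x) :
    Tendsto (fun N => (logDiff (x ^ 2) N : ℂ)) atTop
      (𝓝 (Complex.digamma (Complex.I * x) + Complex.digamma (-Complex.I * x))) := by
  have hx' : (x : ℂ) ≠ 0 := by exact_mod_cast hx.ne'
  -- The recurrence moves the arguments `±ix` into the right half-plane.
  have hrec : ∀ ε : ℂ, (ε = Complex.I ∨ ε = -Complex.I) →
      Complex.digamma (ε * x) = Complex.digamma (ε * x + 1) - (ε * x)⁻¹ := fun ε hε => by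
    rw [Complex.digamma_apply_add_one, add_sub_cancel_right]
    intro m hm
    have := congrArg Complex.im hm
    rcases hε with rfl | rfl <;> simp at this <;> exact hx.ne' this
  rw [hrec _ (Or.inl rfl), hrec _ (Or.inr rfl)]
  have h1 := tendsto_digamma (s := Complex.I * x + 1) (by simp)
  have h2 := tendsto_digamma (s := -Complex.I * x + 1) (by simp)
  -- After this shift the digamma sums run to `N + 1` instead of `N`; the extra term tends to `0`.
  have h3 : Tendsto
      (fun N : ℕ => ((thetaWeight 1 (N + 1) / (((N + 1 : ℕ) : ℝ) ^ 2 + x ^ 2) : ℝ) : ℂ))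
      atTop (𝓝 0) := by
    rw [← Complex.ofReal_zero]
    refine (Complex.continuous_ofReal.tendsto 0).comp ?_
    have ha : Tendsto (fun N : ℕ => 2 * (1 / ((N : ℝ) + 1))) atTop (𝓝 (2 * 0)) :=
      tendsto_one_div_add_atTop_nhds_zero_nat.const_mul 2
    rw [mul_zero] at ha
    refine squeeze_zero (fun N => div_nonneg (thetaWeight_nonneg _ _) (by positivity))
      (fun N => ?_) ha
    rw [thetaWeight_one_succ, div_le_iff₀ (by positivity)]
    push_cast
    have : 0 ≤ x ^ 2 / ((N : ℝ) + 1) := by positivity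
    calc 2 * ((N : ℝ) + 1) ≤ 2 * ((N : ℝ) + 1) + 2 * (x ^ 2 / ((N : ℝ) + 1)) := by linarith
      _ = _ := by field_simp
  have hlim := (h1.add h2).add h3
  have e : Complex.digamma (Complex.I * x + 1) + Complex.digamma (-Complex.I * x + 1) + 0 =
      Complex.digamma (Complex.I * x + 1) - (Complex.I * x)⁻¹ +
        (Complex.digamma (-Complex.I * x + 1) - (-Complex.I * x)⁻¹) := by
    field_simp
    ring
  rw [e] at hlim
  refine hlim.congr fun N => ?_
  have hsum : ∀ j : ℕ, 1 / (Complex.I * x + 1 + j) + 1 / (-Complex.I * x + 1 + j) =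
      ((thetaWeight 1 (j + 1) / (((j + 1 : ℕ) : ℝ) ^ 2 + x ^ 2) : ℝ) : ℂ) := fun j => by
    rw [thetaWeight_one_succ]
    have n1 : Complex.I * x + 1 + j ≠ 0 := fun h => by
      have := congrArg Complex.im h; simp at this; exact hx.ne' this
    have n2 : -Complex.I * x + 1 + j ≠ 0 := fun h => by
      have := congrArg Complex.im h; simp at this; exact hx.ne' this
    have n3 : ((j : ℂ) + 1) ^ 2 + x ^ 2 ≠ 0 := by
      have : ((j : ℂ) + 1) ^ 2 + x ^ 2 = (Complex.I * x + 1 + j) * (-Complex.I * x + 1 + j) := by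
        linear_combination (x : ℂ) ^ 2 * Complex.I_sq
      rw [this]; exact mul_ne_zero n1 n2
    push_cast
    rw [div_add_div _ _ n1 n2, div_eq_div_iff (mul_ne_zero n1 n2) n3]
    linear_combination (2 * ((j : ℂ) + 1) * x ^ 2) * Complex.I_sq
  have hs2 : ∑ j ∈ Finset.range (N + 1), 1 / (Complex.I * x + 1 + j) +
      ∑ j ∈ Finset.range (N + 1), 1 / (-Complex.I * x + 1 + j) =
      ((∑ j ∈ Finset.range N, thetaWeight 1 (j + 1) / (((j + 1 : ℕ) : ℝ) ^ 2 + x ^ 2) +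
        thetaWeight 1 (N + 1) / (((N + 1 : ℕ) : ℝ) ^ 2 + x ^ 2) : ℝ) : ℂ) := by
    rw [← Finset.sum_add_distrib, ← Finset.sum_range_succ, Complex.ofReal_sum]
    exact Finset.sum_congr rfl fun j _ => hsum j
  have hl : Complex.log (N : ℂ) = (Real.log N : ℂ) := by
    rw [← Complex.ofReal_natCast, Complex.ofReal_log N.cast_nonneg]
  rw [logDiff, hl]
  rw [Complex.ofReal_add] at hs2
  push_cast at hs2 ⊢
  linear_combination -hs2

theorem exists_tendsto_logDiff {s₀ : ℝ} (hs₀ : 0 < s₀) : ∃ C, Tendsto (logDiff s₀) atTop (𝓝 C) := by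
  have h := tendsto_logDiff_digamma (Real.sqrt_pos.2 hs₀)
  rw [Real.sq_sqrt hs₀.le] at h
  exact ⟨_, (Complex.continuous_re.tendsto _).comp h⟩

/-! ### Interlacing of poles and real roots -/

/-- The function `ζ ↦ φ(-ζ)` on the real line, as a partial fraction series. -/
noncomputable def realLaplace (P : ThetaParams) (m h : ℕ) (x : ℝ) : ℝ :=
  1 / 2 * P.σ ^ 2 * x ^ 2 - P.μ * x + realHalfExponent P.α₁ P.β₁ P.c₁ m h (-x) +
    realHalfExponent P.α₂ P.β₂ P.c₂ m h x

theorem laplaceSeries_neg_ofReal (P : ThetaParams) (m h : ℕ) (x : ℝ) :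
    laplaceSeries P m h (-(x : ℂ)) = (realLaplace P m h x : ℂ) := by
  rw [laplaceSeries, neg_neg, halfExponent_ofReal, ← Complex.ofReal_neg, halfExponent_ofReal,
    realLaplace]
  push_cast
  ring

section roots

variable (P : ThetaParams) {m h : ℕ}

theorem thetaPole_ne_neg {α β x : ℝ} (hα : 0 < α) (hβ : 0 < β) (hx : 0 < x) (n : ℕ) :
    (thetaPole α β n : ℂ) ≠ -(x : ℂ) := fun h0 => by
  have := thetaPole_pos hα hβ n
  have h1 : thetaPole α β n = -x := by exact_mod_cast h0
  linarith

theorem analyticAt_laplaceSeries_neg (hmh : m ≤ 2 * h + 2) {x : ℝ} (hx : 0 < x)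
    (hne : ∀ n, thetaWeight m n = 0 ∨ thetaPole P.α₂ P.β₂ n ≠ x) :
    AnalyticAt ℂ (laplaceSeries P m h) (-(x : ℂ)) := by
  refine analyticAt_laplaceSeries P hmh
    (fun n => Or.inr (thetaPole_ne_neg P.α₁_pos P.β₁_pos hx n))
    fun n => (hne n).imp_right fun h0 => ?_
  rw [neg_neg]
  exact_mod_cast h0

theorem continuousAt_realLaplace (hmh : m ≤ 2 * h + 2) {x : ℝ} (hx : 0 < x)
    (hne : ∀ n, thetaWeight m n = 0 ∨ thetaPole P.α₂ P.β₂ n ≠ x) :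
    ContinuousAt (realLaplace P m h) x := by
  have h1 : ContinuousAt (fun y : ℝ => -(y : ℂ)) x := by fun_prop
  have h2 := Complex.continuous_re.continuousAt.comp
    (ContinuousAt.comp (f := fun y : ℝ => -(y : ℂ))
      (analyticAt_laplaceSeries_neg P hmh hx hne).continuousAt h1)
  refine h2.congr (Eventually.of_forall fun y => ?_)
  simp [laplaceSeries_neg_ofReal]

/-- The polar part of `φ(-z)` at the `n`-th pole. -/
theorem exists_laplaceSeries_eq_add (hmh : m ≤ 2 * h + 2) (n : ℕ) :
    ∃ g : ℂ → ℂ, AnalyticAt ℂ g (thetaPole P.α₂ P.β₂ n) ∧ ∀ z, laplaceSeries P m h (-z) =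
      P.c₂ * P.β₂ * z ^ (h + 1) * ((thetaWeight m n / thetaPole P.α₂ P.β₂ n ^ (h + 1) : ℝ) : ℂ) /
        (thetaPole P.α₂ P.β₂ n - z) + g z := by
  set t : ℕ → ℝ := fun n => thetaWeight m n / thetaPole P.α₂ P.β₂ n ^ (h + 1) with ht
  have hs := summable_mass_div P.α₂_pos P.β₂_pos hmh
  refine ⟨fun z => 1 / 2 * (P.σ : ℂ) ^ 2 * (-z) ^ 2 + P.μ * (-z) +
    halfExponent P.α₁ P.β₁ P.c₁ m h (-z) + P.c₂ * P.β₂ * z ^ (h + 1) *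
      stieltjes (Function.update t n 0) (thetaPole P.α₂ P.β₂) z, ?_, fun z => ?_⟩
  · refine AnalyticAt.add (AnalyticAt.add (by fun_prop) ?_) (AnalyticAt.mul (by fun_prop) ?_)
    · refine (analyticAt_halfExponent P.c₁ P.α₁_pos P.β₁_pos hmh fun k =>
        Or.inr (thetaPole_ne_neg P.α₁_pos P.β₁_pos ?_ k)).fun_comp (f := fun z => -z) (by fun_prop)
      exact thetaPole_pos P.α₂_pos P.β₂_pos n
    · exact analyticAt_stieltjes_update (tendsto_thetaPole _ P.β₂_pos)
        (thetaPole_strictMono _ P.β₂_pos).injective hs n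
  · rw [laplaceSeries, neg_neg, halfExponent.eq_1 P.α₂,
      stieltjes_eq_add (tendsto_thetaPole _ P.β₂_pos) hs n]
    simp only [ht]
    ring

/-- The poles on the negative half-line are genuine: the residue does not vanish. For `n = 0` it
does if `m > 0`. -/
theorem not_analyticAt_pole (hmh : m ≤ 2 * h + 2) {n : ℕ} (hn : n ≠ 0) {f : ℂ → ℂ}
    (hf : f =ᶠ[𝓝[≠] (thetaPole P.α₂ P.β₂ n : ℂ)] fun z => laplaceSeries P m h (-z)) :
    ¬ AnalyticAt ℂ f (thetaPole P.α₂ P.β₂ n) := by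
  intro hfa
  obtain ⟨g, hg, hgz⟩ := exists_laplaceSeries_eq_add P hmh n (h := h)
  set b : ℂ := (thetaPole P.α₂ P.β₂ n : ℂ) with hb
  set t : ℝ := thetaWeight m n / thetaPole P.α₂ P.β₂ n ^ (h + 1) with ht
  have hbp := thetaPole_pos P.α₂_pos P.β₂_pos n
  have htp : 0 < t := div_pos (thetaWeight_pos m hn) (by positivity)
  -- Compare the limits at `b` of `(b - z)(f(z) - g(z))`, computed in two ways.
  have c1 : ContinuousAt (fun z => (b - z) * (f z - g z)) b := by
    have := hfa.continuousAt
    have := hg.continuousAt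
    fun_prop
  have c2 : ContinuousAt (fun z : ℂ => P.c₂ * P.β₂ * z ^ (h + 1) * (t : ℂ)) b := by fun_prop
  have l1 := c1.tendsto.mono_left (nhdsWithin_le_nhds (s := {b}ᶜ))
  have l2 := c2.tendsto.mono_left (nhdsWithin_le_nhds (s := {b}ᶜ))
  have heq : (fun z => (b - z) * (f z - g z)) =ᶠ[𝓝[≠] b]
      fun z : ℂ => P.c₂ * P.β₂ * z ^ (h + 1) * (t : ℂ) := by
    filter_upwards [hf, self_mem_nhdsWithin] with z hz hzb
    have : b - z ≠ 0 := sub_ne_zero.2 (Ne.symm hzb)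
    rw [hz, hgz]
    field_simp
    ring
  have := tendsto_nhds_unique (l1.congr' heq) l2
  rw [sub_self, zero_mul] at this
  have h1 : P.c₂ * P.β₂ * thetaPole P.α₂ P.β₂ n ^ (h + 1) * t = 0 := by
    rw [hb] at this
    exact_mod_cast this.symm
  have := P.c₂_pos
  have := P.β₂_pos
  have : 0 < P.c₂ * P.β₂ * thetaPole P.α₂ P.β₂ n ^ (h + 1) * t := by positivity
  exact this.ne' h1

/-- The polar part of `φ(-x)` on the real line; the positive residue determines the signs of the
infinite limits. -/
theorem exists_realLaplace_eq_add (hmh : m ≤ 2 * h + 2) {n : ℕ} (hn : n ≠ 0) :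
    ∃ K g : ℝ → ℝ, ContinuousAt K (thetaPole P.α₂ P.β₂ n) ∧ 0 < K (thetaPole P.α₂ P.β₂ n) ∧
      ContinuousAt g (thetaPole P.α₂ P.β₂ n) ∧
      ∀ x, realLaplace P m h x = K x * (thetaPole P.α₂ P.β₂ n - x)⁻¹ + g x := by
  obtain ⟨g, hg, hgz⟩ := exists_laplaceSeries_eq_add P hmh n (h := h)
  have hbp := thetaPole_pos P.α₂_pos P.β₂_pos n
  have hw := thetaWeight_pos m hn
  have := P.c₂_pos
  have := P.β₂_pos
  refine ⟨fun x => P.c₂ * P.β₂ * x ^ (h + 1) *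
    (thetaWeight m n / thetaPole P.α₂ P.β₂ n ^ (h + 1)), fun x => (g x).re, by fun_prop,
    by positivity, ?_, fun x => ?_⟩
  · exact Complex.continuous_re.continuousAt.comp
      (ContinuousAt.comp (f := fun y : ℝ => (y : ℂ)) hg.continuousAt
        Complex.continuous_ofReal.continuousAt)
  · have := congrArg Complex.re (hgz x)
    rw [laplaceSeries_neg_ofReal, Complex.ofReal_re] at this
    rw [this, Complex.add_re, ← div_eq_mul_inv]
    congr 1
    exact_mod_cast Complex.ofReal_re (P.c₂ * P.β₂ * x ^ (h + 1) *
      (thetaWeight m n / thetaPole P.α₂ P.β₂ n ^ (h + 1)) / (thetaPole P.α₂ P.β₂ n - x))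

theorem tendsto_realLaplace_nhdsGT (hmh : m ≤ 2 * h + 2) {n : ℕ} (hn : n ≠ 0) :
    Tendsto (realLaplace P m h) (𝓝[>] (thetaPole P.α₂ P.β₂ n)) atBot := by
  obtain ⟨K, g, hK, hK0, hg, e⟩ := exists_realLaplace_eq_add P hmh hn (h := h)
  rw [show realLaplace P m h = _ from funext e]
  refine Tendsto.atBot_add (Tendsto.pos_mul_atBot hK0 (hK.tendsto.mono_left nhdsWithin_le_nhds) ?_)
    (hg.tendsto.mono_left nhdsWithin_le_nhds)
  refine tendsto_inv_nhdsLT_zero.comp (tendsto_nhdsWithin_iff.2 ⟨?_, ?_⟩)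
  · have : Tendsto (fun x => thetaPole P.α₂ P.β₂ n - x) (𝓝 (thetaPole P.α₂ P.β₂ n))
        (𝓝 (thetaPole P.α₂ P.β₂ n - thetaPole P.α₂ P.β₂ n)) := tendsto_const_nhds.sub tendsto_id
    rw [sub_self] at this
    exact this.mono_left nhdsWithin_le_nhds
  · filter_upwards [self_mem_nhdsWithin] with x hx
    exact sub_neg.2 (Set.mem_Ioi.1 hx)

theorem tendsto_realLaplace_nhdsLT (hmh : m ≤ 2 * h + 2) {n : ℕ} (hn : n ≠ 0) :
    Tendsto (realLaplace P m h) (𝓝[<] (thetaPole P.α₂ P.β₂ n)) atTop := by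
  obtain ⟨K, g, hK, hK0, hg, e⟩ := exists_realLaplace_eq_add P hmh hn (h := h)
  rw [show realLaplace P m h = _ from funext e]
  refine Tendsto.atTop_add (Tendsto.pos_mul_atTop hK0 (hK.tendsto.mono_left nhdsWithin_le_nhds) ?_)
    (hg.tendsto.mono_left nhdsWithin_le_nhds)
  refine tendsto_inv_nhdsGT_zero.comp (tendsto_nhdsWithin_iff.2 ⟨?_, ?_⟩)
  · have : Tendsto (fun x => thetaPole P.α₂ P.β₂ n - x) (𝓝 (thetaPole P.α₂ P.β₂ n))
        (𝓝 (thetaPole P.α₂ P.β₂ n - thetaPole P.α₂ P.β₂ n)) := tendsto_const_nhds.sub tendsto_id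
    rw [sub_self] at this
    exact this.mono_left nhdsWithin_le_nhds
  · filter_upwards [self_mem_nhdsWithin] with x hx
    exact sub_pos.2 (Set.mem_Iio.1 hx)

theorem thetaPole_ne_of_mem_Ioo {α β : ℝ} (hβ : 0 < β) {n : ℕ} {x : ℝ}
    (hx : x ∈ Set.Ioo (thetaPole α β n) (thetaPole α β (n + 1))) (k : ℕ) :
    thetaPole α β k ≠ x := by
  rintro rfl
  have h1 := (thetaPole_strictMono α hβ).lt_iff_lt.1 hx.1
  have h2 := (thetaPole_strictMono α hβ).lt_iff_lt.1 hx.2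
  omega

theorem realHalfExponent_div {α β c x : ℝ} (hx : x ≠ 0) :
    realHalfExponent α β c m h x / x = c * β *
      ∑' n, thetaWeight m n / thetaPole α β n ^ (h + 1) * (x ^ h / (thetaPole α β n - x)) := by
  rw [realHalfExponent, pow_succ, mul_div_right_comm, ← tsum_mul_left, ← tsum_mul_left]
  congr 1; ext n
  field_simp

theorem summable_realHalfExponent {α β : ℝ} (hα : 0 < α) (hβ : 0 < β) (hmh : m ≤ 2 * h + 2)
    (x : ℝ) : Summable fun n =>
      thetaWeight m n / thetaPole α β n ^ (h + 1) * (x ^ h / (thetaPole α β n - x)) :=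
  ((summable_stieltjes_real (tendsto_thetaPole α hβ) (summable_mass_div hα hβ hmh) x).mul_left
    (x ^ h)).congr fun n => by ring

theorem realHalfExponent_div_le {α β c x y : ℝ} (hα : 0 < α) (hβ : 0 < β) (hc : 0 < c)
    (hmh : m ≤ 2 * h + 2) (hx : x ≠ 0) (hy : y ≠ 0)
    (H : ∀ n, x ^ h / (thetaPole α β n - x) ≤ y ^ h / (thetaPole α β n - y)) :
    realHalfExponent α β c m h x / x ≤ realHalfExponent α β c m h y / y := by
  rw [realHalfExponent_div hx, realHalfExponent_div hy]
  refine mul_le_mul_of_nonneg_left ((summable_realHalfExponent hα hβ hmh x).tsum_le_tsum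
    (fun n => ?_) (summable_realHalfExponent hα hβ hmh y)) (by positivity)
  have := thetaPole_pos hα hβ n
  exact mul_le_mul_of_nonneg_left (H n) (div_nonneg (thetaWeight_nonneg m n) (by positivity))

/-- After division by `ζ`, every term of the equation `φ(-ζ) = q` is increasing between two
consecutive poles. -/
theorem strictMonoOn_realLaplace_sub_div (hh : h < 2) (hmh : m ≤ 2 * h + 2) {q : ℝ} (hq : 0 < q)
    (n : ℕ) : StrictMonoOn (fun x => (realLaplace P m h x - q) / x)
      (Set.Ioo (thetaPole P.α₂ P.β₂ n) (thetaPole P.α₂ P.β₂ (n + 1))) := by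
  intro x hx y hy hxy
  have hx0 : 0 < x := (thetaPole_pos P.α₂_pos P.β₂_pos n).trans hx.1
  have hy0 : 0 < y := hx0.trans hxy
  have e : ∀ z : ℝ, z ≠ 0 → (realLaplace P m h z - q) / z = 1 / 2 * P.σ ^ 2 * z - P.μ -
      realHalfExponent P.α₁ P.β₁ P.c₁ m h (-z) / (-z) +
      realHalfExponent P.α₂ P.β₂ P.c₂ m h z / z - q / z := fun z hz => by
    rw [realLaplace]; field_simp; ring
  -- `x ↦ xʰ / (p - x)` increases on every interval without `p`, for `h = 0` and for `h = 1`.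
  have h1 : realHalfExponent P.α₁ P.β₁ P.c₁ m h (-y) / (-y) ≤
      realHalfExponent P.α₁ P.β₁ P.c₁ m h (-x) / (-x) := by
    refine realHalfExponent_div_le P.α₁_pos P.β₁_pos P.c₁_pos hmh (neg_ne_zero.2 hy0.ne')
      (neg_ne_zero.2 hx0.ne') fun k => ?_
    have hp := thetaPole_pos P.α₁_pos P.β₁_pos k
    rw [div_le_div_iff₀ (by linarith) (by linarith)]
    interval_cases h
    · linarith
    · nlinarith
  have h2 : realHalfExponent P.α₂ P.β₂ P.c₂ m h x / x ≤
      realHalfExponent P.α₂ P.β₂ P.c₂ m h y / y := by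
    refine realHalfExponent_div_le P.α₂_pos P.β₂_pos P.c₂_pos hmh hx0.ne' hy0.ne' fun k => ?_
    have hp := thetaPole_pos P.α₂_pos P.β₂_pos k
    have hmono := (thetaPole_strictMono P.α₂ P.β₂_pos).monotone
    have hsign : 0 < (thetaPole P.α₂ P.β₂ k - x) * (thetaPole P.α₂ P.β₂ k - y) := by
      rcases Nat.lt_or_ge n k with hk | hk
      · have := hmono (Nat.succ_le_of_lt hk)
        exact mul_pos (by linarith [hx.2]) (by linarith [hy.2])
      · have := hmono hk
        exact mul_pos_of_neg_of_neg (by linarith [hx.1]) (by linarith [hy.1])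
    have hxk : thetaPole P.α₂ P.β₂ k - x ≠ 0 := left_ne_zero_of_mul hsign.ne'
    have hyk : thetaPole P.α₂ P.β₂ k - y ≠ 0 := right_ne_zero_of_mul hsign.ne'
    rw [← sub_nonneg, div_sub_div _ _ hyk hxk]
    refine div_nonneg ?_ (by rw [mul_comm]; exact hsign.le)
    interval_cases h
    · linarith
    · nlinarith
  have h3 : q / y < q / x := div_lt_div_of_pos_left hq hx0 hxy
  have h4 : 1 / 2 * P.σ ^ 2 * x ≤ 1 / 2 * P.σ ^ 2 * y := by gcongr
  simp only
  rw [e x hx0.ne', e y hy0.ne']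
  linarith

/-- Between two consecutive poles there is exactly one root. -/
theorem existsUnique_root (hh : h < 2) (hmh : m ≤ 2 * h + 2) {q : ℝ} (hq : 0 < q) {n : ℕ}
    (hn : n ≠ 0) : ∃! x, x ∈ Set.Ioo (thetaPole P.α₂ P.β₂ n) (thetaPole P.α₂ P.β₂ (n + 1)) ∧
      realLaplace P m h x = q := by
  have hlt := thetaPole_strictMono P.α₂ P.β₂_pos (Nat.lt_succ_self n)
  set b := thetaPole P.α₂ P.β₂ n with hb
  set b' := thetaPole P.α₂ P.β₂ (n + 1) with hb'
  obtain ⟨c, hbc, hcb⟩ := exists_between hlt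
  obtain ⟨x₁, hx₁, hx₁'⟩ := (((tendsto_realLaplace_nhdsGT P hmh hn
      (h := h)).eventually_lt_atBot q).and
    (Ioo_mem_nhdsGT hbc)).exists
  obtain ⟨x₂, hx₂, hx₂'⟩ := (((tendsto_realLaplace_nhdsLT P hmh n.succ_ne_zero
    (h := h)).eventually_gt_atTop q).and (Ioo_mem_nhdsLT hcb)).exists
  have hb0 : 0 < b := thetaPole_pos P.α₂_pos P.β₂_pos n
  have hcont : ContinuousOn (realLaplace P m h) (Set.Icc x₁ x₂) := fun x hx =>
    (continuousAt_realLaplace P hmh (hb0.trans (hx₁'.1.trans_le hx.1)) fun k =>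
      Or.inr (thetaPole_ne_of_mem_Ioo P.β₂_pos
        ⟨hx₁'.1.trans_le hx.1, hx.2.trans_lt hx₂'.2⟩ k)).continuousWithinAt
  obtain ⟨x, hx, hxq⟩ := intermediate_value_Icc (hx₁'.2.trans hx₂'.1).le hcont ⟨hx₁.le, hx₂.le⟩
  refine ⟨x, ⟨⟨hx₁'.1.trans_le hx.1, hx.2.trans_lt hx₂'.2⟩, hxq⟩, fun y hy => ?_⟩
  refine (strictMonoOn_realLaplace_sub_div P hh hmh hq n).injOn hy.1
    ⟨hx₁'.1.trans_le hx.1, hx.2.trans_lt hx₂'.2⟩ ?_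
  rw [hy.2, hxq, sub_self, zero_div, zero_div]

theorem exists_thetaPole_le_lt {α β x : ℝ} (hβ : 0 < β) {N : ℕ} (hx : thetaPole α β N < x) :
    ∃ n, N ≤ n ∧ thetaPole α β n ≤ x ∧ x < thetaPole α β (n + 1) := by
  classical
  have hex : ∃ k, x < thetaPole α β k := ((tendsto_thetaPole α hβ).eventually_gt_atTop x).exists
  have hk := Nat.find_spec hex
  have hNk : N < Nat.find hex := (thetaPole_strictMono α hβ).lt_iff_lt.1 (hx.trans hk)
  obtain ⟨n, hn⟩ : ∃ n, Nat.find hex = n + 1 := ⟨Nat.find hex - 1, by omega⟩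
  refine ⟨n, by omega, not_lt.1 (Nat.find_min hex (by omega)), ?_⟩
  rwa [hn] at hk

/-- The list of all roots beyond the pole number `N`. -/
theorem image_roots_eq (hh : h < 2) (hmh : m ≤ 2 * h + 2)
    (hcut : levyCutoff (((m : ℝ) + 1) / 2) = h) {φ : ℂ → ℂ}
    (hφ : IsLaplaceExponent P (((m : ℝ) + 1) / 2) φ) {q : ℝ} (hq : 0 < q) {r : ℕ → ℝ}
    (hr : ∀ n, n ≠ 0 → r n ∈ Set.Ioo (thetaPole P.α₂ P.β₂ n) (thetaPole P.α₂ P.β₂ (n + 1)) ∧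
      realLaplace P m h (r n) = q) {N : ℕ} (hN : N ≠ 0) :
    r '' Set.Ici N = {x : ℝ | thetaPole P.α₂ P.β₂ N < x ∧
      AnalyticAt ℂ (fun z => φ (-z)) (x : ℂ) ∧ φ (-(x : ℂ)) = (q : ℂ)} := by
  rw [hφ.unique (isLaplaceExponent_laplaceSeries P hh hmh hcut)]
  have hmer := meromorphic_laplaceSeries P hmh
  have hmono := thetaPole_strictMono P.α₂ P.β₂_pos
  have hNpos := thetaPole_pos P.α₂_pos P.β₂_pos N
  have hgood : ∀ x : ℝ, 0 < x → (∀ n, thetaPole P.α₂ P.β₂ n ≠ x) →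
      AnalyticAt ℂ (fun z => toMeromorphicNFOn (laplaceSeries P m h) Set.univ (-z)) (x : ℂ) ∧
      toMeromorphicNFOn (laplaceSeries P m h) Set.univ (-(x : ℂ)) = realLaplace P m h x :=
    fun x hx hne => by
      have ha := analyticAt_laplaceSeries_neg P hmh hx fun n => Or.inr (hne n)
      have he := toMeromorphicNFOn_eq_of_analyticAt hmer ha
      exact ⟨(ha.congr he.symm).fun_comp (f := fun z => -z) (by fun_prop),
        by rw [he.eq_of_nhds, laplaceSeries_neg_ofReal]⟩
  ext x
  constructor
  · rintro ⟨n, hn, rfl⟩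
    have hn' : N ≤ n := hn
    obtain ⟨h1, h2⟩ := hr n (by omega)
    have hlt : thetaPole P.α₂ P.β₂ N < r n := (hmono.monotone hn').trans_lt h1.1
    obtain ⟨h3, h4⟩ := hgood (r n) (hNpos.trans hlt) (thetaPole_ne_of_mem_Ioo P.β₂_pos h1)
    exact ⟨hlt, h3, by rw [h4, h2]⟩
  · rintro ⟨hx, hxa, hxq⟩
    obtain ⟨n, hNn, h1, h2⟩ := exists_thetaPole_le_lt P.β₂_pos hx
    have hn0 : n ≠ 0 := by omega
    -- At a pole the exponent is not analytic, so `x` is not in the solution set.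
    rcases h1.eq_or_lt with h1 | h1
    · rw [← h1] at hxa
      refine absurd hxa (not_analyticAt_pole P hmh hn0 (h := h) ?_)
      have h3 := MeromorphicOn.toMeromorphicNFOn_eq_self_on_nhdsNE hmer
        (Set.mem_univ (-(thetaPole P.α₂ P.β₂ n : ℂ)))
      have h4 : Tendsto (fun z : ℂ => -z) (𝓝[≠] (thetaPole P.α₂ P.β₂ n : ℂ))
          (𝓝[≠] (-(thetaPole P.α₂ P.β₂ n : ℂ))) := by
        refine tendsto_nhdsWithin_iff.2
          ⟨(continuous_neg.tendsto _).mono_left nhdsWithin_le_nhds, ?_⟩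
        filter_upwards [self_mem_nhdsWithin] with z hz
        simpa using hz
      exact h4.eventually h3
    · refine ⟨n, hNn, ?_⟩
      obtain ⟨-, h4⟩ := hgood x (hNpos.trans hx) (thetaPole_ne_of_mem_Ioo P.β₂_pos ⟨h1, h2⟩)
      rw [h4] at hxq
      exact (existsUnique_root P hh hmh hq hn0).unique (hr n hn0)
        ⟨⟨h1, h2⟩, by exact_mod_cast hxq⟩

end roots

/-! ### Numbering of the roots and passage from the root variable to the index -/

theorem isBigO_zpow_atTop {k l : ℤ} (hkl : k ≤ l) :
    (fun w : ℝ => w ^ k) =O[atTop] fun w => w ^ l := by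
  refine IsBigO.of_bound 1 ?_
  filter_upwards [eventually_ge_atTop (1 : ℝ)] with w hw
  have h0 : 0 < w := by linarith
  rw [one_mul, Real.norm_of_nonneg (zpow_pos h0 k).le, Real.norm_of_nonneg (zpow_pos h0 l).le]
  exact zpow_le_zpow_right₀ hw hkl

theorem isLittleO_zpow_atTop {k l : ℤ} (hkl : k < l) :
    (fun w : ℝ => w ^ k) =o[atTop] fun w => w ^ l := by
  refine (isLittleO_iff_tendsto' ?_).2 ?_
  · filter_upwards [eventually_gt_atTop (0 : ℝ)] with w hw h
    exact absurd h (zpow_pos hw l).ne'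
  · refine (tendsto_zpow_atTop_zero (n := k - l) (by omega)).congr' ?_
    filter_upwards [eventually_gt_atTop (0 : ℝ)] with w hw
    rw [zpow_sub₀ hw.ne']

theorem abs_arctan_sub_self_le (x : ℝ) : |Real.arctan x - x| ≤ |x| ^ 3 := by
  have hd : ∀ y : ℝ, HasDerivAt (fun y => Real.arctan y - y) (1 / (1 + y ^ 2) - 1) y := fun y =>
    (Real.hasDerivAt_arctan y).sub (hasDerivAt_id y)
  have h := (convex_uIcc (0 : ℝ) x).norm_image_sub_le_of_norm_hasDerivWithin_le
    (f := fun y => Real.arctan y - y) (f' := fun y => 1 / (1 + y ^ 2) - 1) (C := |x| ^ 2)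
    (fun y _ => (hd y).hasDerivWithinAt) (fun y hy => ?_) Set.left_mem_uIcc Set.right_mem_uIcc
  · simpa [pow_succ] using h
  · have hy' : |y| ≤ |x| := by
      rcases Set.mem_uIcc.1 hy with h | h
      · rw [abs_of_nonneg h.1, abs_of_nonneg (h.1.trans h.2)]; exact h.2
      · rw [abs_of_nonpos h.2, abs_of_nonpos (h.1.trans h.2)]; linarith [h.1]
    have e : 1 / (1 + y ^ 2) - 1 = -(y ^ 2 / (1 + y ^ 2)) := by field_simp; ring
    rw [e, norm_neg, Real.norm_of_nonneg (by positivity)]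
    calc y ^ 2 / (1 + y ^ 2) ≤ y ^ 2 / 1 := by gcongr; nlinarith [sq_nonneg y]
      _ = |y| ^ 2 := by rw [div_one, sq_abs]
      _ ≤ |x| ^ 2 := by gcongr

/-- A solution of `A cos(πt) = B sin(πt)` with `|t| < 1` lies in the half-period in which the
cotangent has the sign of `B`, and is the principal one. -/
theorem eq_arctan_div_pi {A B t : ℝ} (hA : 0 < A) (ht : |t| < 1)
    (hB : 0 < B * Real.sin (Real.pi * t))
    (h : A * Real.cos (Real.pi * t) = B * Real.sin (Real.pi * t)) :
    t = Real.arctan (A / B) / Real.pi := by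
  have hπ := Real.pi_pos
  have hB0 : B ≠ 0 := left_ne_zero_of_mul hB.ne'
  have hcos : 0 < Real.cos (Real.pi * t) := by
    rw [← h] at hB
    exact (pos_iff_pos_of_mul_pos hB).1 hA
  have htan : A / B = Real.tan (Real.pi * t) := by
    rw [Real.tan_eq_sin_div_cos, div_eq_div_iff hB0 hcos.ne', h, mul_comm]
  have habs := abs_lt.1 ht
  have hhalf : |t| < 1 / 2 := by
    by_contra hcon
    refine hcos.not_ge ?_
    rw [← Real.cos_abs, abs_mul, abs_of_pos hπ]
    refine Real.cos_nonpos_of_pi_div_two_le_of_le ?_ ?_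
    · nlinarith [not_lt.1 hcon]
    · nlinarith
  have h2 := abs_lt.1 hhalf
  rw [htan, Real.arctan_tan (by nlinarith) (by nlinarith)]
  field_simp

/-- The numbering criterion. In the variable `w`, where `ζ = α₂ + β₂w²`, the equation `φ(-ζ) = q`
takes the form `A(w) cot(πw) = B(w)`. The root between two consecutive poles lies in the left or in
the right half of the interval according to the sign of `B`; this decides which pole it is
numbered by. -/
theorem largeRootsExpansion_of_cot (P : ThetaParams) {m h : ℕ} (hh : h < 2)
    (hmh : m ≤ 2 * h + 2) (hcut : levyCutoff (((m : ℝ) + 1) / 2) = h) {φ : ℂ → ℂ}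
    (hφ : IsLaplaceExponent P (((m : ℝ) + 1) / 2) φ) {q : ℝ} (hq : 0 < q) {A B : ℝ → ℝ}
    {a e : ℕ → ℝ} (hA : ∀ᶠ w in atTop, 0 < A w)
    (hB : (∀ᶠ w in atTop, 0 < B w) ∨ ∀ᶠ w in atTop, B w < 0)
    (heq : ∀ w, 1 < w → (∀ n : ℤ, (n : ℝ) ≠ w) →
      realLaplace P m h (P.α₂ + P.β₂ * w ^ 2) = q →
      A w * Real.cos (Real.pi * w) = B w * Real.sin (Real.pi * w))
    (hexp : ∀ u : ℕ → ℝ, Tendsto u atTop atTop →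
      (∀ᶠ n : ℕ in atTop, u n = n + Real.arctan (A (u n) / B (u n)) / Real.pi) →
      (fun n => P.α₂ + P.β₂ * u n ^ 2 - a n) =O[atTop] e) :
    LargeRootsExpansion (fun z => φ (-z)) q a e := by
  have hβ := P.β₂_pos
  have hπ := Real.pi_pos
  choose! r hr using fun (n : ℕ) (hn : n ≠ 0) => (existsUnique_root P hh hmh hq hn).exists
  have himage := fun {N : ℕ} => image_roots_eq P hh hmh hcut hφ hq hr (N := N)
  have hmono : StrictMonoOn r (Set.Ici 1) := fun i hi j hj hij => by
    have hi' : 1 ≤ i := hi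
    have h1 := (hr i (by omega)).1.2
    have h2 := (hr j (by omega)).1.1
    have h3 := (thetaPole_strictMono P.α₂ hβ).monotone (Nat.succ_le_of_lt hij)
    exact h1.trans_le (h3.trans h2.le)
  set w : ℕ → ℝ := fun n => √((r n - P.α₂) / P.β₂) with hw
  have hwsq : ∀ n, n ≠ 0 → P.α₂ + P.β₂ * w n ^ 2 = r n := fun n hn => by
    have h1 := (hr n hn).1.1
    rw [thetaPole] at h1
    have : 0 ≤ P.β₂ * (n : ℝ) ^ 2 := by positivity
    rw [hw, Real.sq_sqrt (div_nonneg (by linarith) hβ.le)]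
    field_simp
    ring
  have hwmem : ∀ n : ℕ, n ≠ 0 → (n : ℝ) < w n ∧ w n < n + 1 := fun n hn => by
    obtain ⟨h1, h2⟩ := (hr n hn).1
    rw [thetaPole] at h1 h2
    push_cast at h2
    constructor
    · refine Real.lt_sqrt_of_sq_lt ?_
      rw [lt_div_iff₀ hβ]; linarith
    · refine (Real.sqrt_lt' (by positivity)).2 ?_
      rw [div_lt_iff₀ hβ]; linarith
  have hwtop : Tendsto w atTop atTop := by
    refine tendsto_atTop_mono' _ ?_ tendsto_natCast_atTop_atTop
    filter_upwards [eventually_ne_atTop 0] with n hn using (hwmem n hn).1.le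
  have hwint : ∀ n, n ≠ 0 → ∀ k : ℤ, (k : ℝ) ≠ w n := fun n hn k hk => by
    obtain ⟨h1, h2⟩ := hwmem n hn
    rw [← hk] at h1 h2
    have h3 : (n : ℤ) < k := by exact_mod_cast h1
    have h4 : k < n + 1 := by exact_mod_cast h2
    omega
  have hweq : ∀ n, n ≠ 0 → A (w n) * Real.cos (Real.pi * w n) =
      B (w n) * Real.sin (Real.pi * w n) := fun n hn => by
    refine heq _ ?_ (hwint n hn) (by rw [hwsq n hn]; exact (hr n hn).2)
    have : (1 : ℝ) ≤ n := by exact_mod_cast Nat.one_le_iff_ne_zero.2 hn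
    linarith [(hwmem n hn).1]
  -- The equation is invariant under the period of the cotangent.
  have hshift : ∀ (x : ℝ) (k : ℕ), A x * Real.cos (Real.pi * x) = B x * Real.sin (Real.pi * x) →
      A x * Real.cos (Real.pi * (x - k)) = B x * Real.sin (Real.pi * (x - k)) := fun x k hx => by
    have e : Real.pi * (x - k) = Real.pi * x - k * Real.pi := by ring
    rw [e, Real.cos_sub_nat_mul_pi, Real.sin_sub_nat_mul_pi]
    linear_combination (-1) ^ k * hx
  rcases hB with hB | hB
  -- For `B > 0` the root is in the left half of the interval and is numbered by the left pole.
  · refine ⟨r, ⟨1, thetaPole P.α₂ P.β₂ 1, thetaPole_pos P.α₂_pos hβ 1, hmono,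
      himage one_ne_zero⟩, ?_⟩
    refine (hexp w hwtop ?_).congr' ?_ EventuallyEq.rfl
    · filter_upwards [hwtop.eventually hA, hwtop.eventually hB, eventually_ne_atTop 0]
        with n hAn hBn hn
      obtain ⟨h1, h2⟩ := hwmem n hn
      have := eq_arctan_div_pi hAn (t := w n - n) (abs_lt.2 ⟨by linarith, by linarith⟩)
        (mul_pos hBn (Real.sin_pos_of_pos_of_lt_pi (by nlinarith) (by nlinarith)))
        (hshift _ n (hweq n hn))
      linarith
    · filter_upwards [eventually_ne_atTop 0] with n hn
      rw [hwsq n hn]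
  -- For `B < 0` it is in the right half and is numbered by the right pole.
  · refine ⟨fun n => r (n - 1), ⟨2, thetaPole P.α₂ P.β₂ 1, thetaPole_pos P.α₂_pos hβ 1, ?_, ?_⟩, ?_⟩
    · intro i hi j hj hij
      have hi' : 2 ≤ i := hi
      have hj' : 2 ≤ j := hj
      exact hmono (Set.mem_Ici.2 (by omega)) (Set.mem_Ici.2 (by omega)) (by omega)
    · rw [← himage one_ne_zero]
      ext x
      constructor
      · rintro ⟨n, hn, rfl⟩
        have hn' : 2 ≤ n := hn
        exact ⟨n - 1, Set.mem_Ici.2 (by omega), rfl⟩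
      · rintro ⟨n, hn, rfl⟩
        have hn' : 1 ≤ n := hn
        exact ⟨n + 1, Set.mem_Ici.2 (by omega), by simp⟩
    · have hutop : Tendsto (fun n => w (n - 1)) atTop atTop :=
        hwtop.comp (tendsto_sub_atTop_nat 1)
      refine (hexp _ hutop ?_).congr' ?_ EventuallyEq.rfl
      · filter_upwards [hutop.eventually hA, hutop.eventually hB, eventually_ge_atTop 2]
          with n hAn hBn hn
        obtain ⟨k, rfl⟩ : ∃ k, n = k + 1 := ⟨n - 1, by omega⟩
        simp only [Nat.add_sub_cancel] at hAn hBn ⊢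
        have hk : k ≠ 0 := by omega
        obtain ⟨h1, h2⟩ := hwmem k hk
        have := eq_arctan_div_pi hAn (t := w k - (k + 1 : ℕ))
          (abs_lt.2 ⟨by push_cast; linarith, by push_cast; linarith⟩)
          (mul_pos_of_neg_of_neg hBn (Real.sin_neg_of_neg_of_neg_pi_lt
            (by push_cast; nlinarith) (by push_cast; nlinarith)))
          (hshift _ (k + 1) (hweq k hk))
        linarith
      · filter_upwards [eventually_ge_atTop 2] with n hn
        rw [hwsq _ (by omega)]

/-- A sequence with `uₙ = n + O(1)` is of exact order `n`. -/
theorem isTheta_natCast_of_bounded {u : ℕ → ℝ}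
    (hu : ∃ C : ℝ, ∀ᶠ n : ℕ in atTop, |u n - n| ≤ C) :
    u =Θ[atTop] fun n : ℕ => (n : ℝ) := by
  obtain ⟨C, hC⟩ := hu
  refine IsEquivalent.isTheta ?_
  refine IsBigO.trans_isLittleO (g := fun _ : ℕ => (1 : ℝ)) (IsBigO.of_bound C ?_) ?_
  · filter_upwards [hC] with n hn
    simpa using hn
  · exact (isLittleO_const_left_of_ne one_ne_zero).2
      (tendsto_norm_atTop_atTop.comp tendsto_natCast_atTop_atTop)

theorem abs_sub_natCast_le_of_eq_arctan {u : ℕ → ℝ} {f : ℕ → ℝ}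
    (hu : ∀ᶠ n : ℕ in atTop, u n = n + Real.arctan (f n) / Real.pi) :
    ∃ C : ℝ, ∀ᶠ n : ℕ in atTop, |u n - n| ≤ C := by
  refine ⟨1 / 2, ?_⟩
  filter_upwards [hu] with n hn
  have hπ := Real.pi_pos
  rw [hn, add_sub_cancel_left, abs_div, abs_of_pos hπ, div_le_iff₀ hπ]
  have h1 := Real.neg_pi_div_two_lt_arctan (f n)
  have h2 := Real.arctan_lt_pi_div_two (f n)
  exact abs_le.2 ⟨by linarith, by linarith⟩

/-- From an expansion of `H = tan(πw)` in the root variable `w` to an expansion of `ζ` in `n`: since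
`n = u - arctan(H(u)) / π`, the number `βu² - βn²` is `2βu H(u) / π` up to `O(H²)`, and replacing
`D(u)` by `D(n)` costs `O(D' H)`. -/
theorem isBigO_of_expansion_tan {α β : ℝ} {H D D' e : ℝ → ℝ} {j : ℕ} (hj : 1 ≤ j) {u : ℕ → ℝ}
    (hu : Tendsto u atTop atTop)
    (hun : ∀ᶠ n : ℕ in atTop, u n = n + Real.arctan (H (u n)) / Real.pi)
    (hH : H =O[atTop] fun w => w ^ (-(j : ℤ)))
    (hHD : (fun w => 2 * β * w * H w / Real.pi - D w) =O[atTop] e)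
    (hD : ∀ᶠ w in atTop, HasDerivAt D (D' w) w)
    (hD' : D' =O[atTop] fun w => w ^ (-(j : ℤ)))
    (he : (fun w => w ^ (-(2 * j : ℤ))) =O[atTop] e)
    (heu : (fun n => e (u n)) =O[atTop] fun n : ℕ => e n) :
    (fun n : ℕ => α + β * u n ^ 2 - (β * (n : ℝ) ^ 2 + α + D n)) =O[atTop] fun n : ℕ => e n := by
  have hΘ := isTheta_natCast_of_bounded (abs_sub_natCast_le_of_eq_arctan hun)
  set δ : ℝ → ℝ := fun w => Real.arctan (H w) / Real.pi with hδ
  have hH3 : (fun w => Real.arctan (H w) - H w) =O[atTop] fun w => H w ^ 3 :=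
    IsBigO.of_bound 1 (Eventually.of_forall fun w => by
      rw [one_mul, norm_pow]; exact abs_arctan_sub_self_le (H w))
  have hpow : ∀ k l : ℕ, (fun w : ℝ => w ^ k * (w ^ (-(j : ℤ))) ^ l) =ᶠ[atTop]
      fun w => w ^ ((k : ℤ) - l * j) := fun k l => by
    filter_upwards [eventually_gt_atTop (0 : ℝ)] with w hw
    rw [← zpow_natCast w k, ← zpow_natCast, ← zpow_mul, ← zpow_add₀ hw.ne']
    congr 1
    ring
  have hj' : (1 : ℤ) ≤ j := by exact_mod_cast hj
  have hH3' : (fun w => H w ^ 3) =O[atTop] fun w : ℝ => w ^ (-(3 * j : ℤ)) := by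
    refine (hH.pow 3).trans (EventuallyEq.isBigO ?_)
    filter_upwards [hpow 0 3] with w hw
    simp only [pow_zero, one_mul] at hw
    rw [hw]; push_cast; rw [zero_sub]
  have hδO : δ =O[atTop] fun w => w ^ (-(j : ℤ)) := by
    have h1 : (fun w => Real.arctan (H w)) =O[atTop] fun w => w ^ (-(j : ℤ)) := by
      have := (hH3.trans (hH3'.trans (isBigO_zpow_atTop (l := -(j : ℤ)) (by omega)))).add hH
      simpa using this
    simpa only [hδ, div_eq_inv_mul] using h1.const_mul_left Real.pi⁻¹
  have hδ2 : (fun w => β * δ w ^ 2) =O[atTop] e := by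
    refine IsBigO.trans ?_ he
    refine ((hδO.pow 2).const_mul_left β).trans (EventuallyEq.isBigO ?_)
    filter_upwards [hpow 0 2] with w hw
    simp only [pow_zero, one_mul] at hw
    rw [hw]; push_cast; rw [zero_sub]
  have hwδ : (fun w => 2 * β / Real.pi * (w * (Real.arctan (H w) - H w))) =O[atTop] e := by
    refine IsBigO.trans ?_ he
    refine (((isBigO_refl (fun w : ℝ => w) atTop).mul (hH3.trans (hH.pow 3))).const_mul_left
      _).trans ?_
    refine IsBigO.trans (EventuallyEq.isBigO (f₂ := fun w : ℝ => w ^ (1 - 3 * (j : ℤ))) ?_)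
      (isBigO_zpow_atTop (by omega))
    filter_upwards [hpow 1 3] with w hw
    rw [pow_one] at hw
    rw [hw]; push_cast; rfl
  -- With `n = u - δ(u)`, `u² - n² = 2uδ(u) - δ(u)²`.
  have hmain : (fun w => β * (2 * w * δ w - δ w ^ 2) - D w) =O[atTop] e := by
    refine ((hHD.add hwδ).sub hδ2).congr_left fun w => ?_
    simp only [hδ]
    ring
  -- Mean value inequality on the segment from `n` to `uₙ`, which stays in `[n / 2, ∞)`.
  have hDu : (fun n : ℕ => D (u n) - D n) =O[atTop] fun n : ℕ => e n := by
    have hδu : (fun n : ℕ => u n - n) =O[atTop] fun n : ℕ => (n : ℝ) ^ (-(j : ℤ)) := by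
      refine IsBigO.trans (g := fun n => (u n) ^ (-(j : ℤ))) ?_ (hΘ.zpow _).1
      refine (hδO.comp_tendsto hu).congr' ?_ EventuallyEq.rfl
      filter_upwards [hun] with n hn
      simp only [Function.comp_apply, hδ]
      linarith
    have hprod : (fun n : ℕ => (n : ℝ) ^ (-(j : ℤ)) * (n : ℝ) ^ (-(j : ℤ))) =O[atTop]
        fun n : ℕ => e n := by
      refine IsBigO.trans (EventuallyEq.isBigO ?_)
        (he.comp_tendsto tendsto_natCast_atTop_atTop)
      filter_upwards [eventually_gt_atTop 0] with n hn
      have : (n : ℝ) ≠ 0 := by exact_mod_cast hn.ne'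
      simp only [Function.comp_apply]
      rw [← zpow_add₀ this]
      ring_nf
    refine IsBigO.trans ?_ hprod
    obtain ⟨C, hC⟩ := hD'.bound
    obtain ⟨W, hW⟩ := eventually_atTop.1 (hD.and (hC.and (eventually_gt_atTop 0)))
    have hC0 : 0 ≤ max C 0 := le_max_right _ _
    obtain ⟨C₁, hC₁⟩ := abs_sub_natCast_le_of_eq_arctan hun
    refine IsBigO.trans (g := fun n : ℕ => (n : ℝ) ^ (-(j : ℤ)) * (u n - n)) ?_
      ((isBigO_refl _ _).mul hδu)
    refine IsBigO.of_bound (max C 0 * 2 ^ j) ?_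
    filter_upwards [hC₁, tendsto_natCast_atTop_atTop.eventually_ge_atTop (2 * max W 1),
      tendsto_natCast_atTop_atTop.eventually_ge_atTop (2 * C₁)] with n h1 h2 h3
    have hn1 : max W 1 ≤ (n : ℝ) / 2 := by linarith
    have hn0 : (0 : ℝ) < (n : ℝ) / 2 := lt_of_lt_of_le (by positivity) hn1
    have hseg : ∀ x ∈ Set.uIcc (n : ℝ) (u n), (n : ℝ) / 2 ≤ x := fun x hx => by
      have hun' : (n : ℝ) / 2 ≤ u n := by linarith [(abs_le.1 h1).1]
      rcases Set.mem_uIcc.1 hx with h | h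
      · linarith [h.1]
      · exact hun'.trans h.1
    have hmv := (convex_uIcc (n : ℝ) (u n)).norm_image_sub_le_of_norm_hasDerivWithin_le
      (f := D) (f' := D') (C := max C 0 * ((n : ℝ) / 2) ^ (-(j : ℤ)))
      (fun x hx => ((hW x ((le_max_left _ _).trans (hn1.trans (hseg x hx)))).1).hasDerivWithinAt)
      (fun x hx => ?_) Set.left_mem_uIcc Set.right_mem_uIcc
    · refine hmv.trans (le_of_eq ?_)
      have h2n : ((n : ℝ) / 2) ^ (-(j : ℤ)) = 2 ^ j * (n : ℝ) ^ (-(j : ℤ)) := by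
        rw [div_zpow, zpow_neg 2, zpow_natCast]; field_simp
      rw [h2n, norm_mul, Real.norm_of_nonneg (zpow_nonneg n.cast_nonneg _)]
      ring
    · have hx' := hseg x hx
      obtain ⟨-, hb, hx0⟩ := hW x ((le_max_left _ _).trans (hn1.trans hx'))
      refine hb.trans ?_
      rw [Real.norm_of_nonneg (zpow_pos hx0 _).le]
      refine mul_le_mul (le_max_left _ _) ?_ (zpow_pos hx0 _).le hC0
      rw [zpow_neg, zpow_neg, zpow_natCast, zpow_natCast]
      gcongr
  refine ((((hmain.comp_tendsto hu).trans heu).add hDu)).congr' ?_ EventuallyEq.rfl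
  filter_upwards [hun] with n hn
  have hδn : δ (u n) = u n - n := by simp only [hδ]; linarith
  simp only [Function.comp_apply, hδn]
  ring

/-! ### Roots of an equation with a dominant power -/

theorem zpow_mul_zpow_eventuallyEq (k l : ℤ) :
    (fun w : ℝ => w ^ k * w ^ l) =ᶠ[atTop] fun w => w ^ (k + l) := by
  filter_upwards [eventually_gt_atTop (0 : ℝ)] with w hw
  rw [zpow_add₀ hw.ne']

/-- A function with leading term `b₀wᵖ` has eventually the sign of `b₀`, and its inverse has order
`w⁻ᵖ`. -/
theorem eventually_sign_of_leading {B : ℝ → ℝ} {p : ℤ} {b₀ : ℝ} (hb₀ : b₀ ≠ 0)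
    (hB : (fun w => B w - b₀ * w ^ p) =o[atTop] fun w => w ^ p) :
    ((∀ᶠ w in atTop, 0 < B w) ∨ ∀ᶠ w in atTop, B w < 0) ∧
      (fun w => (B w)⁻¹) =O[atTop] fun w => w ^ (-p) := by
  have habs : 0 < |b₀| := abs_pos.2 hb₀
  have h := hB.bound (half_pos habs)
  have hlow : ∀ᶠ w in atTop, |b₀| / 2 * w ^ p ≤ |B w| := by
    filter_upwards [h, eventually_gt_atTop (0 : ℝ)] with w hw hw0
    have hwp := zpow_pos hw0 p
    rw [Real.norm_eq_abs, Real.norm_of_nonneg hwp.le] at hw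
    have h1 := abs_sub_abs_le_abs_sub (b₀ * w ^ p) (B w)
    rw [abs_sub_comm (b₀ * w ^ p), abs_mul, abs_of_pos hwp] at h1
    linarith
  refine ⟨?_, IsBigO.of_bound (2 / |b₀|) ?_⟩
  · rcases lt_or_gt_of_ne hb₀ with hneg | hpos
    · refine Or.inr ?_
      filter_upwards [h, eventually_gt_atTop (0 : ℝ)] with w hw hw0
      have hwp := zpow_pos hw0 p
      rw [Real.norm_eq_abs, Real.norm_of_nonneg hwp.le, abs_of_neg hneg] at hw
      have := (abs_le.1 hw).2
      have : b₀ * w ^ p < 0 := mul_neg_of_neg_of_pos hneg hwp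
      linarith
    · refine Or.inl ?_
      filter_upwards [h, eventually_gt_atTop (0 : ℝ)] with w hw hw0
      have hwp := zpow_pos hw0 p
      rw [Real.norm_eq_abs, Real.norm_of_nonneg hwp.le, abs_of_pos hpos] at hw
      have := (abs_le.1 hw).1
      have : 0 < b₀ * w ^ p := mul_pos hpos hwp
      linarith
  · filter_upwards [hlow, eventually_gt_atTop (0 : ℝ)] with w hw hw0
    have hwp := zpow_pos hw0 p
    rw [norm_inv, Real.norm_eq_abs, zpow_neg, Real.norm_of_nonneg (inv_pos.2 hwp).le]
    have h2 : 0 < |b₀| / 2 * w ^ p := by positivity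
    calc |B w|⁻¹ ≤ (|b₀| / 2 * w ^ p)⁻¹ := inv_anti₀ h2 hw
      _ = 2 / |b₀| * (w ^ p)⁻¹ := by field_simp

/-- The root expansion for an equation `c₂πw^(m-1) cot(πw) = B(w)` with `B = b₀wᵖ + F + O(g)`: to
first order in the subleading part `F`, inversion of `B` gives the expansion
`K n^(m-p) - (K / b₀) n^(m-2p) F(n)`, `K = 2β₂c₂ / b₀`, up to `O(n^(m-2p) g(n))`. -/
theorem largeRootsExpansion_of_isBigO (P : ThetaParams) {m h : ℕ} (hh : h < 2)
    (hmh : m ≤ 2 * h + 2) (hcut : levyCutoff (((m : ℝ) + 1) / 2) = h) {φ : ℂ → ℂ}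
    (hφ : IsLaplaceExponent P (((m : ℝ) + 1) / 2) φ) {q : ℝ} (hq : 0 < q) {B F F' g : ℝ → ℝ}
    {p : ℤ} {b₀ : ℝ} (hb₀ : b₀ ≠ 0) (hmp : (m : ℤ) ≤ p)
    (heq : ∀ w, 1 < w → (∀ n : ℤ, (n : ℝ) ≠ w) →
      realLaplace P m h (P.α₂ + P.β₂ * w ^ 2) = q →
      P.c₂ * Real.pi * w ^ ((m : ℤ) - 1) * Real.cos (Real.pi * w) = B w * Real.sin (Real.pi * w))
    (hB : (fun w => B w - (b₀ * w ^ p + F w)) =O[atTop] g)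
    (hF : ∀ᶠ w in atTop, HasDerivAt F (F' w) w)
    (hFp : F =o[atTop] fun w => w ^ p) (hF' : F' =O[atTop] fun w => w ^ (p - 1))
    (hFF : (fun w => F w * F w) =O[atTop] fun w => w ^ p * g w)
    (hg : g =o[atTop] fun w => w ^ p) (hmg : (fun w : ℝ => w ^ ((m : ℤ) - 2)) =O[atTop] g)
    (hgu : ∀ u : ℕ → ℝ, Tendsto u atTop atTop → u =Θ[atTop] (fun n : ℕ => (n : ℝ)) →
      (fun n => g (u n)) =O[atTop] fun n : ℕ => g n) :
    LargeRootsExpansion (fun z => φ (-z)) q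
      (fun n => P.β₂ * (n : ℝ) ^ 2 + P.α₂ + (2 * P.β₂ * P.c₂ / b₀ * (n : ℝ) ^ ((m : ℤ) - p) -
        2 * P.β₂ * P.c₂ / b₀ / b₀ * ((n : ℝ) ^ ((m : ℤ) - 2 * p) * F n)))
      (fun n => (n : ℝ) ^ ((m : ℤ) - 2 * p) * g n) := by
  have hπ := Real.pi_pos
  have hc := P.c₂_pos
  set K := 2 * P.β₂ * P.c₂ / b₀ with hK
  set A : ℝ → ℝ := fun w => P.c₂ * Real.pi * w ^ ((m : ℤ) - 1) with hA
  set D : ℝ → ℝ := fun w => K * w ^ ((m : ℤ) - p) - K / b₀ * (w ^ ((m : ℤ) - 2 * p) * F w) with hD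
  set D' : ℝ → ℝ := fun w => K * ((((m : ℤ) - p : ℤ) : ℝ) * w ^ ((m : ℤ) - p - 1)) -
    K / b₀ * ((((m : ℤ) - 2 * p : ℤ) : ℝ) * w ^ ((m : ℤ) - 2 * p - 1) * F w +
      w ^ ((m : ℤ) - 2 * p) * F' w) with hD'
  obtain ⟨hsign, hinv⟩ := eventually_sign_of_leading hb₀ (B := B) (p := p)
    (((hB.trans_isLittleO hg).add hFp).congr_left fun w => by ring)
  have hB0 : ∀ᶠ w in atTop, B w ≠ 0 := by
    rcases hsign with h | h
    · exact h.mono fun w hw => hw.ne'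
    · exact h.mono fun w hw => hw.ne
  obtain ⟨j, hj⟩ : ∃ j : ℕ, (j : ℤ) = p - m + 1 := ⟨(p - m + 1).toNat, by omega⟩
  have hFO := hFp.isBigO
  have hzz : ∀ {f₁ f₂ : ℝ → ℝ} {k l n : ℤ}, (f₁ =O[atTop] fun w => w ^ k) →
      (f₂ =O[atTop] fun w => w ^ l) → k + l = n →
      (fun w => f₁ w * f₂ w) =O[atTop] fun w => w ^ n := fun h1 h2 hn => by
    rw [← hn]
    exact (h1.mul h2).trans (zpow_mul_zpow_eventuallyEq _ _).isBigO
  have hz : ∀ k : ℤ, (fun w : ℝ => w ^ k) =O[atTop] fun w => w ^ k := fun k => isBigO_refl _ _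
  have hDO : D =O[atTop] fun w => w ^ ((m : ℤ) - p) :=
    ((hz _).const_mul_left _).sub ((hzz (hz _) hFO (by ring)).const_mul_left _)
  refine largeRootsExpansion_of_cot P hh hmh hcut hφ hq (A := A) (B := B) ?_ hsign heq
    fun u hu hun => ?_
  · filter_upwards [eventually_gt_atTop (0 : ℝ)] with w hw
    have := zpow_pos hw ((m : ℤ) - 1)
    simp only [hA]
    positivity
  refine isBigO_of_expansion_tan (α := P.α₂) (β := P.β₂) (H := fun w => A w / B w) (D := D)
    (D' := D') (e := fun w => w ^ ((m : ℤ) - 2 * p) * g w) (j := j)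
      (by omega) hu hun ?_ ?_ ?_ ?_ ?_ ?_
  · simp only [div_eq_mul_inv]
    exact hzz ((hz _).const_mul_left _) hinv (by omega)
  -- `2β₂wA/π - D·B`: the main terms cancel, since `2β₂wA/π = K b₀ wᵐ`.
  · have hnum : (fun w => K / b₀ * (w ^ ((m : ℤ) - 2 * p) * (F w * F w)) -
        D w * (B w - (b₀ * w ^ p + F w))) =O[atTop] fun w => w ^ ((m : ℤ) - p) * g w := by
      refine IsBigO.sub (IsBigO.const_mul_left ?_ _) (hDO.mul hB)
      refine ((isBigO_refl (fun w : ℝ => w ^ ((m : ℤ) - 2 * p)) atTop).mul hFF).trans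
        (EventuallyEq.isBigO ?_)
      filter_upwards [zpow_mul_zpow_eventuallyEq ((m : ℤ) - 2 * p) p] with w hw
      rw [← mul_assoc, hw]
      congr 2
      ring
    refine ((hnum.mul hinv).congr' ?_ ?_)
    · filter_upwards [eventually_gt_atTop (0 : ℝ), hB0] with w hw hBw
      have hX : w ^ p ≠ 0 := (zpow_pos hw p).ne'
      have e1 : w ^ ((m : ℤ) - p) = w ^ (m : ℤ) / w ^ p := zpow_sub₀ hw.ne' _ _
      have e2 : w ^ ((m : ℤ) - 2 * p) = w ^ (m : ℤ) / (w ^ p * w ^ p) := by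
        rw [zpow_sub₀ hw.ne', two_mul, zpow_add₀ hw.ne']
      have e3 : w ^ ((m : ℤ) - 1) = w ^ (m : ℤ) / w := by rw [zpow_sub₀ hw.ne', zpow_one]
      simp only [hD, hA, e1, e2, e3, hK]
      have hw' := hw.ne'
      field_simp
      ring
    · filter_upwards [zpow_mul_zpow_eventuallyEq ((m : ℤ) - p) (-p)] with w hw
      rw [mul_right_comm, hw]
      congr 2
      ring
  · filter_upwards [hF, eventually_gt_atTop (0 : ℝ)] with w hw hw0
    exact ((hasDerivAt_zpow _ w (Or.inl hw0.ne')).const_mul K).sub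
      (((hasDerivAt_zpow _ w (Or.inl hw0.ne')).mul hw).const_mul _)
  · refine IsBigO.sub (((isBigO_refl _ _).const_mul_left _).const_mul_left K |>.trans
      (isBigO_zpow_atTop (by omega))) (IsBigO.const_mul_left (IsBigO.add ?_ ?_) _)
    · exact hzz ((hz _).const_mul_left _) hFO (by omega)
    · exact hzz (hz _) hF' (by omega)
  · refine IsBigO.trans (EventuallyEq.isBigO ?_)
      ((isBigO_refl (fun w : ℝ => w ^ ((m : ℤ) - 2 * p)) atTop).mul hmg)
    filter_upwards [zpow_mul_zpow_eventuallyEq ((m : ℤ) - 2 * p) ((m : ℤ) - 2)] with w hw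
    rw [hw]
    congr 1
    omega
  · have hΘ := isTheta_natCast_of_bounded (abs_sub_natCast_le_of_eq_arctan hun)
    exact ((hΘ.zpow _).1).mul (hgu u hu hΘ)

/-! ### Asymptotics in the root variable -/

theorem isBigO_one_log : (fun _ : ℝ => (1 : ℝ)) =O[atTop] Real.log :=
  (isLittleO_const_left_of_ne one_ne_zero).2
    (tendsto_norm_atTop_atTop.comp Real.tendsto_log_atTop) |>.isBigO

/-- Error terms containing a logarithm may be evaluated at the index instead of the root
variable. -/
theorem isBigO_log_comp {u : ℕ → ℝ} (hu : Tendsto u atTop atTop)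
    (hΘ : u =Θ[atTop] fun n : ℕ => (n : ℝ)) :
    (fun n => Real.log (u n)) =O[atTop] fun n : ℕ => Real.log n := by
  obtain ⟨C, hC⟩ := hΘ.1.bound
  have hlog : Tendsto (fun n : ℕ => Real.log n) atTop atTop :=
    Real.tendsto_log_atTop.comp tendsto_natCast_atTop_atTop
  refine IsBigO.of_bound 2 ?_
  filter_upwards [hC, hu.eventually_ge_atTop 1, hlog.eventually_ge_atTop (Real.log (max C 1)),
    eventually_gt_atTop 0] with n h1 h2 h3 h4
  have hn : (0 : ℝ) < n := by exact_mod_cast h4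
  have hM : (0 : ℝ) < max C 1 := lt_max_of_lt_right one_pos
  have hM0 : 0 ≤ Real.log (max C 1) := Real.log_nonneg (le_max_right _ _)
  rw [Real.norm_of_nonneg (by linarith), Real.norm_of_nonneg hn.le] at h1
  rw [Real.norm_of_nonneg (Real.log_nonneg h2), Real.norm_of_nonneg (hM0.trans h3)]
  calc Real.log (u n) ≤ Real.log (max C 1 * n) := by
        refine Real.log_le_log (by linarith) (h1.trans ?_)
        gcongr
        exact le_max_left _ _
    _ = Real.log (max C 1) + Real.log n := Real.log_mul hM.ne' hn.ne'
    _ ≤ 2 * Real.log n := by linarith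

section squareRootVariable

variable (P : ThetaParams)

/-- The root variable `v` of the other family of poles, `-ζ = α₁ - β₁v²`, as a function of the root
variable `w`, `ζ = α₂ + β₂w²`. -/
noncomputable def ThetaParams.conjRoot (w : ℝ) : ℝ := √((P.α₁ + P.α₂ + P.β₂ * w ^ 2) / P.β₁)

/-- The limit of the ratio of the root variables of the two families, `√(β₂ / β₁)`. -/
noncomputable def ThetaParams.ratio : ℝ := P.β₂ / √(P.β₁ * P.β₂)

theorem ThetaParams.ratio_pos : 0 < P.ratio := by
  have := P.β₁_pos
  have := P.β₂_pos
  unfold ratio; positivity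

theorem ThetaParams.ratio_sq : P.ratio ^ 2 = P.β₂ / P.β₁ := by
  have h1 := P.β₁_pos
  have h2 := P.β₂_pos
  rw [ratio, div_pow, Real.sq_sqrt (by positivity)]
  field_simp

theorem ThetaParams.conjRoot_pos (w : ℝ) : 0 < P.conjRoot w := by
  have h1 := P.β₁_pos
  have h2 := P.β₂_pos
  have h3 := P.α₁_pos
  have h4 := P.α₂_pos
  exact Real.sqrt_pos.2 (by positivity)

theorem ThetaParams.conjRoot_sq (w : ℝ) :
    P.conjRoot w ^ 2 = P.ratio ^ 2 * w ^ 2 + (P.α₁ + P.α₂) / P.β₁ := by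
  have h1 := P.β₁_pos
  have h2 := P.β₂_pos
  have h3 := P.α₁_pos
  have h4 := P.α₂_pos
  rw [conjRoot, Real.sq_sqrt (by positivity), P.ratio_sq]
  ring

theorem ThetaParams.ratio_mul_le_conjRoot (w : ℝ) : P.ratio * w ≤ P.conjRoot w := by
  have h1 := P.β₁_pos
  have h3 := P.α₁_pos
  have h4 := P.α₂_pos
  refine le_of_sq_le_sq ?_ (P.conjRoot_pos w).le
  rw [P.conjRoot_sq, mul_pow]
  have : 0 < (P.α₁ + P.α₂) / P.β₁ := by positivity
  linarith

theorem ThetaParams.isBigO_conjRoot_sub :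
    (fun w => P.conjRoot w - P.ratio * w) =O[atTop] fun w => w ^ (-1 : ℤ) := by
  refine IsBigO.of_bound ((P.α₁ + P.α₂) / P.β₁ / P.ratio) ?_
  filter_upwards [eventually_gt_atTop (0 : ℝ)] with w hw
  have h1 := P.β₁_pos
  have h3 := P.α₁_pos
  have h4 := P.α₂_pos
  have hr := P.ratio_pos
  have hv := P.conjRoot_pos w
  have hle := P.ratio_mul_le_conjRoot w
  have hsq := P.conjRoot_sq w
  rw [Real.norm_of_nonneg (sub_nonneg.2 hle), zpow_neg_one, Real.norm_of_nonneg (by positivity)]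
  have e : P.conjRoot w - P.ratio * w =
      (P.α₁ + P.α₂) / P.β₁ / (P.conjRoot w + P.ratio * w) := by
    rw [eq_div_iff (by positivity)]
    linear_combination hsq
  rw [e, ← div_eq_mul_inv, div_div _ P.ratio]
  gcongr
  linarith

theorem ThetaParams.isBigO_conjRoot : P.conjRoot =O[atTop] fun w => w ^ (1 : ℤ) := by
  have h : (fun w => P.ratio * w) =O[atTop] fun w : ℝ => w ^ (1 : ℤ) := by
    simpa only [zpow_one] using (isBigO_refl (fun w : ℝ => w) atTop).const_mul_left P.ratio
  exact ((P.isBigO_conjRoot_sub.trans (isBigO_zpow_atTop (by norm_num))).add h).congr_left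
    fun w => by ring

theorem ThetaParams.isBigO_conjRoot_inv :
    (fun w => (P.conjRoot w)⁻¹) =O[atTop] fun w => w ^ (-1 : ℤ) := by
  refine IsBigO.of_bound P.ratio⁻¹ ?_
  filter_upwards [eventually_gt_atTop (0 : ℝ)] with w hw
  have hr := P.ratio_pos
  have hv := P.conjRoot_pos w
  rw [zpow_neg_one, Real.norm_of_nonneg (by positivity), Real.norm_of_nonneg (by positivity),
    ← mul_inv]
  exact inv_anti₀ (by positivity) (P.ratio_mul_le_conjRoot w)

/-- The hyperbolic cotangent tends to `1` faster than any power; the fourth power suffices. -/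
theorem ThetaParams.isBigO_conjRoot_mul_invSqSum :
    (fun w => P.conjRoot w * invSqSum (P.conjRoot w ^ 2) - Real.pi) =O[atTop]
      fun w => w ^ (-4 : ℤ) := by
  refine (IsBigO.of_bound 6 (g := fun w => (P.conjRoot w)⁻¹ ^ 4) ?_).trans
    ((P.isBigO_conjRoot_inv.pow 4).trans (EventuallyEq.isBigO ?_))
  · filter_upwards with w
    have hv := P.conjRoot_pos w
    refine (abs_mul_invSqSum_sq_sub_pi_le hv).trans_eq ?_
    rw [Real.norm_of_nonneg (by positivity), inv_pow, div_eq_mul_inv]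
  · filter_upwards with w
    rw [← zpow_natCast, ← zpow_mul]
    norm_num

theorem isBigO_mul_zpow {f₁ f₂ : ℝ → ℝ} {k l n : ℤ} (h₁ : f₁ =O[atTop] fun w => w ^ k)
    (h₂ : f₂ =O[atTop] fun w => w ^ l) (h : k + l ≤ n) :
    (fun w => f₁ w * f₂ w) =O[atTop] fun w => w ^ n :=
  ((h₁.mul h₂).trans (zpow_mul_zpow_eventuallyEq _ _).isBigO).trans (isBigO_zpow_atTop h)

theorem ThetaParams.isBigO_invSqSum_conjRoot :
    (fun w => invSqSum (P.conjRoot w ^ 2)) =O[atTop] fun w => w ^ (-1 : ℤ) := by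
  have h : (fun _ : ℝ => Real.pi) =O[atTop] fun w : ℝ => w ^ (0 : ℤ) := by
    simpa only [zpow_zero] using isBigO_const_const Real.pi one_ne_zero atTop
  refine (isBigO_mul_zpow P.isBigO_conjRoot_inv
    ((P.isBigO_conjRoot_mul_invSqSum.trans (isBigO_zpow_atTop (by norm_num))).add h)
    (by norm_num)).congr_left fun w => ?_
  have hv := (P.conjRoot_pos w).ne'
  field_simp
  ring

theorem ThetaParams.isBigO_conjRoot_sq_mul_invSqSum :
    (fun w => P.conjRoot w ^ 2 * invSqSum (P.conjRoot w ^ 2) - Real.pi * P.ratio * w) =O[atTop]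
      fun w => w ^ (-1 : ℤ) := by
  refine ((isBigO_mul_zpow P.isBigO_conjRoot P.isBigO_conjRoot_mul_invSqSum (n := -1)
    (by norm_num)).add (P.isBigO_conjRoot_sub.const_mul_left Real.pi)).congr_left fun w => ?_
  ring

theorem ThetaParams.isBigO_conjRoot_pow_four_mul_invSqSum :
    (fun w => P.conjRoot w ^ 4 * invSqSum (P.conjRoot w ^ 2) - Real.pi * P.ratio ^ 3 * w ^ 3)
      =O[atTop] fun w => w ^ (1 : ℤ) := by
  have h := P.isBigO_conjRoot
  have hw : (fun w : ℝ => w) =O[atTop] fun w => w ^ (1 : ℤ) := by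
    simpa only [zpow_one] using isBigO_refl (fun w : ℝ => w) atTop
  have h2 := isBigO_mul_zpow h h (n := 2) (by norm_num)
  have h3 := isBigO_mul_zpow h2 h (n := 3) (by norm_num)
  have h4 := ((h2.const_mul_left 1).add ((isBigO_mul_zpow h hw (n := 2)
      (by norm_num)).const_mul_left
    P.ratio)).add ((isBigO_mul_zpow hw hw (n := 2) (by norm_num)).const_mul_left (P.ratio ^ 2))
  refine ((isBigO_mul_zpow h3 P.isBigO_conjRoot_mul_invSqSum (n := 1) (by norm_num)).add
    ((isBigO_mul_zpow P.isBigO_conjRoot_sub h4 (n := 1) (by norm_num)).const_mul_left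
      Real.pi)).congr_left fun w => ?_
  ring

theorem ThetaParams.two_mul_log_ratio : 2 * Real.log P.ratio = Real.log (P.β₂ / P.β₁) := by
  rw [← P.ratio_sq, Real.log_pow]
  norm_num

theorem ThetaParams.isBigO_log_conjRoot :
    (fun w => Real.log (P.conjRoot w) - Real.log w - Real.log P.ratio) =O[atTop]
      fun w => w ^ (-2 : ℤ) := by
  refine (IsBigO.of_bound 1 ?_).trans (isBigO_mul_zpow P.isBigO_conjRoot_sub
    ((isBigO_refl (fun w : ℝ => w ^ (-1 : ℤ)) atTop).const_mul_left P.ratio⁻¹) (by norm_num))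
  filter_upwards [eventually_gt_atTop (0 : ℝ)] with w hw
  have hr := P.ratio_pos
  have hv := P.conjRoot_pos w
  have hle := P.ratio_mul_le_conjRoot w
  have e : Real.log (P.conjRoot w) - Real.log w - Real.log P.ratio =
      Real.log (P.conjRoot w / (P.ratio * w)) := by
    rw [Real.log_div hv.ne' (by positivity), Real.log_mul hr.ne' hw.ne']
    ring
  have h1 : 1 ≤ P.conjRoot w / (P.ratio * w) := (one_le_div (by positivity)).2 hle
  rw [e, Real.norm_of_nonneg (Real.log_nonneg h1), one_mul, Real.norm_of_nonneg (mul_nonneg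
    (sub_nonneg.2 hle) (by positivity))]
  refine (Real.log_le_sub_one_of_pos (by linarith)).trans_eq ?_
  rw [zpow_neg_one]
  field_simp

theorem ThetaParams.isBigO_thetaDiff_one_conjRoot {s C : ℝ} (hs : 0 < s)
    (hC : Tendsto (logDiff s) atTop (𝓝 C)) :
    (fun w => thetaDiff 1 (P.conjRoot w ^ 2) s - (C - 2 * Real.log w - Real.log (P.β₂ / P.β₁)))
      =O[atTop] fun w => w ^ (-1 : ℤ) := by
  have h1 : (fun w => thetaDiff 1 (P.conjRoot w ^ 2) s - C + 2 * Real.log (P.conjRoot w))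
      =O[atTop] fun w => w ^ (-1 : ℤ) := by
    refine (IsBigO.of_bound 4 ?_).trans P.isBigO_invSqSum_conjRoot
    filter_upwards with w
    refine (abs_thetaDiff_one_sq_le hs hC (P.conjRoot_pos w)).trans ?_
    gcongr
    exact le_abs_self _
  refine (h1.sub ((P.isBigO_log_conjRoot.const_mul_left 2).trans
    (isBigO_zpow_atTop (by norm_num)))).congr_left fun w => ?_
  rw [← P.two_mul_log_ratio]
  ring

end squareRootVariable

/-- The sum `∑ 2n / (n² - w²)`, regularised as in `thetaDiff`, is a cotangent plus a
function that grows logarithmically through the poles. -/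
theorem exists_thetaDiff_one_neg_sq_eq {s : ℝ} (hs : 0 < s) {C : ℝ}
    (hC : Tendsto (logDiff s) atTop (𝓝 C)) : ∃ A : ℝ → ℝ,
      (∀ w, 0 < w → (∀ n : ℤ, (n : ℝ) ≠ w) →
        thetaDiff 1 (-w ^ 2) s = -(Real.pi * (Real.cos (Real.pi * w) / Real.sin
          (Real.pi * w))) + A w) ∧
      (fun w => A w - (C - 2 * Real.log w)) =O[atTop] fun w => w ^ (-1 : ℤ) := by
  classical
  refine ⟨fun w => if ∀ n : ℤ, (n : ℝ) ≠ w then thetaDiff 1 (-w ^ 2) s +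
    Real.pi * (Real.cos (Real.pi * w) / Real.sin (Real.pi * w)) else C - 2 * Real.log w,
    fun w _ hw => ?_, IsBigO.of_bound 3 ?_⟩
  · beta_reduce
    rw [if_pos hw]
    ring
  · filter_upwards [eventually_gt_atTop (0 : ℝ)] with w hw
    rw [zpow_neg_one, Real.norm_of_nonneg (inv_pos.2 hw).le, ← div_eq_mul_inv, Real.norm_eq_abs]
    split_ifs with h
    · convert abs_thetaDiff_one_neg_sq_le hs hC hw h using 2
      ring
    · rw [sub_self, abs_zero]
      positivity

/-! ### The equation for the roots in the root variable -/

theorem LargeRootsExpansion.congr {f : ℂ → ℂ} {q : ℝ} {a a' e e' : ℕ → ℝ}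
    (h : LargeRootsExpansion f q a e) (ha : a =ᶠ[atTop] a') (he : e =ᶠ[atTop] e') :
    LargeRootsExpansion f q a' e' := by
  obtain ⟨ζ, hζ, hO⟩ := h
  exact ⟨ζ, hζ, hO.congr' (ha.mono fun n hn => by beta_reduce; rw [hn]) he⟩

theorem real_sin_pi_mul_ne_zero {w : ℝ} (hw : ∀ n : ℤ, (n : ℝ) ≠ w) :
    Real.sin (Real.pi * w) ≠ 0 := by
  rw [Real.sin_ne_zero_iff]
  intro n hn
  rw [mul_comm] at hn
  exact hw n (mul_left_cancel₀ Real.pi_ne_zero hn)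

section rootVariable

variable (P : ThetaParams) {w : ℝ}

theorem ThetaParams.root_pos : 0 < P.α₂ + P.β₂ * w ^ 2 := by
  have := P.α₂_pos
  have := P.β₂_pos
  positivity

theorem thetaPole_ne_root (hw : ∀ n : ℤ, (n : ℝ) ≠ w) (hw0 : 0 < w) (n : ℕ) :
    thetaPole P.α₂ P.β₂ n ≠ P.α₂ + P.β₂ * w ^ 2 := by
  intro h
  have h1 : P.β₂ * (n : ℝ) ^ 2 = P.β₂ * w ^ 2 := add_left_cancel h
  have h2 := mul_left_cancel₀ P.β₂_pos.ne' h1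
  exact hw n ((pow_left_inj₀ n.cast_nonneg hw0.le two_ne_zero).1 h2)

theorem sq_add_neg_sq_ne_zero (hw : ∀ n : ℤ, (n : ℝ) ≠ w) (hw0 : 0 < w) (n : ℕ) :
    (n : ℝ) ^ 2 + -w ^ 2 ≠ 0 := by
  intro h
  have h2 : (n : ℝ) ^ 2 = w ^ 2 := by linarith
  exact hw n ((pow_left_inj₀ n.cast_nonneg hw0.le two_ne_zero).1 h2)

theorem ThetaParams.conjRoot_sq_eq :
    (P.α₁ - -(P.α₂ + P.β₂ * w ^ 2)) / P.β₁ = P.conjRoot w ^ 2 := by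
  rw [P.conjRoot_sq, P.ratio_sq]
  ring

theorem ThetaParams.neg_sq_eq : (P.α₂ - (P.α₂ + P.β₂ * w ^ 2)) / P.β₂ = -w ^ 2 := by
  have := P.β₂_pos.ne'
  field_simp
  ring

/-- The value of `φ(-ζ)` at `ζ = α₂ + β₂w²` between the poles, without compensator. -/
theorem realLaplace_root_zero (m : ℕ) (hw : ∀ n : ℤ, (n : ℝ) ≠ w) (hw0 : 0 < w) :
    realLaplace P m 0 (P.α₂ + P.β₂ * w ^ 2) =
      1 / 2 * P.σ ^ 2 * (P.α₂ + P.β₂ * w ^ 2) ^ 2 - P.μ * (P.α₂ + P.β₂ * w ^ 2) +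
        P.c₁ * thetaDiff m (P.conjRoot w ^ 2) (P.α₁ / P.β₁) +
        P.c₂ * thetaDiff m (-w ^ 2) (P.α₂ / P.β₂) := by
  rw [realLaplace, realHalfExponent_zero P.α₁_pos P.β₁_pos
    (fun n => by exact_mod_cast thetaPole_ne_neg P.α₁_pos P.β₁_pos P.root_pos n),
    realHalfExponent_zero P.α₂_pos P.β₂_pos (thetaPole_ne_root P hw hw0),
    P.conjRoot_sq_eq, P.neg_sq_eq]

/-- The value of `φ(-ζ)` at `ζ = α₂ + β₂w²` between the poles, with compensator. -/
theorem realLaplace_root_one {m : ℕ} (hm : m ≤ 2) (hw : ∀ n : ℤ, (n : ℝ) ≠ w) (hw0 : 0 < w) :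
    realLaplace P (m + 2) 1 (P.α₂ + P.β₂ * w ^ 2) =
      1 / 2 * P.σ ^ 2 * (P.α₂ + P.β₂ * w ^ 2) ^ 2 - P.μ * (P.α₂ + P.β₂ * w ^ 2) -
        P.c₁ * P.conjRoot w ^ 2 * thetaDiff m (P.conjRoot w ^ 2) (P.α₁ / P.β₁) +
        P.c₂ * w ^ 2 * thetaDiff m (-w ^ 2) (P.α₂ / P.β₂) -
        (P.c₁ * (P.α₁ / P.β₁) / P.β₁ * invSqSqSum m (P.α₁ / P.β₁) -
          P.c₂ * (P.α₂ / P.β₂) / P.β₂ * invSqSqSum m (P.α₂ / P.β₂)) *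
            (P.α₂ + P.β₂ * w ^ 2) := by
  rw [realLaplace, realHalfExponent_one P.α₁_pos P.β₁_pos hm
    (fun n => by exact_mod_cast thetaPole_ne_neg P.α₁_pos P.β₁_pos P.root_pos n),
    realHalfExponent_one P.α₂_pos P.β₂_pos hm (thetaPole_ne_root P hw hw0),
    P.conjRoot_sq_eq, P.neg_sq_eq]
  ring

end rootVariable

theorem levyCutoff_zero {m : ℕ} (hm : m ≤ 2) : levyCutoff (((m : ℝ) + 1) / 2) = (0 : ℕ) := by
  have : (m : ℝ) ≤ 2 := by exact_mod_cast hm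
  rw [levyCutoff, if_pos (by linarith), Nat.cast_zero]

theorem levyCutoff_one {m : ℕ} (hm : 3 ≤ m) : levyCutoff (((m : ℝ) + 1) / 2) = (1 : ℕ) := by
  have : (3 : ℝ) ≤ m := by exact_mod_cast hm
  rw [levyCutoff, if_neg (by linarith), Nat.cast_one]

/-- `largeRootsExpansion_of_isBigO` with a subleading part consisting of two powers. -/
theorem largeRootsExpansion_of_zpow (P : ThetaParams) {m h : ℕ} (hh : h < 2)
    (hmh : m ≤ 2 * h + 2) (hcut : levyCutoff (((m : ℝ) + 1) / 2) = h) {φ : ℂ → ℂ}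
    (hφ : IsLaplaceExponent P (((m : ℝ) + 1) / 2) φ) {q : ℝ} (hq : 0 < q) {B : ℝ → ℝ}
    {p i j r : ℤ} {b₀ k l : ℝ} (hb₀ : b₀ ≠ 0) (hmp : (m : ℤ) ≤ p) (hij : i ≤ j) (hjp : j < p)
    (hjr : 2 * j ≤ p + r) (hrp : r < p) (hmr : (m : ℤ) - 2 ≤ r)
    (heq : ∀ w, 1 < w → (∀ n : ℤ, (n : ℝ) ≠ w) →
      realLaplace P m h (P.α₂ + P.β₂ * w ^ 2) = q →
      P.c₂ * Real.pi * w ^ ((m : ℤ) - 1) * Real.cos (Real.pi * w) = B w * Real.sin (Real.pi * w))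
    (hB : (fun w => B w - (b₀ * w ^ p + (k * w ^ j + l * w ^ i))) =O[atTop] fun w => w ^ r) :
    LargeRootsExpansion (fun z => φ (-z)) q
      (fun n => P.β₂ * (n : ℝ) ^ 2 + P.α₂ + (2 * P.β₂ * P.c₂ / b₀ * (n : ℝ) ^ ((m : ℤ) - p) -
        2 * P.β₂ * P.c₂ / b₀ / b₀ *
          (k * (n : ℝ) ^ ((m : ℤ) - 2 * p + j) + l * (n : ℝ) ^ ((m : ℤ) - 2 * p + i))))
      (fun n => (n : ℝ) ^ ((m : ℤ) - 2 * p + r)) := by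
  have hz : ∀ k : ℤ, (fun w : ℝ => w ^ k) =O[atTop] fun w => w ^ k := fun k => isBigO_refl _ _
  have hF : (fun w : ℝ => k * w ^ j + l * w ^ i) =O[atTop] fun w => w ^ j :=
    ((hz j).const_mul_left k).add (((hz i).const_mul_left l).trans (isBigO_zpow_atTop hij))
  have hz' : ∀ k : ℤ, k ≤ j → (fun w : ℝ => (k : ℝ) * w ^ (k - 1)) =O[atTop] fun w => w ^ (p - 1) :=
    fun k hk => ((hz _).const_mul_left _).trans (isBigO_zpow_atTop (by omega))
  refine (largeRootsExpansion_of_isBigO P hh hmh hcut hφ hq (F := fun w => k * w ^ j + l * w ^ i)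
    (F' := fun w => k * (j * w ^ (j - 1)) + l * (i * w ^ (i - 1))) (g := fun w => w ^ r) hb₀ hmp heq
    hB ?_ (hF.trans_isLittleO (isLittleO_zpow_atTop hjp))
    (((hz' j le_rfl).const_mul_left k).add ((hz' i hij).const_mul_left l)) ?_
    (isLittleO_zpow_atTop hrp) (isBigO_zpow_atTop hmr) fun u _ hu => (hu.zpow r).1).congr ?_ ?_
  · filter_upwards [eventually_gt_atTop (0 : ℝ)] with w hw
    exact ((hasDerivAt_zpow _ w (Or.inl hw.ne')).const_mul k).add
      ((hasDerivAt_zpow _ w (Or.inl hw.ne')).const_mul l)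
  · refine (isBigO_mul_zpow hF hF (by omega : j + j ≤ p + r)).trans
      (zpow_mul_zpow_eventuallyEq _ _).symm.isBigO
  · filter_upwards [eventually_gt_atTop 0] with n hn
    have hn' : (n : ℝ) ≠ 0 := by exact_mod_cast hn.ne'
    rw [zpow_add₀ hn', zpow_add₀ hn']
    ring
  · filter_upwards [eventually_gt_atTop 0] with n hn
    have hn' : (n : ℝ) ≠ 0 := by exact_mod_cast hn.ne'
    rw [zpow_add₀ hn']

/-- `largeRootsExpansion_of_isBigO` with a subleading part consisting of a power, a logarithm and
a constant, and an error of order `wʳ (log w)ᵈ`. -/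
theorem largeRootsExpansion_of_log (P : ThetaParams) {m h : ℕ} (hh : h < 2)
    (hmh : m ≤ 2 * h + 2) (hcut : levyCutoff (((m : ℝ) + 1) / 2) = h) {φ : ℂ → ℂ}
    (hφ : IsLaplaceExponent P (((m : ℝ) + 1) / 2) φ) {q : ℝ} (hq : 0 < q) {B : ℝ → ℝ}
    {p j r : ℤ} {d : ℕ} {b₀ k l : ℝ} (hb₀ : b₀ ≠ 0) (hmp : (m : ℤ) ≤ p) (hjp : j < p)
    (hjr : 2 * j ≤ p + r) (hr : 0 < p + r) (hrp : r + 1 < p) (hmr : (m : ℤ) - 2 ≤ r)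
    (heq : ∀ w, 1 < w → (∀ n : ℤ, (n : ℝ) ≠ w) →
      realLaplace P m h (P.α₂ + P.β₂ * w ^ 2) = q →
      P.c₂ * Real.pi * w ^ ((m : ℤ) - 1) * Real.cos (Real.pi * w) = B w * Real.sin (Real.pi * w))
    (hB : (fun w => B w - (b₀ * w ^ p + (k * w ^ j + l * Real.log w))) =O[atTop]
      fun w => w ^ r * Real.log w ^ d) :
    LargeRootsExpansion (fun z => φ (-z)) q
      (fun n => P.β₂ * (n : ℝ) ^ 2 + P.α₂ + (2 * P.β₂ * P.c₂ / b₀ * (n : ℝ) ^ ((m : ℤ) - p) -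
        2 * P.β₂ * P.c₂ / b₀ / b₀ *
          (k * (n : ℝ) ^ ((m : ℤ) - 2 * p + j) + l * ((n : ℝ) ^ ((m : ℤ) - 2 * p) * Real.log n))))
      (fun n => (n : ℝ) ^ ((m : ℤ) - 2 * p + r) * Real.log n ^ d) := by
  have hz : ∀ k : ℤ, (fun w : ℝ => w ^ k) =O[atTop] fun w => w ^ k := fun k => isBigO_refl _ _
  have hlog : ∀ d : ℕ, (fun w => Real.log w ^ d) =o[atTop] fun w : ℝ => w ^ (1 : ℤ) := fun d =>
    Real.isLittleO_pow_log_id_atTop.congr_right fun w => (zpow_one w).symm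
  have hone : (fun _ : ℝ => (1 : ℝ)) =O[atTop] fun w => Real.log w ^ d := by
    simpa using isBigO_one_log.pow d
  have hzr : (fun w : ℝ => w ^ r) =O[atTop] fun w => w ^ r * Real.log w ^ d := by
    simpa using (hz r).mul hone
  have hFp : (fun w : ℝ => k * w ^ j + l * Real.log w) =o[atTop] fun w => w ^ p := by
    refine (((hz j).const_mul_left k).trans_isLittleO (isLittleO_zpow_atTop hjp)).add
      (IsLittleO.const_mul_left ?_ l)
    simpa only [pow_one] using (hlog 1).trans_isBigO (isBigO_zpow_atTop (by omega : 1 ≤ p))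
  refine (largeRootsExpansion_of_isBigO P hh hmh hcut hφ hq
    (F := fun w => k * w ^ j + l * Real.log w)
    (F' := fun w => k * (j * w ^ (j - 1)) + l * w⁻¹) (g := fun w => w ^ r * Real.log w ^ d) hb₀ hmp
    heq hB ?_ hFp ?_ ?_ ?_ ((isBigO_zpow_atTop hmr).trans hzr) fun u hu hu' =>
      ((hu'.zpow r).1).mul ((isBigO_log_comp hu hu').pow d)).congr ?_ ?_
  · filter_upwards [eventually_gt_atTop (0 : ℝ)] with w hw
    exact ((hasDerivAt_zpow _ w (Or.inl hw.ne')).const_mul k).add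
      ((Real.hasDerivAt_log hw.ne').const_mul l)
  · refine IsBigO.add (((hz _).const_mul_left _).const_mul_left k |>.trans
      (isBigO_zpow_atTop (by omega))) (IsBigO.const_mul_left ?_ l)
    simpa only [zpow_neg_one] using isBigO_zpow_atTop (by omega : (-1 : ℤ) ≤ p - 1)
  · have h1 := isBigO_mul_zpow ((hz j).const_mul_left (k ^ 2)) (hz j) (by omega : j + j ≤ p + r)
    have h2 := isBigO_mul_zpow ((hz j).const_mul_left (2 * k * l)) (hlog 1).isBigO
      (by omega : j + 1 ≤ p + r)
    have h3 := ((hlog 2).isBigO.trans (isBigO_zpow_atTop (by omega : 1 ≤ p + r))).const_mul_left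
      (l ^ 2)
    refine ((((h1.add h2).add h3).congr_left fun w => ?_).trans
      (zpow_mul_zpow_eventuallyEq p r).symm.isBigO).trans ((hz p).mul hzr)
    ring
  · exact (isBigO_mul_zpow (hz r) (hlog d).isBigO le_rfl).trans_isLittleO
      (isLittleO_zpow_atTop hrp)
  · filter_upwards [eventually_gt_atTop 0] with n hn
    have hn' : (n : ℝ) ≠ 0 := by exact_mod_cast hn.ne'
    rw [zpow_add₀ hn']
    ring
  · filter_upwards [eventually_gt_atTop 0] with n hn
    have hn' : (n : ℝ) ≠ 0 := by exact_mod_cast hn.ne'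
    rw [zpow_add₀ hn']
    ring

/-! ### The root expansions of the five families -/

theorem rpow_threeHalves {x : ℝ} (hx : 0 ≤ x) : x ^ (3 / 2 : ℝ) = √x ^ 3 := by
  rw [Real.sqrt_eq_rpow, ← Real.rpow_natCast, ← Real.rpow_mul hx]
  norm_num

theorem ThetaParams.ratio_pow_three (P : ThetaParams) :
    P.ratio ^ 3 = P.β₂ ^ (3 / 2 : ℝ) / P.β₁ ^ (3 / 2 : ℝ) := by
  have h1 := Real.sqrt_pos.2 P.β₁_pos
  have h2 := Real.sqrt_pos.2 P.β₂_pos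
  rw [rpow_threeHalves P.β₁_pos.le, rpow_threeHalves P.β₂_pos.le, ← div_pow, ratio,
    Real.sqrt_mul P.β₁_pos.le]
  congr 1
  rw [div_eq_div_iff (by positivity) h1.ne']
  linear_combination -√P.β₁ * Real.mul_self_sqrt P.β₂_pos.le

section expansions

variable (P : ThetaParams)

/-- The constant `γ` of the family `χ = 1/2`. -/
noncomputable def ThetaParams.halfConst : ℝ :=
  P.c₁ * invSqSum (P.α₁ / P.β₁) + P.c₂ * invSqSum (P.α₂ / P.β₂)

/-- The Gaussian and drift part `½σ²ζ² - μζ` of `φ(-ζ)` at `ζ = α₂ + β₂w²`. -/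
noncomputable def ThetaParams.quadPart (w : ℝ) : ℝ :=
  1 / 2 * P.σ ^ 2 * (P.α₂ + P.β₂ * w ^ 2) ^ 2 - P.μ * (P.α₂ + P.β₂ * w ^ 2)

variable {P} {w q : ℝ}

/-- The equation `φ(-ζ) = q` for `χ = 1/2` in the root variable. -/
theorem root_eq_half (hw1 : 1 < w) (hw : ∀ n : ℤ, (n : ℝ) ≠ w)
    (h : realLaplace P 0 0 (P.α₂ + P.β₂ * w ^ 2) = q) :
    P.c₂ * Real.pi * w ^ (((0 : ℕ) : ℤ) - 1) * Real.cos (Real.pi * w) =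
      (P.quadPart w + P.c₁ * invSqSum (P.conjRoot w ^ 2) - P.halfConst - q) *
        Real.sin (Real.pi * w) := by
  have hs := real_sin_pi_mul_ne_zero hw
  have hw0 : w ≠ 0 := by linarith
  rw [realLaplace_root_zero P 0 hw (by linarith), thetaDiff_zero, thetaDiff_zero,
    invSqSum_neg_sq hw, ← ThetaParams.quadPart] at h
  rw [Nat.cast_zero, zero_sub, zpow_neg_one, ThetaParams.halfConst, ← h]
  field_simp
  ring

/-- The equation `φ(-ζ) = q` for `χ = 1` in the root variable; `A` is the part of the series over
the poles in `ζ` that is regular there. -/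
theorem root_eq_one {A : ℝ → ℝ} (hA : ∀ w, 0 < w → (∀ n : ℤ, (n : ℝ) ≠ w) →
      thetaDiff 1 (-w ^ 2) (P.α₂ / P.β₂) =
        -(Real.pi * (Real.cos (Real.pi * w) / Real.sin (Real.pi * w))) + A w)
    (hw1 : 1 < w) (hw : ∀ n : ℤ, (n : ℝ) ≠ w)
    (h : realLaplace P 1 0 (P.α₂ + P.β₂ * w ^ 2) = q) :
    P.c₂ * Real.pi * w ^ (((1 : ℕ) : ℤ) - 1) * Real.cos (Real.pi * w) =
      (P.quadPart w + P.c₁ * thetaDiff 1 (P.conjRoot w ^ 2) (P.α₁ / P.β₁) + P.c₂ * A w - q) *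
        Real.sin (Real.pi * w) := by
  have hs := real_sin_pi_mul_ne_zero hw
  rw [realLaplace_root_zero P 1 hw (by linarith), hA w (by linarith) hw,
    ← ThetaParams.quadPart] at h
  rw [Nat.cast_one, sub_self, zpow_zero, ← h]
  field_simp
  ring

/-- The equation `φ(-ζ) = q` for `χ = 3/2` in the root variable. -/
theorem root_eq_threeHalves (hw1 : 1 < w) (hw : ∀ n : ℤ, (n : ℝ) ≠ w)
    (h : realLaplace P 2 0 (P.α₂ + P.β₂ * w ^ 2) = q) :
    P.c₂ * Real.pi * w ^ (((2 : ℕ) : ℤ) - 1) * Real.cos (Real.pi * w) =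
      (P.quadPart w - P.c₁ * (P.conjRoot w ^ 2 * invSqSum (P.conjRoot w ^ 2)) +
        (P.c₁ * (P.α₁ / P.β₁ * invSqSum (P.α₁ / P.β₁)) +
          P.c₂ * (P.α₂ / P.β₂ * invSqSum (P.α₂ / P.β₂))) - q) * Real.sin (Real.pi * w) := by
  have hs := real_sin_pi_mul_ne_zero hw
  have hw0 : w ≠ 0 := by linarith
  rw [realLaplace_root_zero P 2 hw (by linarith),
    thetaDiff_two (div_pos P.α₁_pos P.β₁_pos) fun n => (by have := P.conjRoot_pos w; positivity),
    thetaDiff_two (div_pos P.α₂_pos P.β₂_pos) (sq_add_neg_sq_ne_zero hw (by linarith)),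
    invSqSum_neg_sq hw, ← ThetaParams.quadPart] at h
  rw [show ((2 : ℕ) : ℤ) - 1 = 1 by norm_num, zpow_one, ← h]
  field_simp
  ring

variable (P) in
/-- The constant that the compensator contributes to the drift when `χ ≥ 2`. -/
noncomputable def ThetaParams.compConst (m : ℕ) : ℝ :=
  P.c₁ * (P.α₁ / P.β₁) / P.β₁ * invSqSqSum m (P.α₁ / P.β₁) -
    P.c₂ * (P.α₂ / P.β₂) / P.β₂ * invSqSqSum m (P.α₂ / P.β₂)

/-- The equation `φ(-ζ) = q` for `χ = 2` in the root variable; `A` is the part of the series over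
the poles in `ζ` that is regular there. -/
theorem root_eq_two {A : ℝ → ℝ} (hA : ∀ w, 0 < w → (∀ n : ℤ, (n : ℝ) ≠ w) →
      thetaDiff 1 (-w ^ 2) (P.α₂ / P.β₂) =
        -(Real.pi * (Real.cos (Real.pi * w) / Real.sin (Real.pi * w))) + A w)
    (hw1 : 1 < w) (hw : ∀ n : ℤ, (n : ℝ) ≠ w)
    (h : realLaplace P 3 1 (P.α₂ + P.β₂ * w ^ 2) = q) :
    P.c₂ * Real.pi * w ^ (((3 : ℕ) : ℤ) - 1) * Real.cos (Real.pi * w) =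
      (P.quadPart w -
        P.c₁ * (P.conjRoot w ^ 2 * thetaDiff 1 (P.conjRoot w ^ 2) (P.α₁ / P.β₁)) +
        P.c₂ * (w ^ 2 * A w) - P.compConst 1 * (P.α₂ + P.β₂ * w ^ 2) - q) *
        Real.sin (Real.pi * w) := by
  have hs := real_sin_pi_mul_ne_zero hw
  rw [realLaplace_root_one P (m := 1) (by norm_num) hw (by linarith), hA w (by linarith) hw,
    ← ThetaParams.quadPart, ← ThetaParams.compConst] at h
  rw [show ((3 : ℕ) : ℤ) - 1 = 2 by norm_num, zpow_ofNat, ← h]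
  field_simp
  ring

/-- The equation `φ(-ζ) = q` for `χ = 5/2` in the root variable. -/
theorem root_eq_fiveHalves (hw1 : 1 < w) (hw : ∀ n : ℤ, (n : ℝ) ≠ w)
    (h : realLaplace P 4 1 (P.α₂ + P.β₂ * w ^ 2) = q) :
    P.c₂ * Real.pi * w ^ (((4 : ℕ) : ℤ) - 1) * Real.cos (Real.pi * w) =
      (P.quadPart w + P.c₁ * (P.conjRoot w ^ 4 * invSqSum (P.conjRoot w ^ 2)) -
        P.c₁ * (P.α₁ / P.β₁ * invSqSum (P.α₁ / P.β₁)) * P.conjRoot w ^ 2 +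
        P.c₂ * (P.α₂ / P.β₂ * invSqSum (P.α₂ / P.β₂)) * w ^ 2 -
        P.compConst 2 * (P.α₂ + P.β₂ * w ^ 2) - q) * Real.sin (Real.pi * w) := by
  have hs := real_sin_pi_mul_ne_zero hw
  have hw0 : w ≠ 0 := by linarith
  rw [realLaplace_root_one P (m := 2) (by norm_num) hw (by linarith),
    thetaDiff_two (div_pos P.α₁_pos P.β₁_pos) fun n => (by have := P.conjRoot_pos w; positivity),
    thetaDiff_two (div_pos P.α₂_pos P.β₂_pos) (sq_add_neg_sq_ne_zero hw (by linarith)),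
    invSqSum_neg_sq hw, ← ThetaParams.quadPart, ← ThetaParams.compConst] at h
  rw [show ((4 : ℕ) : ℤ) - 1 = 3 by norm_num, zpow_ofNat, ← h]
  field_simp
  ring

theorem isBigO_const_zpow (c : ℝ) {r : ℤ} (hr : 0 ≤ r) :
    (fun _ : ℝ => c) =O[atTop] fun w => w ^ r :=
  (isBigO_const_const c one_ne_zero atTop).trans
    ((isBigO_zpow_atTop hr).congr_left fun w => zpow_zero w)

variable {φ : ℂ → ℂ}

/-- Here `B` is `½σ²ζ² - μζ + O(1)`. -/
theorem largeRootsExpansion_half_gaussian (hφ : IsLaplaceExponent P (1 / 2) φ) (hq : 0 < q)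
    (hσ : P.σ ≠ 0) :
    LargeRootsExpansion (fun z => φ (-z)) q
      (fun n => P.β₂ * (n : ℝ) ^ 2 + P.α₂ + 4 / P.σ ^ 2 * (P.c₂ / P.β₂) * (n : ℝ) ^ (-4 : ℤ)
        + 8 / P.σ ^ 4 * (P.c₂ / P.β₂ ^ 2) * (P.μ - P.α₂ * P.σ ^ 2) * (n : ℝ) ^ (-6 : ℤ))
      (fun n => (n : ℝ) ^ (-8 : ℤ)) := by
  have hβ := P.β₂_pos.ne'
  have hχ : (((0 : ℕ) : ℝ) + 1) / 2 = 1 / 2 := by norm_num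
  refine (largeRootsExpansion_of_zpow P (m := 0) (h := 0) (by norm_num) (by norm_num)
    (levyCutoff_zero (by norm_num)) (hχ.symm ▸ hφ) hq (p := 4) (i := 2) (j := 2) (r := 0)
    (b₀ := 1 / 2 * P.σ ^ 2 * P.β₂ ^ 2) (k := P.σ ^ 2 * P.α₂ * P.β₂ - P.μ * P.β₂) (l := 0)
    (by positivity) (by norm_num) (by norm_num) (by norm_num) (by norm_num) (by norm_num)
      (by norm_num)
    (fun w hw1 hw h => root_eq_half hw1 hw h) ?_).congr ?_ (by simp)
  · refine (((P.isBigO_invSqSum_conjRoot.const_mul_left P.c₁).trans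
      (isBigO_zpow_atTop (by norm_num))).add (isBigO_const_zpow
        (1 / 2 * P.σ ^ 2 * P.α₂ ^ 2 - P.μ * P.α₂ -
        P.halfConst - q) le_rfl)).congr_left fun w => ?_
    simp only [ThetaParams.quadPart, zpow_ofNat]
    ring
  · filter_upwards [eventually_gt_atTop 0] with n hn
    have hn' : (n : ℝ) ≠ 0 := by exact_mod_cast hn.ne'
    norm_num
    field_simp
    ring

/-- Here `B` is `-μζ - γ - q + O(1 / w)`. -/
theorem largeRootsExpansion_half_drift (hφ : IsLaplaceExponent P (1 / 2) φ) (hq : 0 < q)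
    (hσ : P.σ = 0) (hμ : P.μ ≠ 0) :
    LargeRootsExpansion (fun z => φ (-z)) q
      (fun n => P.β₂ * (n : ℝ) ^ 2 + P.α₂ - 2 * P.c₂ / P.μ * (n : ℝ) ^ (-2 : ℤ)
        + 2 / P.μ ^ 2 * (P.c₂ / P.β₂) * (P.μ * P.α₂ + P.halfConst + q) * (n : ℝ) ^ (-4 : ℤ))
      (fun n => (n : ℝ) ^ (-5 : ℤ)) := by
  have hβ := P.β₂_pos.ne'
  have hχ : (((0 : ℕ) : ℝ) + 1) / 2 = 1 / 2 := by norm_num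
  refine (largeRootsExpansion_of_zpow P (m := 0) (h := 0) (by norm_num) (by norm_num)
    (levyCutoff_zero (by norm_num)) (hχ.symm ▸ hφ) hq (p := 2) (i := 0) (j := 0) (r := -1)
    (b₀ := -P.μ * P.β₂) (k := -P.μ * P.α₂ - P.halfConst - q) (l := 0)
    (mul_ne_zero (neg_ne_zero.2 hμ) hβ) (by norm_num) (by norm_num) (by norm_num) (by norm_num)
      (by norm_num) (by norm_num)
    (fun w hw1 hw h => root_eq_half hw1 hw h) ?_).congr ?_ (by simp)
  · refine (P.isBigO_invSqSum_conjRoot.const_mul_left P.c₁).congr_left fun w => ?_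
    simp only [ThetaParams.quadPart, zpow_ofNat, hσ]
    ring
  · filter_upwards [eventually_gt_atTop 0] with n hn
    have hn' : (n : ℝ) ≠ 0 := by exact_mod_cast hn.ne'
    norm_num
    field_simp
    ring

/-- Here `B` is `½σ²ζ² - μζ - 2(c₁ + c₂) log w + O(1)`. -/
theorem largeRootsExpansion_one_gaussian (hφ : IsLaplaceExponent P 1 φ) (hq : 0 < q)
    (hσ : P.σ ≠ 0) :
    LargeRootsExpansion (fun z => φ (-z)) q
      (fun n => P.β₂ * (n : ℝ) ^ 2 + P.α₂ + 4 / P.σ ^ 2 * (P.c₂ / P.β₂) * (n : ℝ) ^ (-3 : ℤ)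
        + 8 / P.σ ^ 4 * (P.c₂ / P.β₂ ^ 2) * (P.μ - P.α₂ * P.σ ^ 2) * (n : ℝ) ^ (-5 : ℤ)
        + 16 / P.σ ^ 4 * (P.c₂ * (P.c₁ + P.c₂) / P.β₂ ^ 3) * ((n : ℝ) ^ (-7 : ℤ) * Real.log n))
      (fun n => (n : ℝ) ^ (-7 : ℤ)) := by
  have hβ := P.β₂_pos.ne'
  obtain ⟨C₁, hC₁⟩ := exists_tendsto_logDiff (div_pos P.α₁_pos P.β₁_pos)
  obtain ⟨C₂, hC₂⟩ := exists_tendsto_logDiff (div_pos P.α₂_pos P.β₂_pos)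
  obtain ⟨A, hA, hAO⟩ := exists_thetaDiff_one_neg_sq_eq (div_pos P.α₂_pos P.β₂_pos) hC₂
  have hD := P.isBigO_thetaDiff_one_conjRoot (div_pos P.α₁_pos P.β₁_pos) hC₁
  have hχ : (((1 : ℕ) : ℝ) + 1) / 2 = 1 := by norm_num
  refine (largeRootsExpansion_of_log P (m := 1) (h := 0) (by norm_num) (by norm_num)
    (levyCutoff_zero (by norm_num)) (hχ.symm ▸ hφ) hq (p := 4) (j := 2) (r := 0) (d := 0)
    (b₀ := 1 / 2 * P.σ ^ 2 * P.β₂ ^ 2) (k := P.σ ^ 2 * P.α₂ * P.β₂ - P.μ * P.β₂)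
    (l := -2 * (P.c₁ + P.c₂))
    (by positivity) (by norm_num) (by norm_num) (by norm_num) (by norm_num) (by norm_num)
      (by norm_num)
    (fun w hw1 hw h => root_eq_one hA hw1 hw h) ?_).congr ?_ (by simp)
  · refine ((((hD.const_mul_left P.c₁).add (hAO.const_mul_left P.c₂)).trans
      (isBigO_zpow_atTop (by norm_num))).add (isBigO_const_zpow
        (1 / 2 * P.σ ^ 2 * P.α₂ ^ 2 - P.μ * P.α₂ + P.c₁ * C₁ + P.c₂ * C₂ -
        P.c₁ * Real.log (P.β₂ / P.β₁) - q) le_rfl)).congr (fun w => ?_) fun w => by simp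
    simp only [ThetaParams.quadPart, zpow_ofNat]
    ring
  · filter_upwards [eventually_gt_atTop 0] with n hn
    have hn' : (n : ℝ) ≠ 0 := by exact_mod_cast hn.ne'
    norm_num
    field_simp
    ring

/-- Here `B` is `-μζ - 2(c₁ + c₂) log w + γ - q - c₁ log(β₂ / β₁) + O(1 / w)`. -/
theorem largeRootsExpansion_one_drift (hφ : IsLaplaceExponent P 1 φ) (hq : 0 < q)
    (hσ : P.σ = 0) (hμ : P.μ ≠ 0) {C₁ C₂ : ℝ}
    (hC₁ : Tendsto (logDiff (P.α₁ / P.β₁)) atTop (𝓝 C₁))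
    (hC₂ : Tendsto (logDiff (P.α₂ / P.β₂)) atTop (𝓝 C₂)) :
    LargeRootsExpansion (fun z => φ (-z)) q
      (fun n => P.β₂ * (n : ℝ) ^ 2 + P.α₂ - 2 * P.c₂ / P.μ * (n : ℝ) ^ (-1 : ℤ)
        + 2 / P.μ ^ 2 * (P.c₂ / P.β₂) * (2 * (P.c₁ + P.c₂) * Real.log n +
          (P.μ * P.α₂ - (P.c₁ * C₁ + P.c₂ * C₂) + q + P.c₁ * Real.log (P.β₂ / P.β₁))) *
          (n : ℝ) ^ (-3 : ℤ))
      (fun n => (n : ℝ) ^ (-4 : ℤ) * Real.log n) := by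
  have hβ := P.β₂_pos.ne'
  obtain ⟨A, hA, hAO⟩ := exists_thetaDiff_one_neg_sq_eq (div_pos P.α₂_pos P.β₂_pos) hC₂
  have hD := P.isBigO_thetaDiff_one_conjRoot (div_pos P.α₁_pos P.β₁_pos) hC₁
  have hχ : (((1 : ℕ) : ℝ) + 1) / 2 = 1 := by norm_num
  refine (largeRootsExpansion_of_log P (m := 1) (h := 0) (by norm_num) (by norm_num)
    (levyCutoff_zero (by norm_num)) (hχ.symm ▸ hφ) hq (p := 2) (j := 0) (r := -1) (d := 1)
    (b₀ := -P.μ * P.β₂) (l := -2 * (P.c₁ + P.c₂))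
    (k := -P.μ * P.α₂ + (P.c₁ * C₁ + P.c₂ * C₂) - q - P.c₁ * Real.log (P.β₂ / P.β₁))
    (mul_ne_zero (neg_ne_zero.2 hμ) hβ) (by norm_num) (by norm_num) (by norm_num) (by norm_num)
      (by norm_num) (by norm_num)
    (fun w hw1 hw h => root_eq_one hA hw1 hw h) ?_).congr ?_ (by simp)
  · have hlog : (fun w : ℝ => w ^ (-1 : ℤ)) =O[atTop] fun w => w ^ (-1 : ℤ) * Real.log w ^ 1 := by
      simpa using (isBigO_refl (fun w : ℝ => w ^ (-1 : ℤ)) atTop).mul isBigO_one_log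
    refine (((hD.const_mul_left P.c₁).add (hAO.const_mul_left P.c₂)).trans hlog).congr_left
      fun w => ?_
    simp only [ThetaParams.quadPart, zpow_ofNat, hσ]
    ring
  · filter_upwards [eventually_gt_atTop 0] with n hn
    have hn' : (n : ℝ) ≠ 0 := by exact_mod_cast hn.ne'
    norm_num
    field_simp
    ring

/-- Here `B` is `½σ²ζ² - μζ - c₁πκw + O(1)`, where `κ` is `P.ratio`. -/
theorem largeRootsExpansion_threeHalves_gaussian (hφ : IsLaplaceExponent P (3 / 2) φ) (hq : 0 < q)
    (hσ : P.σ ≠ 0) :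
    LargeRootsExpansion (fun z => φ (-z)) q
      (fun n => P.β₂ * (n : ℝ) ^ 2 + P.α₂ + 4 / P.σ ^ 2 * (P.c₂ / P.β₂) * (n : ℝ) ^ (-2 : ℤ)
        + 8 / P.σ ^ 4 * (P.c₂ / P.β₂ ^ 2) * (P.μ - P.α₂ * P.σ ^ 2) * (n : ℝ) ^ (-4 : ℤ)
        + 8 * Real.pi / P.σ ^ 4 * (P.c₁ * P.c₂ / (P.β₂ ^ 2 * √(P.β₁ * P.β₂))) *
          (n : ℝ) ^ (-5 : ℤ))
      (fun n => (n : ℝ) ^ (-6 : ℤ)) := by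
  have hβ := P.β₂_pos.ne'
  have hχ : (((2 : ℕ) : ℝ) + 1) / 2 = 3 / 2 := by norm_num
  refine (largeRootsExpansion_of_zpow P (m := 2) (h := 0) (by norm_num) (by norm_num)
    (levyCutoff_zero (by norm_num)) (hχ.symm ▸ hφ) hq (p := 4) (i := 1) (j := 2) (r := 0)
    (b₀ := 1 / 2 * P.σ ^ 2 * P.β₂ ^ 2) (k := P.σ ^ 2 * P.α₂ * P.β₂ - P.μ * P.β₂)
    (l := -P.c₁ * Real.pi * P.ratio)
    (by positivity) (by norm_num) (by norm_num) (by norm_num) (by norm_num) (by norm_num)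
      (by norm_num)
    (fun w hw1 hw h => root_eq_threeHalves hw1 hw h) ?_).congr ?_ (by simp)
  · refine (((P.isBigO_conjRoot_sq_mul_invSqSum.const_mul_left (-P.c₁)).trans
      (isBigO_zpow_atTop (by norm_num))).add (isBigO_const_zpow
        (1 / 2 * P.σ ^ 2 * P.α₂ ^ 2 - P.μ * P.α₂ +
        (P.c₁ * (P.α₁ / P.β₁ * invSqSum (P.α₁ / P.β₁)) +
          P.c₂ * (P.α₂ / P.β₂ * invSqSum (P.α₂ / P.β₂))) - q) le_rfl)).congr_left fun w => ?_
    simp only [ThetaParams.quadPart, zpow_ofNat]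
    ring
  · filter_upwards [eventually_gt_atTop 0] with n hn
    have hn' : (n : ℝ) ≠ 0 := by exact_mod_cast hn.ne'
    have hs := (Real.sqrt_pos.2 (mul_pos P.β₁_pos P.β₂_pos)).ne'
    rw [ThetaParams.ratio]
    norm_num
    field_simp
    ring

/-- Here `B` is `-μζ - c₁πκw + O(1)`, where `κ` is `P.ratio`. -/
theorem largeRootsExpansion_threeHalves_drift (hφ : IsLaplaceExponent P (3 / 2) φ) (hq : 0 < q)
    (hσ : P.σ = 0) (hμ : P.μ ≠ 0) :
    LargeRootsExpansion (fun z => φ (-z)) q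
      (fun n => P.β₂ * (n : ℝ) ^ 2 + P.α₂ - 2 * P.c₂ / P.μ
        + 2 * Real.pi / P.μ ^ 2 * (P.c₁ * P.c₂ / √(P.β₁ * P.β₂)) * (n : ℝ) ^ (-1 : ℤ))
      (fun n => (n : ℝ) ^ (-2 : ℤ)) := by
  have hβ := P.β₂_pos.ne'
  have hχ : (((2 : ℕ) : ℝ) + 1) / 2 = 3 / 2 := by norm_num
  refine (largeRootsExpansion_of_zpow P (m := 2) (h := 0) (by norm_num) (by norm_num)
    (levyCutoff_zero (by norm_num)) (hχ.symm ▸ hφ) hq (p := 2) (i := 1) (j := 1) (r := 0)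
    (b₀ := -P.μ * P.β₂) (k := -P.c₁ * Real.pi * P.ratio) (l := 0)
    (mul_ne_zero (neg_ne_zero.2 hμ) hβ) (by norm_num) (by norm_num) (by norm_num) (by norm_num)
      (by norm_num) (by norm_num)
    (fun w hw1 hw h => root_eq_threeHalves hw1 hw h) ?_).congr ?_ (by simp)
  · refine (((P.isBigO_conjRoot_sq_mul_invSqSum.const_mul_left (-P.c₁)).trans
      (isBigO_zpow_atTop (by norm_num))).add (isBigO_const_zpow (-P.μ * P.α₂ +
        (P.c₁ * (P.α₁ / P.β₁ * invSqSum (P.α₁ / P.β₁)) +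
          P.c₂ * (P.α₂ / P.β₂ * invSqSum (P.α₂ / P.β₂))) - q) le_rfl)).congr_left fun w => ?_
    simp only [ThetaParams.quadPart, zpow_ofNat, hσ]
    ring
  · filter_upwards [eventually_gt_atTop 0] with n hn
    have hn' : (n : ℝ) ≠ 0 := by exact_mod_cast hn.ne'
    have hs := (Real.sqrt_pos.2 (mul_pos P.β₁_pos P.β₂_pos)).ne'
    rw [ThetaParams.ratio]
    norm_num
    field_simp
    ring

/-- Here `B` is `½σ²ζ² + O(w² log w)`: the drift is dominated by the series. -/
theorem largeRootsExpansion_two_gaussian (hφ : IsLaplaceExponent P 2 φ) (hq : 0 < q)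
    (hσ : P.σ ≠ 0) :
    LargeRootsExpansion (fun z => φ (-z)) q
      (fun n => P.β₂ * (n : ℝ) ^ 2 + P.α₂ + 4 / P.σ ^ 2 * (P.c₂ / P.β₂) * (n : ℝ) ^ (-1 : ℤ))
      (fun n => (n : ℝ) ^ (-3 : ℤ) * Real.log n) := by
  have hβ := P.β₂_pos.ne'
  obtain ⟨C₁, hC₁⟩ := exists_tendsto_logDiff (div_pos P.α₁_pos P.β₁_pos)
  obtain ⟨C₂, hC₂⟩ := exists_tendsto_logDiff (div_pos P.α₂_pos P.β₂_pos)
  obtain ⟨A, hA, hAO⟩ := exists_thetaDiff_one_neg_sq_eq (div_pos P.α₂_pos P.β₂_pos) hC₂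
  have hD := P.isBigO_thetaDiff_one_conjRoot (div_pos P.α₁_pos P.β₁_pos) hC₁
  have hχ : (((3 : ℕ) : ℝ) + 1) / 2 = 2 := by norm_num
  refine (largeRootsExpansion_of_log P (m := 3) (h := 1) (by norm_num) (by norm_num)
    (levyCutoff_one (by norm_num)) (hχ.symm ▸ hφ) hq (p := 4) (j := 0) (r := 2) (d := 1)
    (b₀ := 1 / 2 * P.σ ^ 2 * P.β₂ ^ 2) (k := 0) (l := 0)
    (by positivity) (by norm_num) (by norm_num) (by norm_num) (by norm_num) (by norm_num)
      (by norm_num)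
    (fun w hw1 hw h => root_eq_two hA hw1 hw h) ?_).congr ?_ (by simp)
  · have hw2 : ∀ c : ℝ, (fun w : ℝ => c * w ^ 2) =O[atTop] fun w => w ^ 2 * Real.log w :=
      fun c => by
      simpa using ((isBigO_refl (fun w : ℝ => w ^ 2) atTop).const_mul_left c).mul isBigO_one_log
    have hO1 : ∀ {f : ℝ → ℝ}, (f =O[atTop] fun w => w ^ (0 : ℤ)) →
        f =O[atTop] fun w => w ^ 2 * Real.log w := fun hf =>
      (hf.trans (isBigO_zpow_atTop (by norm_num : (0 : ℤ) ≤ 2))).trans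
        ((hw2 1).congr_left fun w => by simp)
    have hA' : A =O[atTop] Real.log := by
      refine (((hAO.trans (isBigO_zpow_atTop (by norm_num : (-1 : ℤ) ≤ 0))).add
        (isBigO_const_zpow C₂ le_rfl)).trans (isBigO_one_log.congr_left fun w => by simp)).sub
        ((isBigO_refl Real.log atTop).const_mul_left 2) |>.congr_left fun w => by ring
    have hD' : (fun w => thetaDiff 1 (P.conjRoot w ^ 2) (P.α₁ / P.β₁)) =O[atTop] Real.log := by
      refine (((hD.trans (isBigO_zpow_atTop (by norm_num : (-1 : ℤ) ≤ 0))).add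
        (isBigO_const_zpow (C₁ - Real.log (P.β₂ / P.β₁)) le_rfl)).trans
        (isBigO_one_log.congr_left fun w => by simp)).sub
        ((isBigO_refl Real.log atTop).const_mul_left 2) |>.congr_left fun w => by ring
    have hv : (fun w => P.conjRoot w ^ 2) =O[atTop] fun w => w ^ 2 :=
      (P.isBigO_conjRoot.pow 2).congr_right fun w => by rw [zpow_one]
    refine (((((hv.mul hD').const_mul_left (-P.c₁)).add
      (((isBigO_refl (fun w : ℝ => w ^ 2) atTop).mul hA').const_mul_left P.c₂)).add
      (hw2 (P.σ ^ 2 * P.α₂ * P.β₂ - P.μ * P.β₂ - P.compConst 1 * P.β₂))).add (hO1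
        (isBigO_const_zpow (1 / 2 * P.σ ^ 2 * P.α₂ ^ 2 - P.μ * P.α₂ -
        P.compConst 1 * P.α₂ - q) le_rfl))).congr (fun w => ?_) fun w => by simp
    simp only [ThetaParams.quadPart, zpow_ofNat]
    ring
  · filter_upwards [eventually_gt_atTop 0] with n hn
    have hn' : (n : ℝ) ≠ 0 := by exact_mod_cast hn.ne'
    simp only [zero_mul, add_zero, mul_zero, sub_zero]
    rw [show ((3 : ℕ) : ℤ) - 4 = -1 by norm_num]
    field_simp
    ring

/-- Here `B` is `½σ²ζ² + c₁πκ³w³ + O(w²)`, where `κ` is `P.ratio`. -/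
theorem largeRootsExpansion_fiveHalves_gaussian (hφ : IsLaplaceExponent P (5 / 2) φ) (hq : 0 < q)
    (hσ : P.σ ≠ 0) :
    LargeRootsExpansion (fun z => φ (-z)) q
      (fun n => P.β₂ * (n : ℝ) ^ 2 + P.α₂ + 4 / P.σ ^ 2 * (P.c₂ / P.β₂)
        - 8 * Real.pi / P.σ ^ 4 * (P.c₁ * P.c₂ / (P.β₁ * P.β₂) ^ (3 / 2 : ℝ)) * (n : ℝ) ^ (-1 : ℤ))
      (fun n => (n : ℝ) ^ (-2 : ℤ)) := by
  have hβ := P.β₂_pos.ne'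
  have hχ : (((4 : ℕ) : ℝ) + 1) / 2 = 5 / 2 := by norm_num
  refine (largeRootsExpansion_of_zpow P (m := 4) (h := 1) (by norm_num) (by norm_num)
    (levyCutoff_one (by norm_num)) (hχ.symm ▸ hφ) hq (p := 4) (i := 3) (j := 3) (r := 2)
    (b₀ := 1 / 2 * P.σ ^ 2 * P.β₂ ^ 2) (k := P.c₁ * Real.pi * P.ratio ^ 3) (l := 0)
    (by positivity) (by norm_num) (by norm_num) (by norm_num) (by norm_num) (by norm_num)
      (by norm_num)
    (fun w hw1 hw h => root_eq_fiveHalves hw1 hw h) ?_).congr ?_ (by simp)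
  · have hv : (fun w => P.conjRoot w ^ 2) =O[atTop] fun w => w ^ (2 : ℤ) :=
      (P.isBigO_conjRoot.pow 2).congr_right fun w => by rw [zpow_one, zpow_ofNat]
    have hw2 := isBigO_refl (fun w : ℝ => w ^ (2 : ℤ)) atTop
    refine (((((P.isBigO_conjRoot_pow_four_mul_invSqSum.const_mul_left P.c₁).trans
      (isBigO_zpow_atTop (by norm_num))).add (hv.const_mul_left
        (-(P.c₁ * (P.α₁ / P.β₁ * invSqSum (P.α₁ / P.β₁)))))).add (hw2.const_mul_left
        (P.σ ^ 2 * P.α₂ * P.β₂ - P.μ * P.β₂ - P.compConst 2 * P.β₂ +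
          P.c₂ * (P.α₂ / P.β₂ * invSqSum (P.α₂ / P.β₂))))).add (isBigO_const_zpow
            (1 / 2 * P.σ ^ 2 * P.α₂ ^ 2 - P.μ * P.α₂ -
        P.compConst 2 * P.α₂ - q) (by norm_num))).congr_left fun w => ?_
    simp only [ThetaParams.quadPart, zpow_ofNat]
    ring
  · filter_upwards [eventually_gt_atTop 0] with n hn
    have hn' : (n : ℝ) ≠ 0 := by exact_mod_cast hn.ne'
    have hs := (Real.sqrt_pos.2 (mul_pos P.β₁_pos P.β₂_pos)).ne'
    rw [ThetaParams.ratio, rpow_threeHalves (mul_pos P.β₁_pos P.β₂_pos).le]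
    norm_num
    field_simp
    ring

/-- `arctan` to first order at an arbitrary point, with an explicit quadratic error. -/
theorem abs_arctan_sub_arctan_sub_le (x y : ℝ) :
    |Real.arctan x - Real.arctan y - (x - y) / (1 + y ^ 2)| ≤ |x - y| ^ 2 := by
  have hd : ∀ t : ℝ, HasDerivAt (fun t => Real.arctan t - t / (1 + y ^ 2))
      (1 / (1 + t ^ 2) - 1 / (1 + y ^ 2)) t := fun t =>
    (Real.hasDerivAt_arctan t).sub ((hasDerivAt_id t).div_const _)
  have h := (convex_uIcc y x).norm_image_sub_le_of_norm_hasDerivWithin_le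
    (f := fun t => Real.arctan t - t / (1 + y ^ 2))
    (f' := fun t => 1 / (1 + t ^ 2) - 1 / (1 + y ^ 2)) (C := |x - y|)
    (fun t _ => (hd t).hasDerivWithinAt) (fun t ht => ?_) Set.left_mem_uIcc Set.right_mem_uIcc
  · rw [Real.norm_eq_abs, Real.norm_eq_abs] at h
    convert h using 1
    · congr 1; ring
    · ring
  · have ht' : |t - y| ≤ |x - y| := Set.abs_sub_left_of_mem_uIcc ht
    have h1 : (0 : ℝ) < 1 + t ^ 2 := by positivity
    have h2 : (0 : ℝ) < 1 + y ^ 2 := by positivity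
    have e : 1 / (1 + t ^ 2) - 1 / (1 + y ^ 2) =
        -((t - y) * ((t + y) / ((1 + t ^ 2) * (1 + y ^ 2)))) := by field_simp; ring
    have h3 : |(t + y) / ((1 + t ^ 2) * (1 + y ^ 2))| ≤ 1 := by
      rw [abs_div, abs_of_pos (mul_pos h1 h2), div_le_one (mul_pos h1 h2), abs_le]
      constructor <;> nlinarith [sq_nonneg (t + 1), sq_nonneg (t - 1), sq_nonneg (y + 1),
        sq_nonneg (y - 1), mul_nonneg (sq_nonneg t) (sq_nonneg y)]
    rw [e, norm_neg, norm_mul]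
    exact (mul_le_of_le_one_right (norm_nonneg _) h3).trans ht'

variable (P) in
/-- The constant `ρ` of the family `χ = 5/2`. -/
noncomputable def ThetaParams.driftConst : ℝ :=
  P.μ + P.c₁ * (P.α₁ / P.β₁ * invSqSum (P.α₁ / P.β₁)) / P.β₁ -
    P.c₂ * (P.α₂ / P.β₂ * invSqSum (P.α₂ / P.β₂)) / P.β₂ + P.compConst 2

/-- The arctangent that locates the roots when the two sides of `a₀w³ cot(πw) = b₀w³ - b₁w² + O(w)`
are of the same order: `arctan` is linearized at `a₀ / b₀` instead of at `0`. -/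
theorem isBigO_arctan_div_sub {a₀ b₀ b₁ : ℝ} (hb₀ : 0 < b₀) {B : ℝ → ℝ}
    (hB : (fun w => B w - (b₀ * w ^ 3 - b₁ * w ^ 2)) =O[atTop] fun w => w ^ (1 : ℤ)) :
    ((∀ᶠ w in atTop, 0 < B w) ∨ ∀ᶠ w in atTop, B w < 0) ∧
    (fun w => Real.arctan (a₀ * w ^ 3 / B w) - Real.arctan (a₀ / b₀) -
      a₀ * b₁ / (b₀ ^ 2 + a₀ ^ 2) * w⁻¹) =O[atTop] fun w => w ^ (-2 : ℤ) := by
  have hw2 : ∀ c : ℝ, (fun w : ℝ => c * w ^ 2) =O[atTop] fun w => w ^ (2 : ℤ) := fun c =>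
    ((isBigO_refl (fun w : ℝ => w ^ (2 : ℤ)) atTop).const_mul_left c).congr_left fun w => by
      rw [zpow_ofNat]
  have hw1 : (fun w : ℝ => w) =O[atTop] fun w => w ^ (1 : ℤ) := by
    simpa only [zpow_one] using isBigO_refl (fun w : ℝ => w) atTop
  have hnum : (fun w => b₁ * w ^ 2 - (B w - (b₀ * w ^ 3 - b₁ * w ^ 2))) =O[atTop]
      fun w => w ^ (2 : ℤ) := (hw2 b₁).sub (hB.trans (isBigO_zpow_atTop (by norm_num)))
  obtain ⟨hsign, hinv⟩ := eventually_sign_of_leading hb₀.ne' (B := B) (p := 3)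
    ((hnum.trans_isLittleO (isLittleO_zpow_atTop (by norm_num : (2 : ℤ) < 3))).neg_left.congr_left
      fun w => by simp only [zpow_ofNat]; ring)
  refine ⟨hsign, ?_⟩
  have hB0 : ∀ᶠ w in atTop, B w ≠ 0 := by
    rcases hsign with h | h
    · exact h.mono fun w hw => hw.ne'
    · exact h.mono fun w hw => hw.ne
  have hX : (fun w => a₀ * w ^ 3 / B w - a₀ / b₀) =O[atTop] fun w => w ^ (-1 : ℤ) := by
    refine ((isBigO_mul_zpow hnum hinv (n := -1) (by norm_num)).const_mul_left (a₀ / b₀)).congr'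
      ?_ EventuallyEq.rfl
    filter_upwards [hB0] with w hw
    field_simp
    ring
  have hX2 : (fun w => a₀ * w ^ 3 / B w - a₀ / b₀ - a₀ * b₁ / b₀ ^ 2 * w⁻¹) =O[atTop]
      fun w => w ^ (-2 : ℤ) := by
    have h1 := (hnum.const_mul_left b₁).sub ((isBigO_mul_zpow hB hw1 (n := 2)
      (by norm_num)).const_mul_left b₀)
    have h2 := isBigO_mul_zpow hinv (isBigO_refl (fun w : ℝ => w ^ (-1 : ℤ)) atTop) (n := -4)
      (by norm_num)
    refine ((isBigO_mul_zpow h1 h2 (n := -2) (by norm_num)).const_mul_left (a₀ / b₀ ^ 2)).congr'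
      ?_ EventuallyEq.rfl
    filter_upwards [hB0, eventually_gt_atTop (0 : ℝ)] with w hw hw0
    rw [zpow_neg_one]
    field_simp
    ring
  have hT : (fun w => Real.arctan (a₀ * w ^ 3 / B w) - Real.arctan (a₀ / b₀) -
      (a₀ * w ^ 3 / B w - a₀ / b₀) / (1 + (a₀ / b₀) ^ 2)) =O[atTop] fun w => w ^ (-2 : ℤ) := by
    refine (IsBigO.of_bound 1 (Eventually.of_forall fun w => ?_)).trans
      (isBigO_mul_zpow hX hX (by norm_num))
    rw [one_mul, Real.norm_eq_abs, Real.norm_eq_abs, abs_mul, ← sq]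
    exact abs_arctan_sub_arctan_sub_le _ _
  refine (hT.add (hX2.const_mul_left (1 + (a₀ / b₀) ^ 2)⁻¹)).congr_left fun w => ?_
  have : b₀ ^ 2 + a₀ ^ 2 ≠ 0 := by positivity
  field_simp
  ring

/-- With `uₙ = n + θ(uₙ)`, `θ(w) = θ₀ + d / w + O(w⁻²)`, the number `u²` is `(n + θ₀)² + 2d` up to
`O(1 / n)`. -/
theorem isBigO_sq_sub_of_shift {θ : ℝ → ℝ} {θ₀ d : ℝ}
    (hθ : (fun w => θ w - θ₀ - d * w⁻¹) =O[atTop] fun w => w ^ (-2 : ℤ)) {u : ℕ → ℝ}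
    (hu : Tendsto u atTop atTop) (hΘ : u =Θ[atTop] fun n : ℕ => (n : ℝ))
    (hun : ∀ᶠ n : ℕ in atTop, u n = n + θ (u n)) :
    (fun n => u n ^ 2 - ((n + θ₀) ^ 2 + 2 * d)) =O[atTop] fun n : ℕ => (n : ℝ) ^ (-1 : ℤ) := by
  have hw1 : (fun w : ℝ => w) =O[atTop] fun w => w ^ (1 : ℤ) := by
    simpa only [zpow_one] using isBigO_refl (fun w : ℝ => w) atTop
  have hδ : (fun w => θ w - θ₀) =O[atTop] fun w => w ^ (-1 : ℤ) := by
    refine ((hθ.trans (isBigO_zpow_atTop (by norm_num : (-2 : ℤ) ≤ -1))).add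
      ((isBigO_refl (fun w : ℝ => w ^ (-1 : ℤ)) atTop).const_mul_left d)).congr_left fun w => ?_
    rw [zpow_neg_one]
    ring
  have h : (fun w => 2 * w * (θ w - θ₀) - (θ w - θ₀) ^ 2 - 2 * d) =O[atTop]
      fun w => w ^ (-1 : ℤ) := by
    refine (((isBigO_mul_zpow hw1 hθ (n := -1) (by norm_num)).const_mul_left 2).sub
      (isBigO_mul_zpow hδ hδ (n := -1) (by norm_num))).congr' ?_ EventuallyEq.rfl
    filter_upwards [eventually_gt_atTop (0 : ℝ)] with w hw
    field_simp
    ring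
  refine ((h.comp_tendsto hu).trans ((hΘ.zpow (-1)).1)).congr' ?_ EventuallyEq.rfl
  filter_upwards [hun] with n hn
  have : (n : ℝ) = u n - θ (u n) := by linarith
  simp only [Function.comp_apply]
  rw [this]
  ring

/-- Here `B` is `c₁πκ³w³ - ρβ₂w² + O(w)`, where `κ` is `P.ratio`, and the left-hand side `c₂πw³` of
the cotangent equation is of the same order. -/
theorem largeRootsExpansion_fiveHalves_drift (hφ : IsLaplaceExponent P (5 / 2) φ) (hq : 0 < q)
    (hσ : P.σ = 0) :
    LargeRootsExpansion (fun z => φ (-z)) q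
      (fun n => P.β₂ * ((n : ℝ) + 1 / Real.pi *
          Real.arctan (P.c₂ * P.β₁ ^ (3 / 2 : ℝ) / (P.c₁ * P.β₂ ^ (3 / 2 : ℝ)))) ^ 2
        + P.α₂ + 2 * P.driftConst / Real.pi ^ 2 *
          (P.c₂ * P.β₂ ^ 2 * P.β₁ ^ 3 / (P.c₁ ^ 2 * P.β₂ ^ 3 + P.c₂ ^ 2 * P.β₁ ^ 3)))
      (fun n => (n : ℝ) ^ (-1 : ℤ)) := by
  have hβ := P.β₂_pos.ne'
  have hβ₁ := P.β₁_pos.ne'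
  have hc₁ := P.c₁_pos
  have hc₂ := P.c₂_pos
  have hr := P.ratio_pos
  have hπ := Real.pi_pos
  have hχ : (((4 : ℕ) : ℝ) + 1) / 2 = 5 / 2 := by norm_num
  set B : ℝ → ℝ := fun w => P.quadPart w +
    P.c₁ * (P.conjRoot w ^ 4 * invSqSum (P.conjRoot w ^ 2)) -
    P.c₁ * (P.α₁ / P.β₁ * invSqSum (P.α₁ / P.β₁)) * P.conjRoot w ^ 2 +
    P.c₂ * (P.α₂ / P.β₂ * invSqSum (P.α₂ / P.β₂)) * w ^ 2 -
    P.compConst 2 * (P.α₂ + P.β₂ * w ^ 2) - q with hBdef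
  have hB : (fun w => B w - (P.c₁ * Real.pi * P.ratio ^ 3 * w ^ 3 - P.driftConst * P.β₂ * w ^ 2))
      =O[atTop] fun w => w ^ (1 : ℤ) := by
    refine ((P.isBigO_conjRoot_pow_four_mul_invSqSum.const_mul_left P.c₁).add (isBigO_const_zpow
      (-P.μ * P.α₂ - P.c₁ * (P.α₁ / P.β₁ * invSqSum (P.α₁ / P.β₁)) * ((P.α₁ + P.α₂) / P.β₁) -
        P.compConst 2 * P.α₂ - q) (by norm_num))).congr_left fun w => ?_
    simp only [hBdef, P.conjRoot_sq, P.ratio_sq, ThetaParams.quadPart, ThetaParams.driftConst, hσ]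
    field_simp
    ring
  obtain ⟨hsign, hO⟩ := isBigO_arctan_div_sub (a₀ := P.c₂ * Real.pi) (by positivity) hB
  refine largeRootsExpansion_of_cot P (m := 4) (h := 1) (by norm_num) (by norm_num)
    (levyCutoff_one (by norm_num)) (hχ.symm ▸ hφ) hq (A := fun w => P.c₂ * Real.pi * w ^ 3) (B := B)
    ?_ hsign (fun w hw1 hw h => by simpa using root_eq_fiveHalves hw1 hw h) fun u hu hun => ?_
  · filter_upwards [eventually_gt_atTop (0 : ℝ)] with w hw
    positivity
  have hΘ := isTheta_natCast_of_bounded (abs_sub_natCast_le_of_eq_arctan hun)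
  have hθ := (hO.const_mul_left Real.pi⁻¹).congr_left fun w => show _ =
    Real.arctan (P.c₂ * Real.pi * w ^ 3 / B w) / Real.pi -
      Real.arctan (P.c₂ / (P.c₁ * P.ratio ^ 3)) / Real.pi - P.driftConst / Real.pi ^ 2 *
        (P.c₂ * P.β₂ / (P.c₁ ^ 2 * P.ratio ^ 6 + P.c₂ ^ 2)) * w⁻¹ by
    rw [show P.c₂ * Real.pi / (P.c₁ * Real.pi * P.ratio ^ 3) = P.c₂ / (P.c₁ * P.ratio ^ 3) by
      field_simp]
    have : P.c₁ ^ 2 * P.ratio ^ 6 + P.c₂ ^ 2 ≠ 0 := by positivity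
    have : (P.c₁ * Real.pi * P.ratio ^ 3) ^ 2 + (P.c₂ * Real.pi) ^ 2 ≠ 0 := by positivity
    field_simp
  have e1 : P.c₂ / (P.c₁ * P.ratio ^ 3) =
      P.c₂ * P.β₁ ^ (3 / 2 : ℝ) / (P.c₁ * P.β₂ ^ (3 / 2 : ℝ)) := by
    have h1 := Real.rpow_pos_of_pos P.β₁_pos (3 / 2)
    have h2 := Real.rpow_pos_of_pos P.β₂_pos (3 / 2)
    rw [P.ratio_pow_three]
    field_simp
  have e2 : P.c₂ * P.β₂ ^ 2 * P.β₁ ^ 3 / (P.c₁ ^ 2 * P.β₂ ^ 3 + P.c₂ ^ 2 * P.β₁ ^ 3) =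
      P.c₂ * P.β₂ ^ 2 / (P.c₁ ^ 2 * P.ratio ^ 6 + P.c₂ ^ 2) := by
    have h1 := P.β₁_pos
    have h2 := P.β₂_pos
    have h3 : P.c₁ ^ 2 * P.β₂ ^ 3 + P.c₂ ^ 2 * P.β₁ ^ 3 ≠ 0 := by positivity
    have h4 : P.c₁ ^ 2 * P.ratio ^ 6 + P.c₂ ^ 2 ≠ 0 := by positivity
    rw [div_eq_div_iff h3 h4, show P.ratio ^ 6 = (P.ratio ^ 2) ^ 3 by ring, P.ratio_sq]
    field_simp
  refine ((isBigO_sq_sub_of_shift hθ hu hΘ hun).const_mul_left P.β₂).congr_left fun n => ?_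
  rw [e1, e2]
  ring

end expansions

/-! ### The constants of the closed forms -/

section constants

/-- The hyperbolic cotangent of the closed forms, on the positive half-line. -/
theorem complexCoth_cpow_half {s : ℝ} (hs : 0 < s) :
    Real.pi * complexCoth (Real.pi * (s : ℂ) ^ (1 / 2 : ℂ)) = ((√s * invSqSum s : ℝ) : ℂ) := by
  have h1 : (s : ℂ) ^ (1 / 2 : ℂ) = (√s : ℂ) := by
    rw [Real.sqrt_eq_rpow, Complex.ofReal_cpow hs.le]
    norm_num
  have hv := Real.sqrt_pos.2 hs
  have h2 := invSqSum_sq hv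
  rw [Real.sq_sqrt hs.le] at h2
  rw [complexCoth, h1, h2]
  push_cast
  have : (√s : ℂ) ≠ 0 := by exact_mod_cast hv.ne'
  field_simp

theorem cpow_neg_half_mul_complexCoth {s : ℝ} (hs : 0 < s) :
    Real.pi * (s : ℂ) ^ (-(1 / 2) : ℂ) * complexCoth (Real.pi * (s : ℂ) ^ (1 / 2 : ℂ)) =
      invSqSum s := by
  have h1 : (s : ℂ) ^ (-(1 / 2) : ℂ) = ((√s)⁻¹ : ℝ) := by
    rw [Real.sqrt_eq_rpow, ← Real.rpow_neg hs.le, Complex.ofReal_cpow hs.le]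
    norm_num
  rw [mul_right_comm, complexCoth_cpow_half hs, h1, ← Complex.ofReal_mul]
  have := (Real.sqrt_pos.2 hs).ne'
  congr 1
  field_simp

theorem cpow_threeHalves_mul_complexCoth {s : ℝ} (hs : 0 < s) :
    Real.pi * (s : ℂ) ^ (3 / 2 : ℂ) * complexCoth (Real.pi * (s : ℂ) ^ (1 / 2 : ℂ)) =
      (s ^ 2 * invSqSum s : ℝ) := by
  have h1 : (s : ℂ) ^ (3 / 2 : ℂ) = (s * √s : ℝ) := by
    rw [Real.sqrt_eq_rpow, ← Real.rpow_one_add' hs.le (by norm_num), Complex.ofReal_cpow hs.le]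
    norm_num
  rw [mul_right_comm, complexCoth_cpow_half hs, h1, ← Complex.ofReal_mul]
  congr 1
  linear_combination s * invSqSum s * Real.sq_sqrt hs.le

variable {P : ThetaParams} {γ ρ : ℝ}

theorem eq_halfConst_of_closedHalf {μ : ℝ} (h : closedHalf P μ γ 0 = 0) : γ = P.halfConst := by
  have h1 := cpow_neg_half_mul_complexCoth (div_pos P.α₁_pos P.β₁_pos)
  have h2 := cpow_neg_half_mul_complexCoth (div_pos P.α₂_pos P.β₂_pos)
  push_cast [div_eq_mul_inv (_ : ℂ) (P.β₁ : ℂ), div_eq_mul_inv (_ : ℂ) (P.β₂ : ℂ)] at h1 h2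
  simp only [closedHalf, mul_zero, sub_zero, add_zero] at h
  have : (γ : ℂ) = P.halfConst := by
    rw [ThetaParams.halfConst]
    push_cast
    linear_combination h + P.c₁ * h1 + P.c₂ * h2
  exact_mod_cast this

theorem eq_of_closedOne {μ : ℝ} (h : closedOne P μ γ 0 = 0) {C₁ C₂ : ℝ}
    (hC₁ : Tendsto (logDiff (P.α₁ / P.β₁)) atTop (𝓝 C₁))
    (hC₂ : Tendsto (logDiff (P.α₂ / P.β₂)) atTop (𝓝 C₂)) : γ = P.c₁ * C₁ + P.c₂ * C₂ := by
  have key : ∀ {s C : ℝ}, 0 < s → Tendsto (logDiff s) atTop (𝓝 C) →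
      Complex.digamma (Complex.I * (s : ℂ) ^ (1 / 2 : ℂ)) +
        Complex.digamma (-Complex.I * (s : ℂ) ^ (1 / 2 : ℂ)) = C := fun {s C} hs hC => by
    have h1 : (s : ℂ) ^ (1 / 2 : ℂ) = (√s : ℂ) := by
      rw [Real.sqrt_eq_rpow, Complex.ofReal_cpow hs.le]
      norm_num
    have h2 := tendsto_logDiff_digamma (Real.sqrt_pos.2 hs)
    rw [Real.sq_sqrt hs.le] at h2
    rw [h1]
    exact tendsto_nhds_unique h2 ((Complex.continuous_ofReal.tendsto C).comp hC)
  have h1 := key (div_pos P.α₁_pos P.β₁_pos) hC₁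
  have h2 := key (div_pos P.α₂_pos P.β₂_pos) hC₂
  push_cast [div_eq_mul_inv (_ : ℂ) (P.β₁ : ℂ), div_eq_mul_inv (_ : ℂ) (P.β₂ : ℂ)] at h1 h2
  simp only [closedOne, mul_zero, sub_zero, add_zero] at h
  have : (γ : ℂ) = (P.c₁ * C₁ + P.c₂ * C₂ : ℝ) := by
    push_cast
    linear_combination -h + P.c₁ * h1 + P.c₂ * h2
  exact_mod_cast this

/-- The compensated partial fraction series vanishes to second order at the origin. -/
theorem hasDerivAt_realHalfExponent_zero {α β : ℝ} (c : ℝ) (hα : 0 < α) (hβ : 0 < β) {m : ℕ}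
    (hm : m ≤ 4) : HasDerivAt (realHalfExponent α β c m 1) 0 0 := by
  have hne : ∀ n, ((thetaPole α β n : ℝ) : ℂ) ≠ ((0 : ℝ) : ℂ) := fun n => by
    exact_mod_cast (thetaPole_pos hα hβ n).ne'
  have hG := (analyticAt_stieltjes (tendsto_thetaPole α hβ) (summable_mass_div hα hβ (m := m)
      (h := 1)
    (by omega)) (z := ((0 : ℝ) : ℂ)) fun n => Or.inr (hne n)).differentiableAt.hasDerivAt
  have h2 : HasDerivAt (halfExponent α β c m 1) 0 ((0 : ℝ) : ℂ) := by
    exact (((hasDerivAt_pow 2 ((0 : ℝ) : ℂ)).const_mul ((c : ℂ) * β)).mul hG).congr_deriv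
      (by simp)
  have h3 := h2.real_of_complex
  refine (h3.congr_of_eventuallyEq (Eventually.of_forall fun x => ?_)).congr_deriv (by simp)
  simp [halfExponent_ofReal]

/-- The series of the closed form for `χ = 5/2` differs from the compensated series by a polynomial
of degree one in `x`. -/
theorem sq_mul_invSqSum_eq {α β : ℝ} (hα : 0 < α) (hβ : 0 < β) {x : ℝ} (hx : |x| < α) :
    ((α - x) / β) ^ 2 * invSqSum ((α - x) / β) =
      realHalfExponent α β 1 4 1 x + (α - x) / β * (α / β * invSqSum (α / β)) -
        x / β * (α / β) * invSqSqSum 2 (α / β) := by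
  have h1 := (abs_lt.1 hx).2
  have hs : 0 < (α - x) / β := div_pos (by linarith) hβ
  have hle : ∀ n, α ≤ thetaPole α β n := fun n => by
    rw [thetaPole]
    have : 0 ≤ β * (n : ℝ) ^ 2 := by positivity
    linarith
  rw [realHalfExponent_one hα hβ le_rfl fun n => (h1.trans_le (hle n)).ne',
    thetaDiff_two (div_pos hα hβ) fun n => by positivity]
  ring

theorem hasDerivAt_sq_mul_invSqSum {α β : ℝ} (hα : 0 < α) (hβ : 0 < β) :
    HasDerivAt (fun x => ((α - x) / β) ^ 2 * invSqSum ((α - x) / β))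
      (-(α / β * (invSqSum (α / β) + invSqSqSum 2 (α / β)) / β)) 0 := by
  have h1 := (((hasDerivAt_realHalfExponent_zero 1 hα hβ (m := 4) le_rfl).add
    (((((hasDerivAt_id (0 : ℝ)).const_sub α).div_const β)).mul_const
      (α / β * invSqSum (α / β)))).sub
    ((((hasDerivAt_id (0 : ℝ)).div_const β).mul_const (α / β)).mul_const (invSqSqSum 2 (α / β))))
  refine (h1.congr_of_eventuallyEq ?_).congr_deriv (by ring)
  have : ∀ᶠ x : ℝ in 𝓝 0, |x| < α := by
    have := (continuous_abs (G := ℝ)).tendsto 0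
    rw [abs_zero] at this
    exact this.eventually_lt_const hα
  filter_upwards [this] with x hx
  exact sq_mul_invSqSum_eq hα hβ hx

/-- On the segment of the imaginary axis around the origin the closed form is real. -/
theorem closedFiveHalves_I_mul {t : ℝ} (h₁ : -P.α₁ < t) (h₂ : t < P.α₂) :
    closedFiveHalves P ρ γ (Complex.I * t) =
      ((-(1 / 2 * P.σ ^ 2 * t ^ 2) + ρ * t -
        P.c₁ * (((P.α₁ - -t) / P.β₁) ^ 2 * invSqSum ((P.α₁ - -t) / P.β₁)) -
        P.c₂ * (((P.α₂ - t) / P.β₂) ^ 2 * invSqSum ((P.α₂ - t) / P.β₂)) + γ : ℝ) : ℂ) := by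
  have e1 := cpow_threeHalves_mul_complexCoth (s := (P.α₁ - -t) / P.β₁)
    (div_pos (by linarith) P.β₁_pos)
  have e2 := cpow_threeHalves_mul_complexCoth (s := (P.α₂ - t) / P.β₂)
    (div_pos (by linarith) P.β₂_pos)
  have i1 : ((P.α₁ : ℂ) - Complex.I * (Complex.I * t)) * (P.β₁ : ℂ)⁻¹ =
      ((P.α₁ - -t) / P.β₁ : ℝ) := by
    push_cast
    rw [← mul_assoc, Complex.I_mul_I, div_eq_mul_inv]
    ring
  have i2 : ((P.α₂ : ℂ) + Complex.I * (Complex.I * t)) * (P.β₂ : ℂ)⁻¹ =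
      ((P.α₂ - t) / P.β₂ : ℝ) := by
    push_cast
    rw [← mul_assoc, Complex.I_mul_I, div_eq_mul_inv]
    ring
  rw [closedFiveHalves, i1, i2]
  simp only [Complex.ofReal_add, Complex.ofReal_sub (_ - _), Complex.ofReal_mul P.c₁,
    Complex.ofReal_mul P.c₂, ← e1, ← e2, Complex.ofReal_sub (_ + _)]
  push_cast
  linear_combination (1 / 2 * (P.σ : ℂ) ^ 2 * t ^ 2 - ρ * t) * Complex.I_sq

theorem eq_driftConst_of_hasDerivAt
    (h : HasDerivAt (closedFiveHalves P ρ γ) (-Complex.I * P.μ) 0) : ρ = P.driftConst := by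
  have hI : HasDerivAt (fun t : ℝ => Complex.I * (t : ℂ)) Complex.I 0 := by
    simpa using (Complex.ofRealCLM.hasDerivAt (x := (0 : ℝ))).const_mul Complex.I
  have h1 : HasDerivAt (fun t : ℝ => closedFiveHalves P ρ γ (Complex.I * t)) ((P.μ : ℝ) : ℂ) 0 := by
    have h0 : HasDerivAt (closedFiveHalves P ρ γ) (-Complex.I * P.μ) (Complex.I *
        ((0 : ℝ) : ℂ)) := by
      simpa using h
    refine (h0.comp (0 : ℝ) hI).congr_deriv ?_
    linear_combination -(P.μ : ℂ) * Complex.I_sq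
  have d1 := (hasDerivAt_sq_mul_invSqSum P.α₁_pos P.β₁_pos)
  rw [← neg_zero] at d1
  have d1' := d1.comp (0 : ℝ) (hasDerivAt_neg (0 : ℝ))
  have d2 := hasDerivAt_sq_mul_invSqSum P.α₂_pos P.β₂_pos
  have h2 := (((((((hasDerivAt_pow 2 (0 : ℝ)).const_mul (1 / 2 * P.σ ^ 2)).neg).add
    ((hasDerivAt_id (0 : ℝ)).const_mul ρ)).sub (d1'.const_mul P.c₁)).sub
    (d2.const_mul P.c₂)).add_const γ).ofReal_comp
  have h4 := h1.unique (h2.congr_of_eventuallyEq (by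
    filter_upwards [eventually_gt_nhds (neg_lt_zero.2 P.α₁_pos), eventually_lt_nhds P.α₂_pos]
      with t ht1 ht2
    exact closedFiveHalves_I_mul ht1 ht2))
  have h5 := Complex.ofReal_injective h4
  rw [ThetaParams.driftConst, ThetaParams.compConst, h5]
  have := P.β₁_pos.ne'
  have := P.β₂_pos.ne'
  simp
  field_simp
  ring

end constants

/-! ### Duality, existence and uniqueness -/

/-- The parameters of the dual process `-X`: the indices `1` and `2` are interchanged and the drift
changes sign. -/
def ThetaParams.swap (P : ThetaParams) : ThetaParams where
  σ := P.σ
  μ := -P.μ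
  α₁ := P.α₂
  α₂ := P.α₁
  β₁ := P.β₂
  β₂ := P.β₁
  c₁ := P.c₂
  c₂ := P.c₁
  σ_nonneg := P.σ_nonneg
  α₁_pos := P.α₂_pos
  α₂_pos := P.α₁_pos
  β₁_pos := P.β₂_pos
  β₂_pos := P.β₁_pos
  c₁_pos := P.c₂_pos
  c₂_pos := P.c₁_pos

theorem levyDensity_swap (P : ThetaParams) (χ x : ℝ) :
    levyDensity P.swap χ x = levyDensity P χ (-x) := by
  unfold levyDensity ThetaParams.swap
  rcases lt_trichotomy x 0 with hx | rfl | hx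
  · simp [hx, hx.le]
  · simp
  · simp [hx, hx.le]

theorem charExponent_swap (P : ThetaParams) (χ z : ℝ) :
    charExponent P.swap χ z = charExponent P χ (-z) := by
  rw [charExponent, charExponent, ← integral_neg_eq_self]
  simp only [levyDensity_swap, neg_neg]
  simp [ThetaParams.swap]

theorem IsLaplaceExponent.swap {P : ThetaParams} {χ : ℝ} {φ : ℂ → ℂ}
    (h : IsLaplaceExponent P χ φ) : IsLaplaceExponent P.swap χ fun z => φ (-z) := by
  refine ⟨fun z _ => (meromorphicNFAt_comp_iff_of_deriv_ne_zero (g := fun z => -z) (by fun_prop)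
    (by simp)).2 (h.1 (Set.mem_univ (-z))), fun y => ?_⟩
  rw [charExponent_swap, ← h.2]
  push_cast
  ring_nf

theorem existsUnique_isLaplaceExponent (P : ThetaParams) {m h : ℕ} (hh : h < 2)
    (hmh : m ≤ 2 * h + 2) (hcut : levyCutoff (((m : ℝ) + 1) / 2) = h) :
    ∃! φ : ℂ → ℂ, IsLaplaceExponent P (((m : ℝ) + 1) / 2) φ :=
  ⟨_, isLaplaceExponent_laplaceSeries P hh hmh hcut, fun _ hψ =>
    hψ.unique (isLaplaceExponent_laplaceSeries P hh hmh hcut)⟩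

theorem ThetaParams.driftConst_swap (P : ThetaParams) : P.swap.driftConst = -P.driftConst := by
  simp only [driftConst, compConst, swap]
  ring

theorem ThetaParams.halfConst_swap (P : ThetaParams) : P.swap.halfConst = P.halfConst := by
  simp only [halfConst, swap]
  ring

end

theorem mainTheorem6 (P : ThetaParams) (q : ℝ) (hq : 0 < q) :
    -- the Laplace exponent exists and is unique in each of the five families
    (∀ χ ∈ ({1 / 2, 1, 3 / 2, 2, 5 / 2} : Set ℝ), ∃! φ : ℂ → ℂ, IsLaplaceExponent P χ φ) ∧
    -- the family with singularity of order 1/2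
    (∀ φ : ℂ → ℂ, IsLaplaceExponent P (1 / 2) φ →
      (P.σ ≠ 0 →
        LargeRootsExpansion (fun z => φ (-z)) q
            (fun n => P.β₂ * (n : ℝ) ^ 2 + P.α₂ + 4 / P.σ ^ 2 * (P.c₂ / P.β₂) * (n : ℝ) ^ (-4 : ℤ)
              + 8 / P.σ ^ 4 * (P.c₂ / P.β₂ ^ 2) * (P.μ - P.α₂ * P.σ ^ 2) * (n : ℝ) ^ (-6 : ℤ))
            (fun n => (n : ℝ) ^ (-8 : ℤ)) ∧
        LargeRootsExpansion φ q
            (fun n => P.β₁ * (n : ℝ) ^ 2 + P.α₁ + 4 / P.σ ^ 2 * (P.c₁ / P.β₁) * (n : ℝ) ^ (-4 : ℤ)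
              + 8 / P.σ ^ 4 * (P.c₁ / P.β₁ ^ 2) * ((-P.μ) - P.α₁ * P.σ ^ 2) * (n : ℝ) ^ (-6 : ℤ))
            (fun n => (n : ℝ) ^ (-8 : ℤ))) ∧
      (P.σ = 0 → P.μ ≠ 0 → ∀ γ : ℝ, closedHalf P P.μ γ 0 = 0 →
        LargeRootsExpansion (fun z => φ (-z)) q
            (fun n => P.β₂ * (n : ℝ) ^ 2 + P.α₂ - 2 * P.c₂ / P.μ * (n : ℝ) ^ (-2 : ℤ)
              + 2 / P.μ ^ 2 * (P.c₂ / P.β₂) * (P.μ * P.α₂ + γ + q) * (n : ℝ) ^ (-4 : ℤ))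
            (fun n => (n : ℝ) ^ (-5 : ℤ)) ∧
        LargeRootsExpansion φ q
            (fun n => P.β₁ * (n : ℝ) ^ 2 + P.α₁ - 2 * P.c₁ / (-P.μ) * (n : ℝ) ^ (-2 : ℤ)
              + 2 / (-P.μ) ^ 2 * (P.c₁ / P.β₁) * ((-P.μ) * P.α₁ + γ + q) * (n : ℝ) ^ (-4 : ℤ))
            (fun n => (n : ℝ) ^ (-5 : ℤ)))) ∧
    -- the family with singularity of order 1
    (∀ φ : ℂ → ℂ, IsLaplaceExponent P 1 φ →
      (P.σ ≠ 0 →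
        LargeRootsExpansion (fun z => φ (-z)) q
            (fun n => P.β₂ * (n : ℝ) ^ 2 + P.α₂ + 4 / P.σ ^ 2 * (P.c₂ / P.β₂) * (n : ℝ) ^ (-3 : ℤ)
              + 8 / P.σ ^ 4 * (P.c₂ / P.β₂ ^ 2) * (P.μ - P.α₂ * P.σ ^ 2) * (n : ℝ) ^ (-5 : ℤ)
              + 16 / P.σ ^ 4 * (P.c₂ * (P.c₁ + P.c₂) / P.β₂ ^ 3) * ((n : ℝ) ^ (-7 : ℤ) * Real.log n))
            (fun n => (n : ℝ) ^ (-7 : ℤ)) ∧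
        LargeRootsExpansion φ q
            (fun n => P.β₁ * (n : ℝ) ^ 2 + P.α₁ + 4 / P.σ ^ 2 * (P.c₁ / P.β₁) * (n : ℝ) ^ (-3 : ℤ)
              + 8 / P.σ ^ 4 * (P.c₁ / P.β₁ ^ 2) * ((-P.μ) - P.α₁ * P.σ ^ 2) * (n : ℝ) ^ (-5 : ℤ)
              + 16 / P.σ ^ 4 * (P.c₁ * (P.c₁ + P.c₂) / P.β₁ ^ 3) * ((n : ℝ) ^ (-7 : ℤ) * Real.log n))
            (fun n => (n : ℝ) ^ (-7 : ℤ))) ∧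
      (P.σ = 0 → P.μ ≠ 0 → ∀ γ : ℝ, closedOne P P.μ γ 0 = 0 →
        LargeRootsExpansion (fun z => φ (-z)) q
            (fun n => P.β₂ * (n : ℝ) ^ 2 + P.α₂ - 2 * P.c₂ / P.μ * (n : ℝ) ^ (-1 : ℤ)
              + 2 / P.μ ^ 2 * (P.c₂ / P.β₂) *
                (2 * (P.c₁ + P.c₂) * Real.log n + (P.μ * P.α₂ - γ + q + P.c₁ * Real.log (P.β₂ / P.β₁))) *
                (n : ℝ) ^ (-3 : ℤ))
            (fun n => (n : ℝ) ^ (-4 : ℤ) * Real.log n) ∧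
        LargeRootsExpansion φ q
            (fun n => P.β₁ * (n : ℝ) ^ 2 + P.α₁ - 2 * P.c₁ / (-P.μ) * (n : ℝ) ^ (-1 : ℤ)
              + 2 / (-P.μ) ^ 2 * (P.c₁ / P.β₁) *
                (2 * (P.c₁ + P.c₂) * Real.log n + ((-P.μ) * P.α₁ - γ + q + P.c₂ * Real.log (P.β₁ / P.β₂))) *
                (n : ℝ) ^ (-3 : ℤ))
            (fun n => (n : ℝ) ^ (-4 : ℤ) * Real.log n))) ∧
    -- the family with singularity of order 3/2
    (∀ φ : ℂ → ℂ, IsLaplaceExponent P (3 / 2) φ →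
      (P.σ ≠ 0 →
        LargeRootsExpansion (fun z => φ (-z)) q
            (fun n => P.β₂ * (n : ℝ) ^ 2 + P.α₂ + 4 / P.σ ^ 2 * (P.c₂ / P.β₂) * (n : ℝ) ^ (-2 : ℤ)
              + 8 / P.σ ^ 4 * (P.c₂ / P.β₂ ^ 2) * (P.μ - P.α₂ * P.σ ^ 2) * (n : ℝ) ^ (-4 : ℤ)
              + 8 * Real.pi / P.σ ^ 4 * (P.c₁ * P.c₂ / (P.β₂ ^ 2 * √(P.β₁ * P.β₂))) * (n : ℝ) ^ (-5 : ℤ))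
            (fun n => (n : ℝ) ^ (-6 : ℤ)) ∧
        LargeRootsExpansion φ q
            (fun n => P.β₁ * (n : ℝ) ^ 2 + P.α₁ + 4 / P.σ ^ 2 * (P.c₁ / P.β₁) * (n : ℝ) ^ (-2 : ℤ)
              + 8 / P.σ ^ 4 * (P.c₁ / P.β₁ ^ 2) * ((-P.μ) - P.α₁ * P.σ ^ 2) * (n : ℝ) ^ (-4 : ℤ)
              + 8 * Real.pi / P.σ ^ 4 * (P.c₁ * P.c₂ / (P.β₁ ^ 2 * √(P.β₁ * P.β₂))) * (n : ℝ) ^ (-5 : ℤ))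
            (fun n => (n : ℝ) ^ (-6 : ℤ))) ∧
      (P.σ = 0 → P.μ ≠ 0 →
        LargeRootsExpansion (fun z => φ (-z)) q
            (fun n => P.β₂ * (n : ℝ) ^ 2 + P.α₂ - 2 * P.c₂ / P.μ
              + 2 * Real.pi / P.μ ^ 2 * (P.c₁ * P.c₂ / √(P.β₁ * P.β₂)) * (n : ℝ) ^ (-1 : ℤ))
            (fun n => (n : ℝ) ^ (-2 : ℤ)) ∧
        LargeRootsExpansion φ q
            (fun n => P.β₁ * (n : ℝ) ^ 2 + P.α₁ - 2 * P.c₁ / (-P.μ)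
              + 2 * Real.pi / (-P.μ) ^ 2 * (P.c₁ * P.c₂ / √(P.β₁ * P.β₂)) * (n : ℝ) ^ (-1 : ℤ))
            (fun n => (n : ℝ) ^ (-2 : ℤ)))) ∧
    -- the family with singularity of order 2
    (∀ φ : ℂ → ℂ, IsLaplaceExponent P 2 φ →
      (P.σ ≠ 0 →
        LargeRootsExpansion (fun z => φ (-z)) q
            (fun n => P.β₂ * (n : ℝ) ^ 2 + P.α₂ + 4 / P.σ ^ 2 * (P.c₂ / P.β₂) * (n : ℝ) ^ (-1 : ℤ))
            (fun n => (n : ℝ) ^ (-3 : ℤ) * Real.log n) ∧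
        LargeRootsExpansion φ q
            (fun n => P.β₁ * (n : ℝ) ^ 2 + P.α₁ + 4 / P.σ ^ 2 * (P.c₁ / P.β₁) * (n : ℝ) ^ (-1 : ℤ))
            (fun n => (n : ℝ) ^ (-3 : ℤ) * Real.log n))) ∧
    -- the family with singularity of order 5/2
    (∀ φ : ℂ → ℂ, IsLaplaceExponent P (5 / 2) φ →
      (P.σ ≠ 0 →
        LargeRootsExpansion (fun z => φ (-z)) q
            (fun n => P.β₂ * (n : ℝ) ^ 2 + P.α₂ + 4 / P.σ ^ 2 * (P.c₂ / P.β₂)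
              - 8 * Real.pi / P.σ ^ 4 * (P.c₁ * P.c₂ / (P.β₁ * P.β₂) ^ (3 / 2 : ℝ)) * (n : ℝ) ^ (-1 : ℤ))
            (fun n => (n : ℝ) ^ (-2 : ℤ)) ∧
        LargeRootsExpansion φ q
            (fun n => P.β₁ * (n : ℝ) ^ 2 + P.α₁ + 4 / P.σ ^ 2 * (P.c₁ / P.β₁)
              - 8 * Real.pi / P.σ ^ 4 * (P.c₁ * P.c₂ / (P.β₁ * P.β₂) ^ (3 / 2 : ℝ)) * (n : ℝ) ^ (-1 : ℤ))
            (fun n => (n : ℝ) ^ (-2 : ℤ))) ∧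
      (P.σ = 0 → ∀ ρ γ : ℝ, closedFiveHalves P ρ γ 0 = 0 →
        HasDerivAt (closedFiveHalves P ρ γ) (-Complex.I * P.μ) 0 →
        LargeRootsExpansion (fun z => φ (-z)) q
            (fun n => P.β₂ *
                ((n : ℝ) + 1 / Real.pi *
                  Real.arctan (P.c₂ * P.β₁ ^ (3 / 2 : ℝ) / (P.c₁ * P.β₂ ^ (3 / 2 : ℝ)))) ^ 2
              + P.α₂ + 2 * ρ / Real.pi ^ 2 *
                (P.c₂ * P.β₂ ^ 2 * P.β₁ ^ 3 / (P.c₁ ^ 2 * P.β₂ ^ 3 + P.c₂ ^ 2 * P.β₁ ^ 3)))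
            (fun n => (n : ℝ) ^ (-1 : ℤ)) ∧
        LargeRootsExpansion φ q
            (fun n => P.β₁ *
                ((n : ℝ) + 1 / Real.pi *
                  Real.arctan (P.c₁ * P.β₂ ^ (3 / 2 : ℝ) / (P.c₂ * P.β₁ ^ (3 / 2 : ℝ)))) ^ 2
              + P.α₁ + 2 * (-ρ) / Real.pi ^ 2 *
                (P.c₁ * P.β₁ ^ 2 * P.β₂ ^ 3 / (P.c₂ ^ 2 * P.β₁ ^ 3 + P.c₁ ^ 2 * P.β₂ ^ 3)))
            (fun n => (n : ℝ) ^ (-1 : ℤ)))) := by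
  have zero := fun m (hm : m ≤ 2) => existsUnique_isLaplaceExponent P (m := m) (h := 0)
    (by norm_num) (by omega) (levyCutoff_zero hm)
  have one := fun m (hm : 3 ≤ m) (hm' : m ≤ 4) => existsUnique_isLaplaceExponent P (m := m) (h := 1)
    (by norm_num) (by omega) (levyCutoff_one hm)
  -- Each expansion for `φ` is the one for `φ(-·)` of the dual process.
  have hdual : ∀ {φ : ℂ → ℂ} {a e : ℕ → ℝ},
      LargeRootsExpansion (fun z => (fun z => φ (-z)) (-z)) q a e →
        LargeRootsExpansion φ q a e := by
    intro φ a e h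
    simpa only [neg_neg] using h
  refine ⟨?_, fun φ hφ => ⟨fun hσ => ⟨largeRootsExpansion_half_gaussian hφ hq hσ, ?_⟩,
      fun hσ hμ γ hγ => ?_⟩, fun φ hφ => ⟨fun hσ => ⟨largeRootsExpansion_one_gaussian hφ hq hσ, ?_⟩,
      fun hσ hμ γ hγ => ?_⟩,
      fun φ hφ => ⟨fun hσ => ⟨largeRootsExpansion_threeHalves_gaussian hφ hq hσ, ?_⟩,
      fun hσ hμ => ⟨largeRootsExpansion_threeHalves_drift hφ hq hσ hμ, ?_⟩⟩,
      fun φ hφ hσ => ⟨largeRootsExpansion_two_gaussian hφ hq hσ, ?_⟩, fun φ hφ => ⟨fun hσ => ?_,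
      fun hσ ρ γ _ hρ => ?_⟩⟩
  · rintro χ (rfl | rfl | rfl | rfl | rfl)
    · simpa using zero 0 (by norm_num)
    · simpa using zero 1 (by norm_num)
    · convert zero 2 (by norm_num) using 3; norm_num
    · convert one 3 (by norm_num) (by norm_num) using 3; norm_num
    · convert one 4 (by norm_num) (by norm_num) using 3; norm_num
  · exact hdual (largeRootsExpansion_half_gaussian hφ.swap hq hσ)
  · obtain rfl := eq_halfConst_of_closedHalf hγ
    refine ⟨largeRootsExpansion_half_drift hφ hq hσ hμ, ?_⟩
    rw [← P.halfConst_swap]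
    exact hdual (largeRootsExpansion_half_drift hφ.swap hq hσ (neg_ne_zero.2 hμ))
  · refine (hdual (largeRootsExpansion_one_gaussian hφ.swap hq hσ)).congr
      (Filter.Eventually.of_forall fun n => ?_) Filter.EventuallyEq.rfl
    simp only [ThetaParams.swap]
    ring
  · obtain ⟨C₁, hC₁⟩ := exists_tendsto_logDiff (div_pos P.α₁_pos P.β₁_pos)
    obtain ⟨C₂, hC₂⟩ := exists_tendsto_logDiff (div_pos P.α₂_pos P.β₂_pos)
    obtain rfl := eq_of_closedOne hγ hC₁ hC₂
    refine ⟨largeRootsExpansion_one_drift hφ hq hσ hμ hC₁ hC₂, ?_⟩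
    refine (hdual (largeRootsExpansion_one_drift hφ.swap hq hσ (neg_ne_zero.2 hμ) hC₂ hC₁)).congr
      (Filter.Eventually.of_forall fun n => ?_) Filter.EventuallyEq.rfl
    simp only [ThetaParams.swap]
    ring
  · refine (hdual (largeRootsExpansion_threeHalves_gaussian hφ.swap hq hσ)).congr
      (Filter.Eventually.of_forall fun n => ?_) Filter.EventuallyEq.rfl
    simp only [ThetaParams.swap, mul_comm P.β₂ P.β₁]
    ring
  · refine (hdual (largeRootsExpansion_threeHalves_drift hφ.swap hq hσ (neg_ne_zero.2 hμ))).congr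
      (Filter.Eventually.of_forall fun n => ?_) Filter.EventuallyEq.rfl
    simp only [ThetaParams.swap, mul_comm P.β₂ P.β₁]
    ring
  · exact hdual (largeRootsExpansion_two_gaussian hφ.swap hq hσ)
  · refine ⟨largeRootsExpansion_fiveHalves_gaussian hφ hq hσ,
      (hdual (largeRootsExpansion_fiveHalves_gaussian hφ.swap hq hσ)).congr
        (Filter.Eventually.of_forall fun n => ?_) Filter.EventuallyEq.rfl⟩
    simp only [ThetaParams.swap, mul_comm P.β₂ P.β₁]
    ring
  · obtain rfl := eq_driftConst_of_hasDerivAt hρ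
    refine ⟨largeRootsExpansion_fiveHalves_drift hφ hq hσ, ?_⟩
    rw [← P.driftConst_swap]
    exact hdual (largeRootsExpansion_fiveHalves_drift hφ.swap hq hσ)
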